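/- **Setting.** Fix $n\ge 0$ and $\mathbf v=(v_1,\dots,v_n)\in\mathbb Z_{\ge0}^n$, put $V=\sum_a v_a$, and let $\operatorname{Seq}(\mathbf v)$ be the set of words $\mathbf i=(i_1,\dots,i_V)$ in $\{1,\dots,n\}$ in which each letter $a$ occurs exactly $v_a$ times, ordered lexicographically. Strands with label $n$ are called red, the others black. Let $\tilde T=\tilde T_{\mathbf v}$ be the KLRW algebra: the unital $\mathbb C$-algebra generated by $e(\mathbf i)$ ($\mathbf i\in\operatorname{Seq}(\mathbf v)$), dots $y_1,\dots,y_V$ and crossings $\psi_1,\dots,\psi_{V-1}$, subject to the following relations, where $s_k\mathbf i$ is $\mathbf i$ with $i_k,i_{k+1}$ interchanged. * $e(\mathbf i)e(\mathbf j)=\delta_{\mathbf i\mathbf j}e(\mathbf i)$, $\sum_{\mathbf i} e(\mathbf i)=1$, $y_ke(\mathbf i)=e(\mathbf i)y_k$, $\psi_ke(\mathbf i)=e(s_k\mathbf i)\psi_k$, and $\psi_ke(\mathbf i)=0$ if $i_k=i_{k+1}=n$ (red strands do not cross); * $y_ky_l=y_ly_k$; $y_l\psi_k=\psi_ky_l$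 for $l\ne k,k+1$; $\psi_k\psi_l=\psi_l\psi_k$ for $|k-l|>1$; * if $i_k\ne i_{k+1}$: $y_k\psi_ke(\mathbf i)=\psi_ky_{k+1}e(\mathbf i)$ and $y_{k+1}\psi_ke(\mathbf i)=\psi_ky_ke(\mathbf i)$; * if $i_k=i_{k+1}\neq n$: $(y_k\psi_k-\psi_ky_{k+1})e(\mathbf i)=e(\mathbf i)=(\psi_ky_k-y_{k+1}\psi_k)e(\mathbf i)$; * $\psi_k^2e(\mathbf i)$ equals $0$ if $i_k=i_{k+1}$; $(y_{k+1}-y_k)e(\mathbf i)$ if $i_k=i_{k+1}-1$; $(y_k-y_{k+1})e(\mathbf i)$ if $i_k=i_{k+1}+1$; and $e(\mathbf i)$ otherwise; * $(\psi_k\psi_{k+1}\psi_k-\psi_{k+1}\psi_k\psi_{k+1})e(\mathbf i)$ equals $e(\mathbf i)$ if $i_k=i_{k+2}=i_{k+1}+1\ne n$; $-e(\mathbf i)$ if $i_k=i_{k+2}=i_{k+1}-1$; and $0$ otherwise. The algebra is graded by $\deg e(\mathbf i)=0$, $\deg y_k=2$, and $\deg\psi_ke(\mathbf i)=-2$, $1$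 or $0$ according to whether $i_k=i_{k+1}$, $|i_k-i_{k+1}|=1$, or neither. (The full KLRW algebra is the direct sum of the $\tilde T_{\mathbf v}$ over all $\mathbf v$.) A word $\mathbf i\in\operatorname{Seq}(\mathbf v)$ is *red-good* if there is a simple $\tilde T$-module $L$ such that $\mathbf i$ is the lexicographically smallest word with $e(\mathbf i)L\ne0$. For a word $\mathbf i$, the *standard module* $\bar\Delta(\mathbf i)$ is the universal left $\tilde T$-module generated by a vector $v$ with $e(\mathbf i)v=v$, $\psi_kv=0$ for every $k$ with $i_k-1=i_{k+1}$, and $y_kv=0$ for all $k$; it is graded with $\deg v=0$. **Theorem.** 0. A word is red-good if and only if it is a concatenation $a_1\cdots a_p\,b_1\cdots b_{v_n}$ of words $a_r$ of the form $(k,k-1,\dots,k-s)$ with $0\le s<k\le n-1$ and words $b_r$ of the form $(n,n-1,\dots,n-s)$ with $0\le s<n$, such that $a_1\le\dots\le a_p$ lexicographically, where a proper prefix of a word counts as larger than the word. (For $n=0$, the only word, the empty one, is red-good.) 1. For each red-good word $\mathbf i$, the module $\bar\Delta(\mathbf i)$ has a unique maximal submodule, hence a unique simple quotient $L(\mathbf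 i)$; this is a graded simple module, with the grading induced from $\bar\Delta(\mathbf i)$. 2. The modules $L(\mathbf i)$, $\mathbf i$ red-good, are a complete irredundant list of the graded simple $\tilde T$-modules up to isomorphism and grading shift: each $\mathbb Z$-graded $\tilde T$-module that is nonzero and has no homogeneous submodules other than $0$ and itself is isomorphic, as a graded module, to a shift of some $L(\mathbf i)$ with $\mathbf i$ red-good, and if $L(\mathbf i)\cong L(\mathbf j)$ as (ungraded) modules, for $\mathbf i,\mathbf j$ red-good, then $\mathbf i=\mathbf j$. 3. For each red-good $\mathbf i$, the kernel of $\bar\Delta(\mathbf i)\to L(\mathbf i)$ has finite length, and each of its composition factors is isomorphic to $L(\mathbf j)$ for some red-good $\mathbf j>\mathbf i$ in the lexicographic order. -/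

import Mathlib

noncomputable section

namespace KLRW

/-! Strands carry labels in `[1, n]`; the label `ℓ` is encoded as the element `ℓ - 1` of `Fin n`.
Strands with label `n` are red, all others are black. -/

/-- The label `n`, i.e. the colour red. -/
def IsRed {n : ℕ} (a : Fin n) : Prop := (a : ℕ) + 1 = n

/-- The total number of strands. -/
abbrev size {n : ℕ} (v : Fin n → ℕ) : ℕ := ∑ a, v a

/-- `Seq(v)`: the words in which each letter `a` appears exactly `v a` times. -/
def Words {n : ℕ} (v : Fin n → ℕ) : Type :=
  {w : Fin (size v) → Fin n // ∀ a, (Finset.univ.filter fun k => w k = a).card = v a}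

instance {n : ℕ} (v : Fin n → ℕ) : Fintype (Words v) := by
  unfold Words; infer_instance

instance {n : ℕ} (v : Fin n → ℕ) : DecidableEq (Words v) := by
  unfold Words; infer_instance

/-- Left strand of the `k`-th pair of neighbouring strands. -/
def lft {V : ℕ} (k : Fin (V - 1)) : Fin V := ⟨k, by omega⟩

/-- Right strand of the `k`-th pair of neighbouring strands. -/
def rgt {V : ℕ} (k : Fin (V - 1)) : Fin V := ⟨k + 1, by omega⟩

/-- The word with the letters in positions `k`, `k + 1` interchanged. -/
def Words.swap {n : ℕ} {v : Fin n → ℕ} (i : Words v) (k : Fin (size v - 1)) : Words v :=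
  ⟨fun m => i.1 (Equiv.swap (lft k) (rgt k) m), fun a => by
    rw [← i.2 a]
    refine Finset.card_bij (fun m _ => Equiv.swap (lft k) (rgt k) m) ?_ ?_ ?_
    · intro m hm
      simpa using hm
    · intro m _ m' _ h
      exact (Equiv.swap (lft k) (rgt k)).injective h
    · intro m hm
      exact ⟨Equiv.swap (lft k) (rgt k) m, by simpa using hm, by simp⟩⟩

/-- Strict lexicographic order on words. -/
def Words.LexLT {n : ℕ} {v : Fin n → ℕ} (i j : Words v) : Prop := toLex i.1 < toLex j.1

/-- Both strands of the `k`-th pair of neighbours are red at the word `i`; such strands may not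
be crossed. -/
def Words.RedPair {n : ℕ} {v : Fin n → ℕ} (i : Words v) (k : Fin (size v - 1)) : Prop :=
  IsRed (i.1 (lft k)) ∧ IsRed (i.1 (rgt k))

/-- Generators: the idempotents `e(i)`, the dots `y_k` and the crossings `ψ_k`.  Here `y_k` and
`ψ_k` are sums over all bottom words, so that the elementary Stendhal diagrams are
`e(i)`, `y_k e(i)` and `ψ_k e(i)`. -/
inductive Gen {n : ℕ} (v : Fin n → ℕ) : Type
  | idem (i : Words v)
  | dot (k : Fin (size v))
  | cross (k : Fin (size v - 1))

/-- The free algebra on the generators. -/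
abbrev Free {n : ℕ} (v : Fin n → ℕ) : Type := FreeAlgebra ℂ (Gen v)

section
variable {n : ℕ} {v : Fin n → ℕ}

/-- `e(i)` in the free algebra. -/
abbrev fe (i : Words v) : Free v := FreeAlgebra.ι ℂ (Gen.idem i)
/-- `y_k` in the free algebra. -/
abbrev fy (k : Fin (size v)) : Free v := FreeAlgebra.ι ℂ (Gen.dot k)
/-- `ψ_k` in the free algebra. -/
abbrev fψ (k : Fin (size v - 1)) : Free v := FreeAlgebra.ι ℂ (Gen.cross k)

end

/-- Relations of the KLRW algebra `T̃_v`.  A product `a * b` is the diagram `a` stacked on top of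
the diagram `b`; the word in `e(i)` on the right is read at the bottom. -/
inductive Rel {n : ℕ} (v : Fin n → ℕ) : Free v → Free v → Prop
  -- composition of diagrams: a composite is zero unless the words match
  | idem_self (i : Words v) : Rel v (fe i * fe i) (fe i)
  | idem_ne (i j : Words v) : i ≠ j → Rel v (fe i * fe j) 0
  | idem_sum : Rel v (∑ i, fe i) 1
  | dot_idem (k : Fin (size v)) (i : Words v) : Rel v (fy k * fe i) (fe i * fy k)
  | cross_idem (k : Fin (size v - 1)) (i : Words v) :
      Rel v (fψ k * fe i) (fe (i.swap k) * fψ k)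
  -- there is no crossing of two red strands
  | cross_red (k : Fin (size v - 1)) (i : Words v) : i.RedPair k → Rel v (fψ k * fe i) 0
  -- planar isotopy
  | dot_dot (k l : Fin (size v)) : Rel v (fy k * fy l) (fy l * fy k)
  | dot_cross_far (l : Fin (size v)) (k : Fin (size v - 1)) : l ≠ lft k → l ≠ rgt k →
      Rel v (fy l * fψ k) (fψ k * fy l)
  | cross_cross_far (k l : Fin (size v - 1)) : (k : ℕ) + 1 < l →
      Rel v (fψ k * fψ l) (fψ l * fψ k)
  -- dots slide through crossings of strands with different labels
  | slide_left (k : Fin (size v - 1)) (i : Words v) : i.1 (lft k) ≠ i.1 (rgt k) →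
      Rel v (fy (lft k) * fψ k * fe i) (fψ k * fy (rgt k) * fe i)
  | slide_right (k : Fin (size v - 1)) (i : Words v) : i.1 (lft k) ≠ i.1 (rgt k) →
      Rel v (fy (rgt k) * fψ k * fe i) (fψ k * fy (lft k) * fe i)
  -- nilHecke relations for two black strands with the same label
  | nil_left (k : Fin (size v - 1)) (i : Words v) : i.1 (lft k) = i.1 (rgt k) → ¬ i.RedPair k →
      Rel v ((fy (lft k) * fψ k - fψ k * fy (rgt k)) * fe i) (fe i)
  | nil_right (k : Fin (size v - 1)) (i : Words v) : i.1 (lft k) = i.1 (rgt k) → ¬ i.RedPair k →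
      Rel v ((fψ k * fy (lft k) - fy (rgt k) * fψ k) * fe i) (fe i)
  -- bigons
  | bigon_eq (k : Fin (size v - 1)) (i : Words v) : i.1 (lft k) = i.1 (rgt k) →
      Rel v (fψ k * fψ k * fe i) 0
  | bigon_far (k : Fin (size v - 1)) (i : Words v) : i.1 (lft k) ≠ i.1 (rgt k) →
      (i.1 (lft k) : ℕ) + 1 ≠ i.1 (rgt k) → (i.1 (rgt k) : ℕ) + 1 ≠ i.1 (lft k) →
      Rel v (fψ k * fψ k * fe i) (fe i)
  | bigon_up (k : Fin (size v - 1)) (i : Words v) : (i.1 (lft k) : ℕ) + 1 = i.1 (rgt k) →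
      Rel v (fψ k * fψ k * fe i) ((fy (rgt k) - fy (lft k)) * fe i)
  | bigon_down (k : Fin (size v - 1)) (i : Words v) : (i.1 (rgt k) : ℕ) + 1 = i.1 (lft k) →
      Rel v (fψ k * fψ k * fe i) ((fy (lft k) - fy (rgt k)) * fe i)
  -- triple points; the bottom word reads `(a, b, c)` at the positions `k, k + 1, k + 2`.
  -- If two of the three strands are red, these diagrams do not exist.
  | triple_down (k l : Fin (size v - 1)) (i : Words v) : (l : ℕ) = k + 1 →
      i.1 (lft k) = i.1 (rgt l) → (i.1 (rgt k) : ℕ) + 1 = i.1 (lft k) → ¬ IsRed (i.1 (lft k)) →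
      Rel v ((fψ k * fψ l * fψ k - fψ l * fψ k * fψ l) * fe i) (fe i)
  | triple_up (k l : Fin (size v - 1)) (i : Words v) : (l : ℕ) = k + 1 →
      i.1 (lft k) = i.1 (rgt l) → (i.1 (lft k) : ℕ) + 1 = i.1 (rgt k) →
      Rel v ((fψ k * fψ l * fψ k - fψ l * fψ k * fψ l) * fe i) (-fe i)
  | triple_far (k l : Fin (size v - 1)) (i : Words v) : (l : ℕ) = k + 1 →
      ¬ (i.1 (lft k) = i.1 (rgt l) ∧
        ((i.1 (rgt k) : ℕ) + 1 = i.1 (lft k) ∨ (i.1 (lft k) : ℕ) + 1 = i.1 (rgt k))) →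
      Rel v ((fψ k * fψ l * fψ k - fψ l * fψ k * fψ l) * fe i) 0

/-- The KLRW algebra `T̃_v`. -/
abbrev T {n : ℕ} (v : Fin n → ℕ) : Type := RingQuot (Rel v)

section
variable {n : ℕ} {v : Fin n → ℕ}

/-- `e(i)`. -/
def e (i : Words v) : T v := RingQuot.mkAlgHom ℂ (Rel v) (fe i)
/-- The dot `y_k`. -/
def y (k : Fin (size v)) : T v := RingQuot.mkAlgHom ℂ (Rel v) (fy k)
/-- The crossing `ψ_k`. -/
def ψ (k : Fin (size v - 1)) : T v := RingQuot.mkAlgHom ℂ (Rel v) (fψ k)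

/-- Degree of a crossing of strands with labels `a`, `b`. -/
def crossDeg (a b : Fin n) : ℤ :=
  if a = b then -2 else if (a : ℕ) + 1 = b ∨ (b : ℕ) + 1 = a then 1 else 0

/-- `IsDiagram x i d`: `x` is the class of a Stendhal diagram of degree `d` whose top word
is `i`, built from bottom to top out of dots and crossings. -/
inductive IsDiagram : T v → Words v → ℤ → Prop
  | idem (i : Words v) : IsDiagram (e i) i 0
  | dot (k : Fin (size v)) {x : T v} {i : Words v} {d : ℤ} :
      IsDiagram x i d → IsDiagram (y k * x) i (d + 2)
  | cross (k : Fin (size v - 1)) {x : T v} {i : Words v} {d : ℤ} : ¬ i.RedPair k →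
      IsDiagram x i d →
      IsDiagram (ψ k * x) (i.swap k) (d + crossDeg (i.1 (lft k)) (i.1 (rgt k)))

end

/-- The homogeneous part of degree `d` of `T̃_v`: the span of the diagrams of degree `d`. -/
def component {n : ℕ} (v : Fin n → ℕ) (d : ℤ) : Submodule ℂ (T v) :=
  Submodule.span ℂ {x | ∃ i, IsDiagram x i d}

section
variable {n : ℕ} {v : Fin n → ℕ}

/-- A graded module is graded simple if it is nonzero and has no homogeneous submodules
besides `0` and itself. -/
def IsGradedSimple {M : Type*} [AddCommGroup M] [Module ℂ M] [Module (T v) M]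
    (ℳ : ℤ → Submodule ℂ M) [DirectSum.Decomposition ℳ] : Prop :=
  Nontrivial M ∧ ∀ N : Submodule (T v) M, N.IsHomogeneous ℳ → N = ⊥ ∨ N = ⊤

/-- A word `i` is red-good if there is a simple module `L` such that `i` is lexicographically
minimal among the words `j` with `e(j) L ≠ 0`. -/
def IsRedGood (i : Words v) : Prop :=
  ∃ (L : Type) (_ : AddCommGroup L) (_ : Module (T v) L), IsSimpleModule (T v) L ∧
    (∃ x : L, e i • x ≠ 0) ∧ ∀ j : Words v, (∃ x : L, e j • x ≠ 0) → i = j ∨ i.LexLT j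

/-- The left ideal generated by the relations `e(i) v = v`, `ψ_k v = 0` whenever
`i_k - 1 = i_{k+1}`, and `y_k v = 0` for all `k`. -/
def standardIdeal (i : Words v) : Submodule (T v) (T v) :=
  Submodule.span (T v) ({1 - e i} ∪
    {x | ∃ k : Fin (size v - 1), (i.1 (rgt k) : ℕ) + 1 = i.1 (lft k) ∧ x = ψ k} ∪
    {x | ∃ k : Fin (size v), x = y k})

/-- The standard module `Δ̄(i)`: the universal module on a generator satisfying these relations. -/
abbrev Standard (i : Words v) : Type := T v ⧸ standardIdeal i

/-- The intersection of all maximal submodules of `Δ̄(i)`; this is the maximal submodule if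
there is only one. -/
def kernel (i : Words v) : Submodule (T v) (Standard i) := Module.jacobson (T v) (Standard i)

/-- The quotient `L(i)` of `Δ̄(i)`. -/
abbrev L (i : Words v) : Type := Standard i ⧸ kernel i

/-- The image in `L(i)` of the generator of `Δ̄(i)`. -/
def generator (i : Words v) : L i := (kernel i).mkQ ((standardIdeal i).mkQ 1)

/-- The grading of `L(i)` for which the generator has degree `0`. -/
def L.component (i : Words v) (d : ℤ) : Submodule ℂ (L i) :=
  (KLRW.component v d).map
    ((LinearMap.toSpanSingleton (T v) (L i) (generator i)).restrictScalars ℂ)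

/-- The word `i` as a list of labels in `[1, n]`. -/
def Words.toList (i : Words v) : List ℕ := List.ofFn fun k => (i.1 k : ℕ) + 1

/-- The word `(k, k - 1, …, k - p)`, for the pair `(k, p)`. -/
def segment (a : ℕ × ℕ) : List ℕ := (List.range (a.2 + 1)).map fun t => a.1 - t

/-- The word `i` is a concatenation `a_1 ⋯ a_p b_1 ⋯ b_q`, where the `a`'s are words
`(k, k - 1, …, k - p)` with `p < k < n` that increase weakly in the lexicographic order (in which
a proper prefix of a word is larger than that word), and the `b`'s are words
`(n, n - 1, …, n - p)` with `p < n`, in any order. (As each `b` has exactly one letter `n`,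
`q` is the number of letters `n` in `i`.) -/
def IsLyndonConcat (i : Words v) : Prop :=
  ∃ (as : List (ℕ × ℕ)) (bs : List ℕ),
    (∀ a ∈ as, a.2 < a.1 ∧ a.1 < n) ∧
    as.Pairwise (fun a a' => a.1 < a'.1 ∨ (a.1 = a'.1 ∧ a'.2 ≤ a.2)) ∧
    (∀ p ∈ bs, p < n) ∧
    i.toList = (as.map segment).flatten ++ (bs.map fun p => segment (n, p)).flatten

end

end KLRW

end

/-! This is a highest weight theory: words, ordered lexicographically, are the weights, and the
spaces `e(i) M` are the weight spaces.

Smallest words. Let `x` be a nonzero vector whose weight `i` is the smallest word of a module. Every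
crossing that leads to a smaller word kills `x`. By the bigon relations `i` can then descend by one
only (`descent_eq`), so it is a concatenation of runs `k, k - 1, …`, the segments. NilHecke
arguments exclude a segment followed by one with a smaller first letter
(`eq_zero_of_smaller_segment`), and two black segments with the same first letter of which the
second is longer (`eq_zero_of_longer_segment`). The latter uses an element `Phi` that exchanges two
equal segments and behaves like a nilHecke crossing with respect to the dots at their ends
(`TwoSegments.phi`). What remains are the words of the theorem.

Standard modules. For such a word, the standard module is spanned by the shuffles of the segments of
`i`, applied to the generator. This follows from a factorization of the algebra that imitates the
cosets of a symmetric group modulo the next smaller one (`mem_cosets_of_mem_alg`,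
`smul_mem_sup_span_Sh`). All shuffles lead to larger words, except the permutations of equal black
segments. These lead back to `i`; their degrees lie between `-2 * ell` and `0`, where `ell` counts
the pairs of equal black segments, and degree `0` belongs to the identity only (`Sh.lyn`). To a
nonzero homogeneous vector of weight `i` one applies exchanges of segments until all of them kill
the result. A staircase monomial of degree `2 * ell` in the dots at the ends of the segments does
not kill such a vector (`stairs_smul_ne_zero`), and by the degree bounds the outcome is a multiple
of the generator. Hence every nonzero vector of weight `i` generates the module (`exists_smul_eq`),
and the largest submodule without vectors of weight `i` is the only maximal one.

Nonvanishing. The algebra acts on the functions on the permutations of the strands, with dots acting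
diagonally (`permPres`). There, one vector satisfies the relations of the generator, except that
dots act on it by scalars that need not be zero. If `1` belonged to the left ideal that defines the
standard module, replacing dots by scalars would give an element of degree `-2` that fixes this
vector. Its powers contradict the lower bound for the degrees of the algebra (`mkQ_one_ne_zero`,
`Grading.bounded`).

Classification. In a graded simple module the same lower bound makes the dots nilpotent on
homogeneous vectors, so the smallest weight space contains a homogeneous vector killed by the dots,
which gives a map from a standard module. The smallest word of `L(i)` is `i`, hence irredundancy.
Standard modules are finite dimensional with nilpotent dots; a composition factor of the kernel has
no weight `≤ i`, so it is some `L(j)` with `j > i`.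

The relations are packaged as `Pres`, since they are needed for the algebra itself, for the coaction
that records degrees (`coact`) and for the permutation representation. -/

noncomputable section

namespace KLRW

/-! ### Generators and relations, indexed by natural numbers. -/

variable {n : ℕ} {v : Fin n → ℕ}

/-- The label in `[1, n]` at position `k`; `0` if there is no such position. -/
def Words.lab (i : Words v) (k : ℕ) : ℕ := if h : k < size v then (i.1 ⟨k, h⟩ : ℕ) + 1 else 0

/-- The word with the letters in positions `k`, `k + 1` interchanged, if these exist. -/
def Words.sw (i : Words v) (k : ℕ) : Words v := if h : k < size v - 1 then i.swap ⟨k, h⟩ else i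

/-- The dot `y_k`, or `0` if there is no such strand. -/
def Y (k : ℕ) : T v := if h : k < size v then y ⟨k, h⟩ else 0

/-- The crossing `ψ_k`, or `0` if there is no such crossing. -/
def cr (k : ℕ) : T v := if h : k < size v - 1 then ψ ⟨k, h⟩ else 0

theorem Words.lab_of_lt (i : Words v) {k : ℕ} (h : k < size v) :
    i.lab k = (i.1 ⟨k, h⟩ : ℕ) + 1 := by simp [lab, h]

theorem Words.lab_le (i : Words v) (k : ℕ) : i.lab k ≤ n := by
  unfold lab; split_ifs with h
  · exact (i.1 ⟨k, h⟩).2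
  · exact Nat.zero_le _

theorem Words.lab_pos (i : Words v) {k : ℕ} (h : k < size v) : 0 < i.lab k := by
  simp [lab, h]

theorem Words.lab_ext {i j : Words v} (h : ∀ k < size v, i.lab k = j.lab k) : i = j := by
  apply Subtype.ext
  funext k
  have := h k k.2
  rw [i.lab_of_lt k.2, j.lab_of_lt k.2] at this
  exact Fin.ext (by simpa using this)

theorem Words.lab_sw (i : Words v) {k : ℕ} (h : k + 1 < size v) (m : ℕ) :
    (i.sw k).lab m = i.lab (Equiv.swap k (k + 1) m) := by
  have hk : k < size v - 1 := by omega
  unfold sw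
  rw [dif_pos hk]
  by_cases hm : m < size v
  · rw [lab_of_lt _ hm]
    simp only [swap]
    by_cases h1 : m = k
    · subst h1
      have : (⟨m, hm⟩ : Fin (size v)) = lft ⟨m, hk⟩ := rfl
      rw [this, Equiv.swap_apply_left, Equiv.swap_apply_left, lab_of_lt _ h]
      rfl
    · by_cases h2 : m = k + 1
      · subst h2
        have : (⟨k + 1, hm⟩ : Fin (size v)) = rgt ⟨k, hk⟩ := rfl
        rw [this, Equiv.swap_apply_right, Equiv.swap_apply_right, lab_of_lt _ (by omega)]
        rfl
      · rw [Equiv.swap_apply_of_ne_of_ne, Equiv.swap_apply_of_ne_of_ne h1 h2, lab_of_lt _ hm]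
        · intro h; exact h1 (by simpa [lft] using congrArg Fin.val h)
        · intro h; exact h2 (by simpa [rgt] using congrArg Fin.val h)
  · rw [Equiv.swap_apply_of_ne_of_ne (by omega) (by omega)]
    simp [lab, hm]

theorem Words.lab_sw_left (i : Words v) {k : ℕ} (h : k + 1 < size v) :
    (i.sw k).lab k = i.lab (k + 1) := by rw [lab_sw _ h, Equiv.swap_apply_left]

theorem Words.lab_sw_right (i : Words v) {k : ℕ} (h : k + 1 < size v) :
    (i.sw k).lab (k + 1) = i.lab k := by rw [lab_sw _ h, Equiv.swap_apply_right]

theorem Words.lab_sw_of_ne (i : Words v) {k m : ℕ} (h1 : m ≠ k) (h2 : m ≠ k + 1) :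
    (i.sw k).lab m = i.lab m := by
  by_cases h : k + 1 < size v
  · rw [lab_sw _ h, Equiv.swap_apply_of_ne_of_ne h1 h2]
  · rw [sw, dif_neg (by omega)]

theorem Words.sw_sw (i : Words v) (k : ℕ) : (i.sw k).sw k = i := by
  by_cases h : k + 1 < size v
  · apply lab_ext
    intro m _
    rw [lab_sw _ h, lab_sw _ h, Equiv.swap_apply_self]
  · rw [sw, dif_neg (by omega), sw, dif_neg (by omega)]

theorem mk_rel {a b : Free v} (h : Rel v a b) :
    RingQuot.mkAlgHom ℂ (Rel v) a = RingQuot.mkAlgHom ℂ (Rel v) b :=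
  RingQuot.mkAlgHom_rel ℂ h

theorem e_mul_self (i : Words v) : e i * e i = e i := by
  simpa [e] using mk_rel (Rel.idem_self i)

theorem e_mul_ne {i j : Words v} (h : i ≠ j) : e i * e j = 0 := by
  simpa [e] using mk_rel (Rel.idem_ne i j h)

theorem sum_e : ∑ i : Words v, e i = 1 := by
  simpa [e] using mk_rel (Rel.idem_sum (v := v))

theorem Y_mul_e (k : ℕ) (i : Words v) : Y k * e i = e i * Y k := by
  unfold Y; split_ifs with h
  · simpa [e, y] using mk_rel (Rel.dot_idem ⟨k, h⟩ i)
  · simp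

theorem cr_mul_e (k : ℕ) (i : Words v) : cr k * e i = e (i.sw k) * cr k := by
  unfold cr Words.sw; split_ifs with h
  · simpa [e, ψ] using mk_rel (Rel.cross_idem ⟨k, h⟩ i)
  · simp

theorem cr_of_le {k : ℕ} (h : size v ≤ k + 1) : (cr k : T v) = 0 := by
  rw [cr, dif_neg (by omega)]

theorem Y_of_le {k : ℕ} (h : size v ≤ k) : (Y k : T v) = 0 := by
  rw [Y, dif_neg (by omega)]

theorem isRed_iff_lab (i : Words v) {k : ℕ} (h : k < size v) :
    IsRed (i.1 ⟨k, h⟩) ↔ i.lab k = n := by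
  rw [i.lab_of_lt h]; rfl

theorem cr_mul_e_red {k : ℕ} {i : Words v} (h1 : i.lab k = n) (h2 : i.lab (k + 1) = n) :
    cr k * e i = 0 := by
  unfold cr; split_ifs with h
  · have hrel := mk_rel (Rel.cross_red ⟨k, h⟩ i
      ⟨(isRed_iff_lab i _).2 h1, (isRed_iff_lab i _).2 h2⟩)
    simpa [e, ψ] using hrel
  · simp

theorem Y_mul_Y (k l : ℕ) : (Y k * Y l : T v) = Y l * Y k := by
  unfold Y; split_ifs with h h'
  · simpa [y] using mk_rel (Rel.dot_dot ⟨k, h⟩ ⟨l, h'⟩)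
  all_goals simp

theorem Y_mul_cr_far {k l : ℕ} (h1 : l ≠ k) (h2 : l ≠ k + 1) :
    (Y l * cr k : T v) = cr k * Y l := by
  unfold Y cr; split_ifs with h h'
  · simpa [y, ψ] using mk_rel (Rel.dot_cross_far (v := v) ⟨l, h⟩ ⟨k, h'⟩
      (by simpa [lft, Fin.ext_iff] using h1) (by simpa [rgt, Fin.ext_iff] using h2))
  all_goals simp

theorem cr_mul_cr_far {k l : ℕ} (h1 : k + 1 < l) : (cr k * cr l : T v) = cr l * cr k := by
  unfold cr; split_ifs with h h'
  · simpa [ψ] using mk_rel (Rel.cross_cross_far (v := v) ⟨k, h⟩ ⟨l, h'⟩ h1)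
  all_goals simp

theorem Fin_eq_iff_lab (i : Words v) {k l : ℕ} (h : k < size v) (h' : l < size v) :
    i.1 ⟨k, h⟩ = i.1 ⟨l, h'⟩ ↔ i.lab k = i.lab l := by
  rw [i.lab_of_lt h, i.lab_of_lt h', Fin.ext_iff]; omega


/-- The coefficient in the relation between a crossing and a dot at its left end. -/
def eps (i : Words v) (k : ℕ) : ℂ :=
  if k + 1 < size v ∧ i.lab k = i.lab (k + 1) ∧ i.lab k ≠ n then 1 else 0

/-- One formula for three cases: distinct labels (dots slide), equal black labels (nilHecke), and
equal red labels, where both products vanish with the crossing. -/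
theorem Y_mul_cr_left (k : ℕ) (i : Words v) :
    Y k * cr k * e i = cr k * Y (k + 1) * e i + eps i k • e i := by
  by_cases h : k + 1 < size v
  swap
  · simp [eps, h, cr_of_le (v := v) (k := k) (by omega)]
  have hk : k < size v - 1 := by omega
  by_cases hl : i.lab k = i.lab (k + 1)
  · by_cases hr : i.lab k = n
    · have h0 := cr_mul_e_red hr (hl ▸ hr)
      rw [mul_assoc, h0, mul_assoc, Y_mul_e, ← mul_assoc, h0]
      simp [eps, hr]
    · have hrel := mk_rel (Rel.nil_left ⟨k, hk⟩ i
        ((Fin_eq_iff_lab i (by omega) h).2 hl)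
        (fun hh => hr ((isRed_iff_lab i _).1 hh.1)))
      have : (Y k * cr k - cr k * Y (k + 1)) * e i = e i := by
        simpa [e, ψ, y, Y, cr, hk, h, (by omega : k < size v), lft, rgt] using hrel
      rw [sub_mul] at this
      rw [eps, if_pos ⟨h, hl, hr⟩, one_smul, ← sub_eq_iff_eq_add', this]
  · have hrel := mk_rel (Rel.slide_left ⟨k, hk⟩ i
        (fun hh => hl ((Fin_eq_iff_lab i (by omega) h).1 hh)))
    rw [eps, if_neg (by tauto), zero_smul, add_zero]
    simpa [e, ψ, y, Y, cr, hk, h, (by omega : k < size v), lft, rgt] using hrel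

theorem cr_mul_Y_left (k : ℕ) (i : Words v) :
    cr k * Y k * e i = Y (k + 1) * cr k * e i + eps i k • e i := by
  by_cases h : k + 1 < size v
  swap
  · simp [eps, h, cr_of_le (v := v) (k := k) (by omega)]
  have hk : k < size v - 1 := by omega
  by_cases hl : i.lab k = i.lab (k + 1)
  · by_cases hr : i.lab k = n
    · have h0 := cr_mul_e_red hr (hl ▸ hr)
      rw [mul_assoc, Y_mul_e, ← mul_assoc, h0, mul_assoc, h0]
      simp [eps, hr]
    · have hrel := mk_rel (Rel.nil_right ⟨k, hk⟩ i
        ((Fin_eq_iff_lab i (by omega) h).2 hl)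
        (fun hh => hr ((isRed_iff_lab i _).1 hh.1)))
      have : (cr k * Y k - Y (k + 1) * cr k) * e i = e i := by
        simpa [e, ψ, y, Y, cr, hk, h, (by omega : k < size v), lft, rgt] using hrel
      rw [sub_mul] at this
      rw [eps, if_pos ⟨h, hl, hr⟩, one_smul, ← sub_eq_iff_eq_add', this]
  · have hrel := mk_rel (Rel.slide_right ⟨k, hk⟩ i
        (fun hh => hl ((Fin_eq_iff_lab i (by omega) h).1 hh)))
    rw [eps, if_neg (by tauto), zero_smul, add_zero]
    simpa [e, ψ, y, Y, cr, hk, h, (by omega : k < size v), lft, rgt] using hrel.symm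

theorem cr_sq_eq {k : ℕ} {i : Words v} (h : i.lab k = i.lab (k + 1)) :
    cr k * cr k * e i = 0 := by
  by_cases hk : k < size v - 1
  · have hrel := mk_rel (Rel.bigon_eq ⟨k, hk⟩ i ((Fin_eq_iff_lab i (by omega) (by omega)).2 h))
    simpa [e, ψ, cr, hk] using hrel
  · simp [cr, hk]

theorem cr_sq_far {k : ℕ} {i : Words v} (hk : k + 1 < size v) (h : i.lab k ≠ i.lab (k + 1))
    (h1 : i.lab k + 1 ≠ i.lab (k + 1)) (h2 : i.lab (k + 1) + 1 ≠ i.lab k) :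
    cr k * cr k * e i = e i := by
  have hk' : k < size v - 1 := by omega
  rw [i.lab_of_lt hk, i.lab_of_lt (by omega : k < size v)] at h1 h2
  have hrel := mk_rel (Rel.bigon_far ⟨k, hk'⟩ i
    (fun hh => h ((Fin_eq_iff_lab i (by omega) (by omega)).1 hh))
    (fun hh => h1 (congrArg (· + 1) hh)) (fun hh => h2 (congrArg (· + 1) hh)))
  simpa [e, ψ, cr, hk'] using hrel

theorem cr_sq_up {k : ℕ} {i : Words v} (h : i.lab k + 1 = i.lab (k + 1)) :
    cr k * cr k * e i = (Y (k + 1) - Y k) * e i := by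
  have hk : k + 1 < size v := by
    by_contra hk
    simp [Words.lab, hk] at h
  have hk' : k < size v - 1 := by omega
  have hk'' : k < size v := by omega
  rw [i.lab_of_lt hk, i.lab_of_lt hk''] at h
  have hrel := mk_rel (Rel.bigon_up ⟨k, hk'⟩ i (by simpa [lft, rgt] using h))
  simpa [e, ψ, cr, y, Y, hk, hk', hk'', lft, rgt] using hrel

theorem cr_sq_down {k : ℕ} {i : Words v} (hk : k + 1 < size v)
    (h : i.lab (k + 1) + 1 = i.lab k) :
    cr k * cr k * e i = (Y k - Y (k + 1)) * e i := by
  have hk' : k < size v - 1 := by omega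
  have hk'' : k < size v := by omega
  rw [i.lab_of_lt hk, i.lab_of_lt hk''] at h
  have hrel := mk_rel (Rel.bigon_down ⟨k, hk'⟩ i (by simpa [lft, rgt] using h))
  simpa [e, ψ, cr, y, Y, hk, hk', hk'', lft, rgt] using hrel

theorem triple_down {k : ℕ} {i : Words v} (hk : k + 2 < size v) (h1 : i.lab k = i.lab (k + 2))
    (h2 : i.lab (k + 1) + 1 = i.lab k) (h3 : i.lab k ≠ n) :
    (cr k * cr (k + 1) * cr k - cr (k + 1) * cr k * cr (k + 1)) * e i = e i := by
  have a0 : k < size v - 1 := by omega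
  have a1 : k + 1 < size v - 1 := by omega
  have b0 : k < size v := by omega
  have b1 : k + 1 < size v := by omega
  have hrel := mk_rel (Rel.triple_down ⟨k, a0⟩ ⟨k + 1, a1⟩ i rfl
    ((Fin_eq_iff_lab i (by omega) (by omega)).2 h1)
    (by rw [i.lab_of_lt b1, i.lab_of_lt b0] at h2; simpa [lft, rgt] using h2)
    (fun hh => h3 ((isRed_iff_lab i _).1 hh)))
  simpa [e, ψ, cr, a0, a1] using hrel

theorem triple_up {k : ℕ} {i : Words v} (hk : k + 2 < size v) (h1 : i.lab k = i.lab (k + 2))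
    (h2 : i.lab k + 1 = i.lab (k + 1)) :
    (cr k * cr (k + 1) * cr k - cr (k + 1) * cr k * cr (k + 1)) * e i = - e i := by
  have a0 : k < size v - 1 := by omega
  have a1 : k + 1 < size v - 1 := by omega
  have b0 : k < size v := by omega
  have b1 : k + 1 < size v := by omega
  have hrel := mk_rel (Rel.triple_up ⟨k, a0⟩ ⟨k + 1, a1⟩ i rfl
    ((Fin_eq_iff_lab i (by omega) (by omega)).2 h1)
    (by rw [i.lab_of_lt b1, i.lab_of_lt b0] at h2; simpa [lft, rgt] using h2))
  simpa [e, ψ, cr, a0, a1] using hrel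

theorem triple_far {k : ℕ} {i : Words v} (h : ¬ (i.lab k = i.lab (k + 2) ∧
      (i.lab (k + 1) + 1 = i.lab k ∨ i.lab k + 1 = i.lab (k + 1)))) :
    (cr k * cr (k + 1) * cr k - cr (k + 1) * cr k * cr (k + 1)) * e i = 0 := by
  by_cases hk : k + 2 < size v
  swap
  · simp [cr_of_le (v := v) (k := k + 1) (by omega)]
  have a0 : k < size v - 1 := by omega
  have a1 : k + 1 < size v - 1 := by omega
  have b0 : k < size v := by omega
  have b1 : k + 1 < size v := by omega
  have hrel := mk_rel (Rel.triple_far ⟨k, a0⟩ ⟨k + 1, a1⟩ i rfl (by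
    rintro ⟨h1, h2⟩
    refine h ⟨(Fin_eq_iff_lab i b0 hk).1 h1, ?_⟩
    rw [i.lab_of_lt b1, i.lab_of_lt b0]
    rcases h2 with h2 | h2
    · left; simpa [lft, rgt] using h2
    · right; simpa [lft, rgt] using h2))
  simpa [e, ψ, cr, a0, a1] using hrel

/-- Elements `e(i)`, `y_k`, `ψ_k` of an algebra that satisfy the relations of the KLRW algebra.
Dots and crossings are indexed by natural numbers and vanish when out of range. -/
structure Pres {n : ℕ} (v : Fin n → ℕ) (A : Type*) [Ring A] [Algebra ℂ A] where
  e : Words v → A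
  Y : ℕ → A
  cr : ℕ → A
  e_mul_self (i) : e i * e i = e i
  e_mul_ne {i j} : i ≠ j → e i * e j = 0
  sum_e : ∑ i, e i = 1
  Y_mul_e (k i) : Y k * e i = e i * Y k
  cr_mul_e (k i) : cr k * e i = e (i.sw k) * cr k
  cr_of_le {k} : size v ≤ k + 1 → cr k = 0
  Y_of_le {k} : size v ≤ k → Y k = 0
  cr_mul_e_red {k} {i : Words v} : i.lab k = n → i.lab (k + 1) = n → cr k * e i = 0
  Y_mul_Y (k l) : Y k * Y l = Y l * Y k
  Y_mul_cr_far {k l} : l ≠ k → l ≠ k + 1 → Y l * cr k = cr k * Y l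
  cr_mul_cr_far {k l} : k + 1 < l → cr k * cr l = cr l * cr k
  Y_mul_cr_left (k i) : Y k * cr k * e i = cr k * Y (k + 1) * e i + eps i k • e i
  cr_mul_Y_left (k i) : cr k * Y k * e i = Y (k + 1) * cr k * e i + eps i k • e i
  cr_sq_eq {k} {i : Words v} : i.lab k = i.lab (k + 1) → cr k * cr k * e i = 0
  cr_sq_far {k} {i : Words v} : k + 1 < size v → i.lab k ≠ i.lab (k + 1) →
    i.lab k + 1 ≠ i.lab (k + 1) → i.lab (k + 1) + 1 ≠ i.lab k → cr k * cr k * e i = e i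
  cr_sq_up {k} {i : Words v} : i.lab k + 1 = i.lab (k + 1) →
    cr k * cr k * e i = (Y (k + 1) - Y k) * e i
  cr_sq_down {k} {i : Words v} : k + 1 < size v → i.lab (k + 1) + 1 = i.lab k →
    cr k * cr k * e i = (Y k - Y (k + 1)) * e i
  triple_down {k} {i : Words v} : k + 2 < size v → i.lab k = i.lab (k + 2) →
    i.lab (k + 1) + 1 = i.lab k → i.lab k ≠ n →
    (cr k * cr (k + 1) * cr k - cr (k + 1) * cr k * cr (k + 1)) * e i = e i
  triple_up {k} {i : Words v} : k + 2 < size v → i.lab k = i.lab (k + 2) →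
    i.lab k + 1 = i.lab (k + 1) →
    (cr k * cr (k + 1) * cr k - cr (k + 1) * cr k * cr (k + 1)) * e i = -e i
  triple_far {k} {i : Words v} : ¬ (i.lab k = i.lab (k + 2) ∧
      (i.lab (k + 1) + 1 = i.lab k ∨ i.lab k + 1 = i.lab (k + 1))) →
    (cr k * cr (k + 1) * cr k - cr (k + 1) * cr k * cr (k + 1)) * e i = 0

/-- The generators of `T̃_v`. -/
def pres (v : Fin n → ℕ) : Pres v (T v) where
  e := e
  Y := Y
  cr := cr
  e_mul_self := e_mul_self
  e_mul_ne := e_mul_ne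
  sum_e := sum_e
  Y_mul_e := Y_mul_e
  cr_mul_e := cr_mul_e
  cr_of_le := cr_of_le
  Y_of_le := Y_of_le
  cr_mul_e_red := cr_mul_e_red
  Y_mul_Y := Y_mul_Y
  Y_mul_cr_far := Y_mul_cr_far
  cr_mul_cr_far := cr_mul_cr_far
  Y_mul_cr_left := Y_mul_cr_left
  cr_mul_Y_left := cr_mul_Y_left
  cr_sq_eq := cr_sq_eq
  cr_sq_far := cr_sq_far
  cr_sq_up := cr_sq_up
  cr_sq_down := cr_sq_down
  triple_down := triple_down
  triple_up := triple_up
  triple_far := triple_far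

end KLRW
end

/-! ### Coset factorization with respect to the crossings away from the first strand. -/

noncomputable section

namespace KLRW

variable {n : ℕ} {v : Fin n → ℕ}

namespace Pres

variable {A : Type*} [Ring A] [Algebra ℂ A] (P : Pres v A)

theorem mem_of_mul_e {S : Submodule ℂ A} {a : A} (h : ∀ i, a * P.e i ∈ S) : a ∈ S := by
  rw [← mul_one a, ← P.sum_e, Finset.mul_sum]
  exact S.sum_mem fun i _ => h i

/-- In all cases, the two sides of a triple point move differ by a multiple of the idempotent. -/
theorem triple_exists (k : ℕ) (i : Words v) : ∃ c : ℂ,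
    (P.cr k * P.cr (k + 1) * P.cr k - P.cr (k + 1) * P.cr k * P.cr (k + 1)) * P.e i
      = c • P.e i := by
  by_cases hk : k + 2 < size v
  swap
  · exact ⟨0, by simp [P.cr_of_le (k := k + 1) (by omega)]⟩
  by_cases h : i.lab k = i.lab (k + 2) ∧
      (i.lab (k + 1) + 1 = i.lab k ∨ i.lab k + 1 = i.lab (k + 1))
  swap
  · exact ⟨0, by simp [P.triple_far h]⟩
  obtain ⟨h1, h2 | h2⟩ := h
  -- With red outer strands no defining relation applies, but each side crosses these two strands,
  -- so both products vanish.
  · by_cases hr : i.lab k = n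
    · refine ⟨0, ?_⟩
      have e1 : P.cr k * P.cr (k + 1) * P.cr k * P.e i = 0 := by
        rw [mul_assoc, P.cr_mul_e, ← mul_assoc, mul_assoc (P.cr k), P.cr_mul_e_red]
        · simp
        · rw [Words.lab_sw_right _ (by omega), hr]
        · rw [Words.lab_sw_of_ne _ (by omega) (by omega), ← h1, hr]
      have e2 : P.cr (k + 1) * P.cr k * P.cr (k + 1) * P.e i = 0 := by
        rw [mul_assoc, P.cr_mul_e, ← mul_assoc, mul_assoc (P.cr (k + 1)), P.cr_mul_e_red]
        · simp
        · rw [Words.lab_sw_of_ne _ (by omega) (by omega), hr]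
        · rw [Words.lab_sw_left _ (by omega), ← h1, hr]
      rw [sub_mul, e1, e2]; simp
    · exact ⟨1, by rw [P.triple_down hk h1 h2 hr, one_smul]⟩
  · exact ⟨-1, by rw [P.triple_up hk h1 h2, neg_smul, one_smul]⟩

/-- The span of the idempotents. -/
def idemSpan : Submodule ℂ A := Submodule.span ℂ (Set.range P.e)

theorem smul_e_mem (c : ℂ) (i : Words v) : c • P.e i ∈ P.idemSpan :=
  Submodule.smul_mem _ _ (Submodule.subset_span ⟨i, rfl⟩)

/-- Distinct labels give no error and equal labels an idempotent, so a crossing permutes the dots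
modulo `idemSpan`. This form avoids later case distinctions on labels. -/
theorem Y_mul_cr_sub (k l : ℕ) :
    P.Y l * P.cr k - P.cr k * P.Y (Equiv.swap k (k + 1) l) ∈ P.idemSpan := by
  refine P.mem_of_mul_e fun i => ?_
  by_cases h1 : l = k
  · subst h1
    rw [Equiv.swap_apply_left, sub_mul, P.Y_mul_cr_left, add_sub_cancel_left]
    exact P.smul_e_mem _ _
  by_cases h2 : l = k + 1
  · subst h2
    rw [Equiv.swap_apply_right, sub_mul, P.cr_mul_Y_left, ← sub_sub, sub_self, zero_sub,
      ← neg_smul]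
    exact P.smul_e_mem _ _
  · rw [Equiv.swap_apply_of_ne_of_ne h1 h2, P.Y_mul_cr_far h1 h2, sub_self, zero_mul]
    exact Submodule.zero_mem _

theorem triple_sub (k : ℕ) :
    P.cr k * P.cr (k + 1) * P.cr k - P.cr (k + 1) * P.cr k * P.cr (k + 1) ∈ P.idemSpan := by
  refine P.mem_of_mul_e fun i => ?_
  obtain ⟨c, hc⟩ := P.triple_exists k i
  rw [hc]
  exact P.smul_e_mem _ _

/-- The subalgebra generated by all idempotents and dots, and by the crossings at or to the right
of position `p`. -/
def alg (p : ℕ) : Subalgebra ℂ A :=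
  Algebra.adjoin ℂ (Set.range P.e ∪ Set.range P.Y ∪ {x | ∃ k, p ≤ k ∧ x = P.cr k})

theorem e_mem_alg (p : ℕ) (i : Words v) : P.e i ∈ P.alg p :=
  Algebra.subset_adjoin (Or.inl (Or.inl ⟨i, rfl⟩))

theorem Y_mem_alg (p k : ℕ) : P.Y k ∈ P.alg p :=
  Algebra.subset_adjoin (Or.inl (Or.inr ⟨k, rfl⟩))

theorem cr_mem_alg {p k : ℕ} (h : p ≤ k) : P.cr k ∈ P.alg p :=
  Algebra.subset_adjoin (Or.inr ⟨k, h, rfl⟩)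

theorem alg_anti {p q : ℕ} (h : p ≤ q) : P.alg q ≤ P.alg p := by
  apply Algebra.adjoin_mono
  refine Set.union_subset_union_right _ ?_
  rintro _ ⟨k, hk, rfl⟩
  exact ⟨k, h.trans hk, rfl⟩

/-- `ψ_p ψ_{p+1} ⋯ ψ_{p+m-1}`: the strand at position `p + m` is moved to position `p`. -/
def C (p : ℕ) : ℕ → A
  | 0 => 1
  | m + 1 => C p m * P.cr (p + m)

@[simp] theorem C_zero (p : ℕ) : P.C p 0 = 1 := rfl

theorem C_succ (p m : ℕ) : P.C p (m + 1) = P.C p m * P.cr (p + m) := rfl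

theorem C_add (p a b : ℕ) : P.C p (a + b) = P.C p a * P.C (p + a) b := by
  induction b with
  | zero => simp
  | succ b ih => rw [← add_assoc, C_succ, ih, C_succ, mul_assoc, add_assoc]

theorem C_succ' (p m : ℕ) : P.C p (m + 1) = P.cr p * P.C (p + 1) m := by
  rw [add_comm, C_add, C_succ, C_zero, one_mul, add_zero]

theorem C_mem_alg {p q : ℕ} (h : q ≤ p) (m : ℕ) : P.C p m ∈ P.alg q := by
  induction m with
  | zero => exact one_mem _
  | succ m ih => exact mul_mem ih (P.cr_mem_alg (by omega))

theorem C_eq_zero {p m : ℕ} (hm : m ≠ 0) (h : size v ≤ p + m) : P.C p m = 0 := by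
  obtain ⟨m, rfl⟩ := Nat.exists_eq_succ_of_ne_zero hm
  rw [Nat.succ_eq_add_one, C_succ, P.cr_of_le (by omega), mul_zero]

theorem cr_mul_C_right {p m k : ℕ} (h : p + m < k) : P.cr k * P.C p m = P.C p m * P.cr k := by
  induction m with
  | zero => simp
  | succ m ih =>
    rw [C_succ, ← mul_assoc, ih (by omega), mul_assoc, mul_assoc, ← P.cr_mul_cr_far (by omega)]

theorem cr_mul_C_left {p m k : ℕ} (h : k + 1 < p) : P.cr k * P.C p m = P.C p m * P.cr k := by
  induction m with
  | zero => simp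
  | succ m ih =>
    rw [C_succ, ← mul_assoc, ih, mul_assoc, mul_assoc, P.cr_mul_cr_far (by omega)]

theorem C_mul_C_comm {p m q r : ℕ} (h : p + m < q) : P.C p m * P.C q r = P.C q r * P.C p m := by
  induction m with
  | zero => simp
  | succ m ih =>
    rw [C_succ, mul_assoc, P.cr_mul_C_left (by omega), ← mul_assoc, ih (by omega), mul_assoc]

/-- The word obtained by moving the letter at position `p + m` to position `p`. -/
def _root_.KLRW.Words.mv (i : Words v) (p : ℕ) : ℕ → Words v
  | 0 => i
  | m + 1 => (i.sw (p + m)).mv p m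

theorem C_mul_e (p m : ℕ) (i : Words v) : P.C p m * P.e i = P.e (i.mv p m) * P.C p m := by
  induction m generalizing i with
  | zero => simp [Words.mv]
  | succ m ih => rw [C_succ, mul_assoc, P.cr_mul_e, ← mul_assoc, ih, mul_assoc, Words.mv]

/-- The span of the elements `a ψ_p ⋯ ψ_{p+b-1}` with `b < m` and `a` in `alg (p + 1)`. -/
def cosets (p m : ℕ) : Submodule ℂ A :=
  Submodule.span ℂ {x | ∃ b < m, ∃ a ∈ P.alg (p + 1), x = a * P.C p b}

theorem mul_C_mem_cosets {p m b : ℕ} (h : b < m) {a : A} (ha : a ∈ P.alg (p + 1)) :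
    a * P.C p b ∈ P.cosets p m := Submodule.subset_span ⟨b, h, a, ha, rfl⟩

theorem C_mem_cosets {p m b : ℕ} (h : b < m) : P.C p b ∈ P.cosets p m := by
  simpa using P.mul_C_mem_cosets h (one_mem (P.alg (p + 1)))

theorem cosets_mono {p m m' : ℕ} (h : m ≤ m') : P.cosets p m ≤ P.cosets p m' := by
  apply Submodule.span_mono
  rintro x ⟨b, hb, a, ha, rfl⟩
  exact ⟨b, hb.trans_le h, a, ha, rfl⟩

theorem mul_mem_cosets {p m : ℕ} {a x : A} (ha : a ∈ P.alg (p + 1)) (hx : x ∈ P.cosets p m) :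
    a * x ∈ P.cosets p m := by
  induction hx using Submodule.span_induction with
  | mem x hx =>
    obtain ⟨b, hb, a', ha', rfl⟩ := hx
    rw [← mul_assoc]
    exact P.mul_C_mem_cosets hb (mul_mem ha ha')
  | zero => rw [mul_zero]; exact zero_mem _
  | add x y _ _ hx hy => rw [mul_add]; exact add_mem hx hy
  | smul c x _ hx => rw [mul_smul_comm]; exact Submodule.smul_mem _ _ hx

theorem C_mul_idem_mem {p m b : ℕ} (h : b < m) {x : A} (hx : x ∈ P.idemSpan) :
    P.C p b * x ∈ P.cosets p m := by
  induction hx using Submodule.span_induction with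
  | mem x hx =>
    obtain ⟨i, rfl⟩ := hx
    rw [C_mul_e]
    exact P.mul_C_mem_cosets h (P.e_mem_alg _ _)
  | zero => rw [mul_zero]; exact zero_mem _
  | add x y _ _ hx hy => rw [mul_add]; exact add_mem hx hy
  | smul c x _ hx => rw [mul_smul_comm]; exact Submodule.smul_mem _ _ hx

/-- All products `C p b` with `b < m` end before `cr (p + m)` and commute with it, so it joins the
left factor. -/
theorem mul_cr_mem_cosets {p m : ℕ} {x : A} (hx : x ∈ P.cosets p m) :
    x * P.cr (p + m) ∈ P.cosets p m := by
  induction hx using Submodule.span_induction with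
  | mem x hx =>
    obtain ⟨b, hb, a', ha', rfl⟩ := hx
    rw [mul_assoc, ← P.cr_mul_C_right (by omega), ← mul_assoc]
    exact P.mul_C_mem_cosets hb (mul_mem ha' (P.cr_mem_alg (by omega)))
  | zero => rw [zero_mul]; exact zero_mem _
  | add x y _ _ hx hy => rw [add_mul]; exact add_mem hx hy
  | smul c x _ hx => rw [smul_mul_assoc]; exact Submodule.smul_mem _ _ hx

/-- Dots move through `ψ_p ⋯ ψ_{p+m-1}` up to shorter terms. -/
theorem exists_perm_Y_mul_C (p m : ℕ) : ∃ σ : Equiv.Perm ℕ, ∀ k,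
    P.Y k * P.C p m - P.C p m * P.Y (σ k) ∈ P.cosets p m := by
  induction m with
  | zero => exact ⟨1, fun k => by simp⟩
  | succ m ih =>
    obtain ⟨σ, hσ⟩ := ih
    refine ⟨σ.trans (Equiv.swap (p + m) (p + m + 1)), fun k => ?_⟩
    have h1 := P.mul_cr_mem_cosets (hσ k)
    have h2 := P.C_mul_idem_mem (p := p) (Nat.lt_succ_self m) (P.Y_mul_cr_sub (p + m) (σ k))
    have := add_mem (P.cosets_mono (Nat.le_succ m) h1) h2
    convert this using 1
    rw [C_succ, Equiv.trans_apply]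
    noncomm_ring

/-- Crossings move through `ψ_p ⋯ ψ_{p+m-1}` up to shorter terms. -/
theorem C_mul_cr_sub {p m k : ℕ} (h : p ≤ k) (h' : k + 1 < p + m) :
    P.C p m * P.cr k - P.cr (k + 1) * P.C p m ∈ P.cosets p m := by
  obtain ⟨b, rfl⟩ := Nat.exists_eq_add_of_le h
  obtain ⟨r, rfl⟩ := Nat.exists_eq_add_of_le (show b + 2 ≤ m by omega)
  have hC : P.C p (b + 2 + r) = P.C p b * P.cr (p + b) * P.cr (p + b + 1) * P.C (p + (b + 2)) r := by
    rw [C_add, C_succ, C_succ, ← add_assoc p b 1]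
  have hD := P.cr_mul_C_left (p := p + (b + 2)) (m := r) (k := p + b) (by omega)
  have hB := P.cr_mul_C_right (p := p) (m := b) (k := p + b + 1) (by omega)
  have hCC := P.C_mul_C_comm (p := p) (m := b) (q := p + (b + 2)) (r := r) (by omega)
  have e1 : P.C p (b + 2 + r) * P.cr (p + b) = P.C p b * (P.cr (p + b) * P.cr (p + b + 1) *
      P.cr (p + b)) * P.C (p + (b + 2)) r := by
    rw [hC, mul_assoc _ (P.C _ r), ← hD]; noncomm_ring
  have e2 : P.cr (p + b + 1) * P.C p (b + 2 + r) = P.C p b * (P.cr (p + b + 1) * P.cr (p + b) *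
      P.cr (p + b + 1)) * P.C (p + (b + 2)) r := by
    rw [hC, ← mul_assoc, ← mul_assoc, ← mul_assoc, hB]; noncomm_ring
  rw [e1, e2, ← sub_mul, ← mul_sub]
  -- The error of the triple point move is a combination of idempotents. Once it replaces the three
  -- crossings, the tail commutes with `C p b` and can be moved to the left, into `alg (p + 1)`.
  have hE : ∀ x ∈ P.idemSpan, P.C p b * x * P.C (p + (b + 2)) r ∈ P.cosets p (b + 2 + r) := by
    intro x hx
    induction hx using Submodule.span_induction with
    | mem x hx =>
      obtain ⟨i, rfl⟩ := hx
      rw [C_mul_e, mul_assoc, hCC, ← mul_assoc]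
      exact P.mul_C_mem_cosets (by omega) (mul_mem (P.e_mem_alg _ _) (P.C_mem_alg (by omega) _))
    | zero => simp
    | add x y _ _ hx hy => rw [mul_add, add_mul]; exact add_mem hx hy
    | smul c x _ hx => rw [mul_smul_comm, smul_mul_assoc]; exact Submodule.smul_mem _ _ hx
  exact hE _ (P.triple_sub _)

/-- Every element of `alg p` is a combination of products of elements of `alg (p + 1)` with
elements `ψ_p ⋯ ψ_{p+m-1}`. -/
theorem mem_cosets_of_mem_alg {p : ℕ} {x : A} (hx : x ∈ P.alg p) : ∃ m, x ∈ P.cosets p m := by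
  have hY : ∀ m l, P.C p m * P.Y l ∈ P.cosets p (m + 1) := by
    intro m l
    obtain ⟨σ, hσ⟩ := P.exists_perm_Y_mul_C p m
    have h1 := P.cosets_mono (Nat.le_succ m) (hσ (σ.symm l))
    have h2 := P.mul_C_mem_cosets (Nat.lt_succ_self m) (P.Y_mem_alg (p + 1) (σ.symm l))
    simpa using sub_mem h2 h1
  have hYY : ∀ m l x, x ∈ P.cosets p m → x * P.Y l ∈ P.cosets p m := by
    intro m l x hx
    induction hx using Submodule.span_induction with
    | mem x hx =>
      obtain ⟨b, hb, a', ha', rfl⟩ := hx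
      rw [mul_assoc]
      exact P.mul_mem_cosets ha' (P.cosets_mono hb (hY _ _))
    | zero => rw [zero_mul]; exact zero_mem _
    | add x y _ _ hx hy => rw [add_mul]; exact add_mem hx hy
    | smul c x _ hx => rw [smul_mul_assoc]; exact Submodule.smul_mem _ _ hx
  have hee : ∀ m i x, x ∈ P.cosets p m → x * P.e i ∈ P.cosets p m := by
    intro m i x hx
    induction hx using Submodule.span_induction with
    | mem x hx =>
      obtain ⟨b, hb, a', ha', rfl⟩ := hx
      rw [mul_assoc, C_mul_e, ← mul_assoc]
      exact P.mul_C_mem_cosets hb (mul_mem ha' (P.e_mem_alg _ _))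
    | zero => rw [zero_mul]; exact zero_mem _
    | add x y _ _ hx hy => rw [add_mul]; exact add_mem hx hy
    | smul c x _ hx => rw [smul_mul_assoc]; exact Submodule.smul_mem _ _ hx
  -- Four positions of `k`: before the last factor, the crossing slides through with its index
  -- raised by one; at the last factor it forms a bigon, which is zero, an idempotent or a
  -- difference of dots; just behind, it lengthens the product; further right, it commutes and joins
  -- the left factor.
  have hcr : ∀ m k, p ≤ k → P.C p m * P.cr k ∈ P.cosets p (m + 2) := by
    intro m k hk
    rcases lt_trichotomy k (p + m) with h | rfl | h
    · by_cases h' : k + 1 < p + m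
      · have h1 := P.cosets_mono (Nat.le_add_right m 2) (P.C_mul_cr_sub hk h')
        have h2 := P.mul_C_mem_cosets (p := p) (m := m + 2) (b := m) (by omega)
          (P.cr_mem_alg (p := p + 1) (k := k + 1) (by omega))
        simpa using add_mem h1 h2
      · obtain ⟨m, rfl⟩ := Nat.exists_eq_succ_of_ne_zero (show m ≠ 0 by omega)
        obtain rfl : k = p + m := by omega
        rw [Nat.succ_eq_add_one, C_succ, mul_assoc]
        refine P.mem_of_mul_e fun i => ?_
        have hp : ∀ a b, P.C p m * ((P.Y a - P.Y b) * P.e i) ∈ P.cosets p (m + 3) := by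
          intro a b
          rw [← mul_assoc, mul_sub]
          exact hee _ _ _ (P.cosets_mono (by omega) (sub_mem (hY _ _) (hY _ _)))
        rw [mul_assoc]
        by_cases h : i.lab (p + m) = i.lab (p + m + 1)
        · rw [P.cr_sq_eq h, mul_zero]; exact zero_mem _
        by_cases h1 : i.lab (p + m) + 1 = i.lab (p + m + 1)
        · rw [P.cr_sq_up h1]; exact hp _ _
        by_cases hk : p + m + 1 < size v
        swap
        · rw [P.cr_of_le (by omega)]; simp
        by_cases h2 : i.lab (p + m + 1) + 1 = i.lab (p + m)
        · rw [P.cr_sq_down hk h2]; exact hp _ _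
        · rw [P.cr_sq_far hk h h1 h2]
          exact hee _ _ _ (P.C_mem_cosets (by omega))
    · rw [← C_succ]
      exact P.C_mem_cosets (by omega)
    · rw [← P.cr_mul_C_right h]
      exact P.mul_C_mem_cosets (by omega) (P.cr_mem_alg (by omega))
  have hcr' : ∀ m k x, p ≤ k → x ∈ P.cosets p m → x * P.cr k ∈ P.cosets p (m + 2) := by
    intro m k x hk hx
    induction hx using Submodule.span_induction with
    | mem x hx =>
      obtain ⟨b, hb, a', ha', rfl⟩ := hx
      rw [mul_assoc]
      exact P.mul_mem_cosets ha' (P.cosets_mono (by omega) (hcr _ _ hk))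
    | zero => rw [zero_mul]; exact zero_mem _
    | add x y _ _ hx hy => rw [add_mul]; exact add_mem hx hy
    | smul c x _ hx => rw [smul_mul_assoc]; exact Submodule.smul_mem _ _ hx
  -- A general left factor `y` lets the product case be chained. The bound `m` may grow, which is
  -- harmless.
  suffices h : ∀ m y, y ∈ P.cosets p m → ∃ m', y * x ∈ P.cosets p m' by
    simpa using h 1 1 (by simpa using P.C_mem_cosets (p := p) Nat.zero_lt_one)
  induction hx using Algebra.adjoin_induction with
  | mem x hx =>
    intro m y hy
    rcases hx with (⟨i, rfl⟩ | ⟨k, rfl⟩) | ⟨k, hk, rfl⟩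
    · exact ⟨m, hee _ _ _ hy⟩
    · exact ⟨m, hYY _ _ _ hy⟩
    · exact ⟨m + 2, hcr' _ _ _ hk hy⟩
  | algebraMap r =>
    intro m y hy
    refine ⟨m, ?_⟩
    rw [← Algebra.commutes, ← Algebra.smul_def]
    exact Submodule.smul_mem _ _ hy
  | add a b _ _ ha hb =>
    intro m y hy
    obtain ⟨m1, h1⟩ := ha m y hy
    obtain ⟨m2, h2⟩ := hb m y hy
    refine ⟨max m1 m2, ?_⟩
    rw [mul_add]
    exact add_mem (P.cosets_mono (le_max_left _ _) h1) (P.cosets_mono (le_max_right _ _) h2)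
  | mul a b _ _ ha hb =>
    intro m y hy
    obtain ⟨m1, h1⟩ := ha m y hy
    obtain ⟨m2, h2⟩ := hb _ _ h1
    exact ⟨m2, by rwa [← mul_assoc]⟩

end Pres
end KLRW
end

/-! ### Universal property, and the presentation with degrees recorded in a Laurent variable. -/

noncomputable section

namespace KLRW

variable {n : ℕ} {v : Fin n → ℕ}

/-- The images of the generators under the homomorphism determined by `P`. -/
def Pres.gen {B : Type*} [Ring B] [Algebra ℂ B] (P : Pres v B) : Gen v → B
  | .idem i => P.e i
  | .dot k => P.Y k
  | .cross k => P.cr k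

theorem Words.swap_eq_sw (i : Words v) (k : Fin (size v - 1)) : i.swap k = i.sw k := by
  simp [sw]

theorem Pres.lift_rel {B : Type*} [Ring B] [Algebra ℂ B] (P : Pres v B) {a b : Free v}
    (hab : Rel v a b) : FreeAlgebra.lift ℂ P.gen a = FreeAlgebra.lift ℂ P.gen b := by
  have hl : ∀ (k : Fin (size v - 1)) (i : Words v), i.lab k = (i.1 (lft k) : ℕ) + 1 :=
    fun k i => i.lab_of_lt (by omega)
  have hr : ∀ (k : Fin (size v - 1)) (i : Words v), i.lab (k + 1) = (i.1 (rgt k) : ℕ) + 1 :=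
    fun k i => i.lab_of_lt (by omega)
  have hne : ∀ {k : Fin (size v - 1)} {i : Words v}, i.1 (lft k) ≠ i.1 (rgt k) →
      i.lab k ≠ i.lab (k + 1) := fun {k i} h => by
    rw [hl, hr]; intro h'; exact h (Fin.ext (by omega))
  have heq : ∀ {k : Fin (size v - 1)} {i : Words v}, i.1 (lft k) = i.1 (rgt k) →
      i.lab k = i.lab (k + 1) := fun {k i} h => by rw [hl, hr, h]
  have heps : ∀ {k : Fin (size v - 1)} {i : Words v}, i.1 (lft k) ≠ i.1 (rgt k) →
      eps i k = 0 := fun {k i} h => if_neg fun h' => hne h h'.2.1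
  have heps' : ∀ {k : Fin (size v - 1)} {i : Words v}, i.1 (lft k) = i.1 (rgt k) →
      ¬ i.RedPair k → eps i k = 1 := fun {k i} h h' =>
    if_pos ⟨by omega, heq h, fun h'' => h' ⟨by rw [IsRed, ← hl, h''],
      by rw [IsRed, ← hr, ← heq h, h'']⟩⟩
  have hYl : ∀ k : Fin (size v - 1), FreeAlgebra.lift ℂ P.gen (fy (lft k)) = P.Y k := fun k => by
    simp [Pres.gen, lft]
  have hYr : ∀ k : Fin (size v - 1), FreeAlgebra.lift ℂ P.gen (fy (rgt k)) = P.Y (k + 1) :=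
    fun k => by simp [Pres.gen, rgt]
  have hψ : ∀ k : Fin (size v - 1), FreeAlgebra.lift ℂ P.gen (fψ k) = P.cr k := fun k => by
    simp [Pres.gen]
  have hY : ∀ k : Fin (size v), FreeAlgebra.lift ℂ P.gen (fy k) = P.Y k := fun k => by
    simp [Pres.gen]
  have he : ∀ i : Words v, FreeAlgebra.lift ℂ P.gen (fe i) = P.e i := fun i => by
    simp [Pres.gen]
  cases hab with
  | idem_self i => rw [map_mul, he, P.e_mul_self]
  | idem_ne i j hij => rw [map_mul, he, he, P.e_mul_ne hij, map_zero]
  | idem_sum => simp only [map_sum, he, P.sum_e, map_one]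
  | dot_idem k i => rw [map_mul, map_mul, he, hY, P.Y_mul_e]
  | cross_idem k i => rw [map_mul, map_mul, he, hψ, he, P.cr_mul_e, Words.swap_eq_sw]
  | cross_red k i h =>
    rw [map_mul, he, hψ, map_zero, P.cr_mul_e_red ((hl k i).trans h.1) ((hr k i).trans h.2)]
  | dot_dot k l => rw [map_mul, map_mul, hY, hY, P.Y_mul_Y]
  | dot_cross_far l k h1 h2 =>
    rw [map_mul, map_mul, hY, hψ, P.Y_mul_cr_far]
    · exact fun h => h1 (Fin.ext h)
    · exact fun h => h2 (Fin.ext h)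
  | cross_cross_far k l h => rw [map_mul, map_mul, hψ, hψ, P.cr_mul_cr_far h]
  | slide_left k i h =>
    simp only [map_mul, he, hψ, hYl, hYr]
    rw [P.Y_mul_cr_left, heps h, zero_smul, add_zero]
  | slide_right k i h =>
    simp only [map_mul, he, hψ, hYl, hYr]
    rw [P.cr_mul_Y_left, heps h, zero_smul, add_zero]
  | nil_left k i h h' =>
    simp only [map_mul, map_sub, he, hψ, hYl, hYr]
    rw [sub_mul, P.Y_mul_cr_left, heps' h h', one_smul, add_sub_cancel_left]
  | nil_right k i h h' =>
    simp only [map_mul, map_sub, he, hψ, hYl, hYr]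
    rw [sub_mul, P.cr_mul_Y_left, heps' h h', one_smul, add_sub_cancel_left]
  | bigon_eq k i h => simp only [map_mul, he, hψ, map_zero, P.cr_sq_eq (heq h)]
  | bigon_far k i h h1 h2 =>
    simp only [map_mul, he, hψ]
    exact P.cr_sq_far (by omega) (hne h) (by rw [hl, hr]; omega) (by rw [hl, hr]; omega)
  | bigon_up k i h =>
    simp only [map_mul, map_sub, he, hψ, hYl, hYr]
    exact P.cr_sq_up (by rw [hl, hr, h])
  | bigon_down k i h =>
    simp only [map_mul, map_sub, he, hψ, hYl, hYr]
    exact P.cr_sq_down (by omega) (by rw [hl, hr, h])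
  | triple_down k l i h h1 h2 h3 =>
    have hr' := hr l i
    simp only [map_mul, map_sub, he, hψ, h] at hr' ⊢
    refine P.triple_down (by omega) ?_ (by rw [hl, hr, h2]) (by rw [hl]; exact h3)
    rw [hl, hr', h1]
  | triple_up k l i h h1 h2 =>
    have hr' := hr l i
    simp only [map_mul, map_sub, map_neg, he, hψ, h] at hr' ⊢
    refine P.triple_up (by omega) ?_ (by rw [hl, hr, h2])
    rw [hl, hr', h1]
  | triple_far k l i h h1 =>
    have hr' := hr l i
    simp only [map_mul, map_sub, map_zero, he, hψ, h] at hr' ⊢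
    refine P.triple_far fun h' => h1 ?_
    rw [hl, hr, hr'] at h'
    exact ⟨Fin.ext (by omega), by omega⟩

/-- The universal property of `T̃_v`. -/
def Pres.lift {B : Type*} [Ring B] [Algebra ℂ B] (P : Pres v B) : T v →ₐ[ℂ] B :=
  RingQuot.liftAlgHom ℂ ⟨FreeAlgebra.lift ℂ P.gen, fun _ _ h => P.lift_rel h⟩

theorem Pres.lift_mk {B : Type*} [Ring B] [Algebra ℂ B] (P : Pres v B) (g : Gen v) :
    P.lift (RingQuot.mkAlgHom ℂ (Rel v) (FreeAlgebra.ι ℂ g)) = P.gen g := by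
  simp [Pres.lift]

/-- The degree of a crossing of strands with labels `a` and `b`. -/
def cdeg (a b : ℕ) : ℤ := if a = b then -2 else if a + 1 = b ∨ b + 1 = a then 1 else 0

theorem cdeg_comm (a b : ℕ) : cdeg a b = cdeg b a := by
  unfold cdeg; split_ifs <;> first | rfl | omega

theorem cdeg_self (a : ℕ) : cdeg a a = -2 := if_pos rfl

theorem cdeg_adj {a b : ℕ} (h : a + 1 = b ∨ b + 1 = a) : cdeg a b = 1 := by
  rw [cdeg, if_neg (by omega), if_pos h]

theorem crossDeg_eq (a b : Fin n) : crossDeg a b = cdeg (a + 1) (b + 1) := by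
  unfold crossDeg cdeg
  simp only [Fin.ext_iff]
  split_ifs <;> first | rfl | omega

theorem neg_two_le_cdeg (a b : ℕ) : -2 ≤ cdeg a b := by
  unfold cdeg; split_ifs <;> omega

/-- The degree of the `k`-th crossing at the bottom word `i`. -/
def Words.cd (i : Words v) (k : ℕ) : ℤ := cdeg (i.lab k) (i.lab (k + 1))

theorem Words.cd_sw (i : Words v) {k : ℕ} (h : k + 1 < size v) : (i.sw k).cd k = i.cd k := by
  rw [cd, lab_sw_left _ h, lab_sw_right _ h, cdeg_comm, cd]

namespace Pres

variable {A : Type*} [Ring A] [Algebra ℂ A] (P : Pres v A)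

theorem e_mul_of_e_mul (i : Words v) {a : A} (h : P.e i * a = a) (j : Words v) :
    P.e j * a = if i = j then a else 0 := by
  split_ifs with hij
  · rw [← hij, h]
  · rw [← h, ← mul_assoc, P.e_mul_ne (Ne.symm hij), zero_mul]

theorem e_mul_cr_mul {k : ℕ} {i : Words v} {a : A} (h : P.e i * a = a) :
    P.e (i.sw k) * (P.cr k * a) = P.cr k * a := by
  rw [← mul_assoc, ← P.cr_mul_e, mul_assoc, h]

open AddMonoidAlgebra

/-- The crossings, with their degree recorded. -/
def coactCr (k : ℕ) : AddMonoidAlgebra A ℤ := ∑ i, single (i.cd k) (P.cr k * P.e i)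

theorem coactCr_mul (k : ℕ) (i : Words v) {a : A} (h : P.e i * a = a) (d : ℤ) :
    P.coactCr k * single d a = single (i.cd k + d) (P.cr k * a) := by
  rw [coactCr, Finset.sum_mul, Finset.sum_eq_single i]
  · rw [single_mul_single, mul_assoc, h]
  · intro j _ hj
    rw [single_mul_single, mul_assoc, P.e_mul_of_e_mul i h j, if_neg hj.symm, mul_zero,
      single_zero]
  · simp

theorem single_sum_e : ∑ i, single (0 : ℤ) (P.e i) = 1 := by
  have := map_sum (AddMonoidAlgebra.singleAddHom (R := A) (0 : ℤ)) (fun i => P.e i) Finset.univ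
  rw [P.sum_e] at this
  exact this.symm

theorem coact_ext {x z : AddMonoidAlgebra A ℤ}
    (h : ∀ i, x * single 0 (P.e i) = z * single 0 (P.e i)) : x = z := by
  rw [← mul_one x, ← mul_one z, ← P.single_sum_e, Finset.mul_sum, Finset.mul_sum]
  exact Finset.sum_congr rfl fun i _ => h i

theorem coactCr_one (k : ℕ) (i : Words v) : P.coactCr k * single 0 (P.e i)
      = single (i.cd k) (P.cr k * P.e i) := by
  rw [P.coactCr_mul k i (P.e_mul_self i), add_zero]

theorem coactCr_two (k l : ℕ) (i : Words v) :
    P.coactCr k * P.coactCr l * single 0 (P.e i)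
      = single ((i.sw l).cd k + i.cd l) (P.cr k * P.cr l * P.e i) := by
  rw [mul_assoc, coactCr_one, P.coactCr_mul k _ (P.e_mul_cr_mul (P.e_mul_self i)), mul_assoc]

theorem coactCr_three (k l m : ℕ) (i : Words v) :
    P.coactCr k * P.coactCr l * P.coactCr m * single 0 (P.e i)
      = single (((i.sw m).sw l).cd k + ((i.sw m).cd l + i.cd m))
        (P.cr k * P.cr l * P.cr m * P.e i) := by
  rw [mul_assoc, mul_assoc, ← mul_assoc (P.coactCr l), coactCr_two, mul_assoc (P.cr l),
    P.coactCr_mul k _ (P.e_mul_cr_mul (P.e_mul_cr_mul (P.e_mul_self i)))]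
  simp only [mul_assoc]

theorem coactCr_Y (k l : ℕ) (i : Words v) :
    P.coactCr k * single 2 (P.Y l) * single 0 (P.e i)
      = single (i.cd k + 2) (P.cr k * P.Y l * P.e i) := by
  rw [mul_assoc, single_mul_single, P.coactCr_mul k i, add_zero, mul_assoc]
  rw [P.Y_mul_e, ← mul_assoc, P.e_mul_self]

theorem Y_coactCr (k l : ℕ) (i : Words v) :
    single 2 (P.Y l) * P.coactCr k * single 0 (P.e i)
      = single (i.cd k + 2) (P.Y l * P.cr k * P.e i) := by
  rw [mul_assoc, coactCr_one, single_mul_single, add_comm, mul_assoc]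

/-- On either side of a triple point every pair of the three strands crosses exactly once. -/
theorem _root_.KLRW.Words.cd_triple (k : ℕ) (i : Words v) (h : k + 2 < size v) :
    ((i.sw k).sw (k + 1)).cd k + ((i.sw k).cd (k + 1) + i.cd k)
        = cdeg (i.lab k) (i.lab (k + 1)) + cdeg (i.lab k) (i.lab (k + 2)) +
        cdeg (i.lab (k + 1)) (i.lab (k + 2)) ∧
      ((i.sw (k + 1)).sw k).cd (k + 1) + ((i.sw (k + 1)).cd k + i.cd (k + 1))
        = cdeg (i.lab k) (i.lab (k + 1)) + cdeg (i.lab k) (i.lab (k + 2)) +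
        cdeg (i.lab (k + 1)) (i.lab (k + 2)) := by
  have h2 : k + 1 + 1 < size v := by omega
  have h1 : k + 1 < size v := by omega
  simp only [Words.cd, Words.lab_sw _ h1, Words.lab_sw _ h2]
  have e1 : Equiv.swap (k + 1) (k + 1 + 1) k = k :=
    Equiv.swap_apply_of_ne_of_ne (by omega) (by omega)
  have e2 : Equiv.swap k (k + 1) (k + 1 + 1) = k + 1 + 1 :=
    Equiv.swap_apply_of_ne_of_ne (by omega) (by omega)
  simp only [Equiv.swap_apply_left, Equiv.swap_apply_right, e1, e2]
  constructor <;> ring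

theorem coactCr_triple (k : ℕ) (i : Words v) (h : k + 2 < size v) :
    (P.coactCr k * P.coactCr (k + 1) * P.coactCr k -
      P.coactCr (k + 1) * P.coactCr k * P.coactCr (k + 1)) * single 0 (P.e i) =
    single (cdeg (i.lab k) (i.lab (k + 1)) + cdeg (i.lab k) (i.lab (k + 2)) +
        cdeg (i.lab (k + 1)) (i.lab (k + 2)))
      ((P.cr k * P.cr (k + 1) * P.cr k - P.cr (k + 1) * P.cr k * P.cr (k + 1)) * P.e i) := by
  rw [sub_mul, coactCr_three, coactCr_three, (i.cd_triple k h).1, (i.cd_triple k h).2,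
    ← single_sub, sub_mul]

theorem smul_single_eq (c : ℂ) (i : Words v) :
    c • (single 0 (P.e i) : AddMonoidAlgebra A ℤ) = single 0 (c • P.e i) := by
  exact AddMonoidAlgebra.smul_single c (0 : ℤ) (P.e i)

/-- The presentation inside the Laurent polynomials with the degrees recorded. -/
def coact : Pres v (AddMonoidAlgebra A ℤ) where
  e i := single 0 (P.e i)
  Y k := single 2 (P.Y k)
  cr := P.coactCr
  e_mul_self i := by rw [single_mul_single, P.e_mul_self, add_zero]
  e_mul_ne h := by rw [single_mul_single, P.e_mul_ne h, single_zero]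
  sum_e := P.single_sum_e
  Y_mul_e k i := by rw [single_mul_single, single_mul_single, P.Y_mul_e, add_comm]
  cr_mul_e k i := by
    rw [coactCr_one]
    simp only [coactCr, Finset.mul_sum, single_mul_single]
    rw [Finset.sum_eq_single i]
    · rw [← mul_assoc, ← P.cr_mul_e, mul_assoc, P.e_mul_self, zero_add]
    · intro j _ hj
      rw [← mul_assoc, ← P.cr_mul_e, mul_assoc, P.e_mul_ne hj.symm, mul_zero, single_zero]
    · simp
  cr_of_le h := by simp [coactCr, P.cr_of_le h]
  Y_of_le h := by rw [P.Y_of_le h, single_zero]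
  cr_mul_e_red h1 h2 := by rw [coactCr_one, P.cr_mul_e_red h1 h2, single_zero]
  Y_mul_Y k l := by rw [single_mul_single, single_mul_single, P.Y_mul_Y]
  Y_mul_cr_far h1 h2 := P.coact_ext fun i => by
    rw [coactCr_Y, Y_coactCr, P.Y_mul_cr_far h1 h2]
  cr_mul_cr_far {k l} h := P.coact_ext fun i => by
    rw [coactCr_two, coactCr_two, P.cr_mul_cr_far h]
    congr 1
    simp only [Words.cd]
    rw [Words.lab_sw_of_ne _ (by omega) (by omega), Words.lab_sw_of_ne _ (by omega) (by omega),
      Words.lab_sw_of_ne _ (by omega) (by omega), Words.lab_sw_of_ne _ (by omega) (by omega),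
      add_comm]
  Y_mul_cr_left k i := by
    rw [coactCr_Y, Y_coactCr, P.Y_mul_cr_left, single_add, smul_single_eq]
    congr 1
    -- If the error term is present, the labels are equal and the crossing has degree `-2`; together
    -- with the dot this gives degree `0`, that of the idempotent.
    by_cases h : k + 1 < size v ∧ i.lab k = i.lab (k + 1) ∧ i.lab k ≠ n
    · rw [Words.cd, cdeg, if_pos h.2.1]; rfl
    · rw [eps, if_neg h]; simp
  cr_mul_Y_left k i := by
    rw [coactCr_Y, Y_coactCr, P.cr_mul_Y_left, single_add, smul_single_eq]
    congr 1
    by_cases h : k + 1 < size v ∧ i.lab k = i.lab (k + 1) ∧ i.lab k ≠ n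
    · rw [Words.cd, cdeg, if_pos h.2.1]; rfl
    · rw [eps, if_neg h]; simp
  cr_sq_eq h := by rw [coactCr_two, P.cr_sq_eq h, single_zero]
  cr_sq_far hk h h1 h2 := by
    rw [coactCr_two, P.cr_sq_far hk h h1 h2, Words.cd_sw _ hk, Words.cd, cdeg, if_neg h,
      if_neg (by tauto), add_zero]
  cr_sq_up {k i} h := by
    have hk : k + 1 < size v := by
      by_contra hk
      simp [Words.lab, hk] at h
    rw [coactCr_two, P.cr_sq_up h, Words.cd_sw _ hk, Words.cd, cdeg, if_neg (by omega),
      if_pos (by tauto), ← single_sub, single_mul_single]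
    rfl
  cr_sq_down hk h := by
    rw [coactCr_two, P.cr_sq_down hk h, Words.cd_sw _ hk, Words.cd, cdeg, if_neg (by omega),
      if_pos (by tauto), ← single_sub, single_mul_single]
    rfl
  triple_down hk h1 h2 h3 := by
    rw [P.coactCr_triple _ _ hk, P.triple_down hk h1 h2 h3, ← h1]
    -- The three crossings have degrees `1`, `-2` and `1`, with sum `0`, as needed for an
    -- idempotent.
    rw [cdeg_self, cdeg_adj (Or.inr h2), cdeg_adj (Or.inl h2)]
    rfl
  triple_up hk h1 h2 := by
    rw [P.coactCr_triple _ _ hk, P.triple_up hk h1 h2, ← h1, single_neg]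
    rw [cdeg_self, cdeg_adj (Or.inl h2), cdeg_adj (Or.inr h2)]
    rfl
  triple_far {k i} h := by
    by_cases hk : k + 2 < size v
    · rw [P.coactCr_triple _ _ hk, P.triple_far h, single_zero]
    · simp [coactCr, P.cr_of_le (show size v ≤ k + 1 + 1 by omega)]

end Pres

end KLRW
end

/-! ### The grading of the algebra, obtained from the coaction. -/

noncomputable section

namespace KLRW

variable {n : ℕ} {v : Fin n → ℕ}

/-- A grading of an algebra with a presentation, compatible with the degrees of the generators. -/
structure Pres.Grading {A : Type*} [Ring A] [Algebra ℂ A] (P : Pres v A)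
    (G : ℤ → Submodule ℂ A) : Prop where
  mul_mem {d d' : ℤ} {a b : A} : a ∈ G d → b ∈ G d' → a * b ∈ G (d + d')
  e_mem (i) : P.e i ∈ G 0
  Y_mem (k) : P.Y k ∈ G 2
  cr_mem (k) (i : Words v) : P.cr k * P.e i ∈ G (i.cd k)
  alg_zero : P.alg 0 = ⊤
  internal : DirectSum.IsInternal G

theorem pres_cr (k : Fin (size v - 1)) : (pres v).cr k = ψ k := by simp [pres, cr]

theorem pres_Y (k : Fin (size v)) : (pres v).Y k = y k := by simp [pres, Y]

/-- The coaction recording degrees. -/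
def coaction (v : Fin n → ℕ) : T v →ₐ[ℂ] AddMonoidAlgebra (T v) ℤ := (pres v).coact.lift

theorem coaction_e (i : Words v) : coaction v (e i) = AddMonoidAlgebra.single 0 (e i) :=
  (pres v).coact.lift_mk (.idem i)

theorem coaction_y (k : Fin (size v)) : coaction v (y k) = AddMonoidAlgebra.single 2 (y k) := by
  refine ((pres v).coact.lift_mk (.dot k)).trans ?_
  change AddMonoidAlgebra.single 2 ((pres v).Y k) = _
  rw [pres_Y]

theorem coaction_ψ (k : Fin (size v - 1)) : coaction v (ψ k) = (pres v).coactCr k :=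
  (pres v).coact.lift_mk (.cross k)

theorem IsDiagram.e_mul {x : T v} {i : Words v} {d : ℤ} (h : IsDiagram x i d) : e i * x = x := by
  induction h with
  | idem i => exact e_mul_self i
  | @dot k x i d h ih =>
    have h1 : e i * y k = y k * e i := by rw [← pres_Y]; exact ((pres v).Y_mul_e k i).symm
    rw [← mul_assoc, h1, mul_assoc, ih]
  | cross k h h' ih =>
    rw [← pres_cr, Words.swap_eq_sw]
    exact (pres v).e_mul_cr_mul ih

theorem IsDiagram.coaction {x : T v} {i : Words v} {d : ℤ} (h : IsDiagram x i d) :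
    coaction v x = AddMonoidAlgebra.single d x := by
  induction h with
  | idem i => exact coaction_e i
  | dot k h ih => rw [map_mul, ih, coaction_y, AddMonoidAlgebra.single_mul_single, add_comm]
  | @cross k x i d h h' ih =>
    rw [map_mul, ih, coaction_ψ, (pres v).coactCr_mul k i h'.e_mul, pres_cr, add_comm]
    congr 2
    rw [crossDeg_eq, Words.cd, Words.lab_of_lt _ (by omega), Words.lab_of_lt _ (by omega)]
    rfl

/-- The property that left multiplication by `x` preserves `S` is stable under sums and products of
such `x`, so it is enough to have it for the generators. -/
theorem mkAlgHom_induction {S : Submodule ℂ (T v)} (h1 : (1 : T v) ∈ S)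
    (he : ∀ i, ∀ x ∈ S, e i * x ∈ S) (hy : ∀ k, ∀ x ∈ S, y k * x ∈ S)
    (hψ : ∀ k, ∀ x ∈ S, ψ k * x ∈ S) : S = ⊤ := by
  rw [eq_top_iff]
  rintro x -
  obtain ⟨x, rfl⟩ := RingQuot.mkAlgHom_surjective ℂ (Rel v) x
  suffices h : ∀ z ∈ S, RingQuot.mkAlgHom ℂ (Rel v) x * z ∈ S by simpa using h 1 h1
  induction x using FreeAlgebra.induction with
  | grade0 r =>
    intro z hz
    rw [AlgHom.commutes, ← Algebra.smul_def]
    exact S.smul_mem _ hz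
  | grade1 g =>
    intro z hz
    cases g with
    | idem i => exact he i z hz
    | dot k => exact hy k z hz
    | cross k => exact hψ k z hz
  | mul a b ha hb =>
    intro z hz
    rw [map_mul, mul_assoc]
    exact ha _ (hb _ hz)
  | add a b ha hb =>
    intro z hz
    rw [map_add, add_mul]
    exact S.add_mem (ha _ hz) (hb _ hz)

/-- Left multiplication by a generator sends a diagram to a diagram or to zero: idempotents of a
wrong word and crossings of red strands give zero. -/
theorem span_diagrams : Submodule.span ℂ {x : T v | ∃ i d, IsDiagram x i d} = ⊤ := by
  have key : ∀ f : T v →ₗ[ℂ] T v, (∀ x i d, IsDiagram x i d →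
      f x ∈ Submodule.span ℂ {x : T v | ∃ i d, IsDiagram x i d}) →
      ∀ x ∈ Submodule.span ℂ {x : T v | ∃ i d, IsDiagram x i d},
      f x ∈ Submodule.span ℂ {x : T v | ∃ i d, IsDiagram x i d} := by
    intro f hf x hx
    have : Submodule.span ℂ {x : T v | ∃ i d, IsDiagram x i d} ≤
        (Submodule.span ℂ {x : T v | ∃ i d, IsDiagram x i d}).comap f := by
      refine Submodule.span_le.2 ?_
      rintro x ⟨i, d, h⟩
      exact hf x i d h
    exact this hx
  refine mkAlgHom_induction ?_ ?_ ?_ ?_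
  · rw [← sum_e]
    exact Submodule.sum_mem _ fun i _ => Submodule.subset_span ⟨i, 0, .idem i⟩
  · intro i
    refine key (LinearMap.mulLeft ℂ (e i)) fun x j d h => ?_
    rw [LinearMap.mulLeft_apply]
    have := (pres v).e_mul_of_e_mul j h.e_mul i
    change e i * x = _ at this
    rw [this]
    split_ifs
    · exact Submodule.subset_span ⟨j, d, h⟩
    · exact Submodule.zero_mem _
  · intro k
    refine key (LinearMap.mulLeft ℂ (y k)) fun x j d h => ?_
    exact Submodule.subset_span ⟨j, _, .dot k h⟩
  · intro k
    refine key (LinearMap.mulLeft ℂ (ψ k)) fun x j d h => ?_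
    rw [LinearMap.mulLeft_apply]
    by_cases hr : j.RedPair k
    · have : ψ k * x = 0 := by
        rw [← h.e_mul, ← mul_assoc, ← pres_cr]
        have h0 : (pres v).cr k * e j = 0 := (pres v).cr_mul_e_red
          ((isRed_iff_lab j (by omega)).1 hr.1) ((isRed_iff_lab j (by omega)).1 hr.2)
        rw [h0, zero_mul]
      rw [this]
      exact Submodule.zero_mem _
    · exact Submodule.subset_span ⟨_, _, .cross k hr h⟩

theorem coaction_of_mem {d : ℤ} {x : T v} (hx : x ∈ component v d) :
    coaction v x = AddMonoidAlgebra.single d x := by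
  induction hx using Submodule.span_induction with
  | mem x hx => obtain ⟨i, h⟩ := hx; exact h.coaction
  | zero => rw [map_zero, AddMonoidAlgebra.single_zero]
  | add x z _ _ hx hz => rw [map_add, hx, hz, AddMonoidAlgebra.single_add]
  | smul c x _ hx => rw [map_smul, hx]; exact AddMonoidAlgebra.smul_single c d x

theorem coeff_coaction_mem (x : T v) (d : ℤ) : (coaction v x).coeff d ∈ component v d := by
  have hx : x ∈ Submodule.span ℂ {x : T v | ∃ i d, IsDiagram x i d} := by
    rw [span_diagrams]; trivial
  induction hx using Submodule.span_induction with
  | mem x hx =>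
    obtain ⟨i, d', h⟩ := hx
    rw [h.coaction, AddMonoidAlgebra.coeff_single, Finsupp.single_apply]
    split_ifs with hd
    · subst hd; exact Submodule.subset_span ⟨i, h⟩
    · exact Submodule.zero_mem _
  | zero => rw [map_zero]; exact Submodule.zero_mem _
  | add x z _ _ hx hz => rw [map_add]; exact Submodule.add_mem _ hx hz
  | smul c x _ hx => rw [map_smul]; exact Submodule.smul_mem _ c hx

/-- This turns a span of diagrams into an equation for an algebra homomorphism, from which
compatibility with products is immediate. -/
theorem mem_component_iff {d : ℤ} {x : T v} :
    x ∈ component v d ↔ coaction v x = AddMonoidAlgebra.single d x := by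
  refine ⟨coaction_of_mem, fun h => ?_⟩
  have := coeff_coaction_mem x d
  rwa [h, AddMonoidAlgebra.coeff_single, Finsupp.single_eq_same] at this

/-- The coefficients of the coaction are projections onto the components, whence independence; the
components exhaust the algebra because diagrams span it. -/
theorem isInternal_component (v : Fin n → ℕ) : DirectSum.IsInternal (component v) := by
  constructor
  · have h : ∀ (z : DirectSum ℤ fun d => component v d) (d : ℤ),
        (coaction v (DirectSum.coeAddMonoidHom (component v) z)).coeff d = z d := by
      intro z d
      induction z using DirectSum.induction_on with
      | zero => rw [map_zero, map_zero]; rfl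
      | of d' x =>
        rw [DirectSum.coeAddMonoidHom_of, coaction_of_mem x.2, AddMonoidAlgebra.coeff_single,
          Finsupp.single_apply, DirectSum.coe_of_apply]
        split_ifs <;> rfl
      | add a b ha hb =>
        rw [map_add, map_add, AddMonoidAlgebra.coeff_add, Finsupp.add_apply, ha, hb]; rfl
    intro a b hab
    ext d
    rw [← h a, ← h b, hab]
  · intro x
    have hx : x ∈ Submodule.span ℂ {x : T v | ∃ i d, IsDiagram x i d} := by
      rw [span_diagrams]; trivial
    induction hx using Submodule.span_induction with
    | mem x hx =>
      obtain ⟨i, d, h⟩ := hx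
      exact ⟨DirectSum.of (fun d => component v d) d ⟨x, Submodule.subset_span ⟨i, h⟩⟩,
        DirectSum.coeAddMonoidHom_of _ _ _⟩
    | zero => exact ⟨0, map_zero _⟩
    | add x z _ _ hx hz =>
      obtain ⟨a, rfl⟩ := hx
      obtain ⟨b, rfl⟩ := hz
      exact ⟨a + b, map_add _ _ _⟩
    | smul c x _ hx =>
      obtain ⟨a, rfl⟩ := hx
      exact ⟨c • a, (DirectSum.coeLinearMap (component v)).map_smul c a⟩

theorem pres_grading (v : Fin n → ℕ) : (pres v).Grading (component v) where
  mul_mem {d d' a b} ha hb := by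
    rw [mem_component_iff] at *
    rw [map_mul, ha, hb, AddMonoidAlgebra.single_mul_single]
  e_mem i := Submodule.subset_span ⟨i, .idem i⟩
  Y_mem k := by
    change Y k ∈ _
    rw [Y]; split_ifs with h
    · rw [mem_component_iff, coaction_y]
    · exact Submodule.zero_mem _
  cr_mem k i := by
    by_cases h : k < size v - 1
    · have := pres_cr (v := v) ⟨k, h⟩
      simp only at this
      rw [this, mem_component_iff, map_mul]
      change _ * coaction v (e i) = AddMonoidAlgebra.single _ (_ * e i)
      rw [coaction_e, coaction_ψ, ← this]
      exact (pres v).coactCr_one k i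
    · rw [(pres v).cr_of_le (by omega), zero_mul]
      exact Submodule.zero_mem _
  alg_zero := by
    have : Subalgebra.toSubmodule ((pres v).alg 0) = ⊤ := by
      refine mkAlgHom_induction (one_mem ((pres v).alg 0)) ?_ ?_ ?_
      · intro i x hx
        exact Subalgebra.mul_mem ((pres v).alg 0) ((pres v).e_mem_alg 0 i) hx
      · intro k x hx
        rw [← pres_Y]
        exact Subalgebra.mul_mem ((pres v).alg 0) ((pres v).Y_mem_alg 0 k) hx
      · intro k x hx
        rw [← pres_cr]
        exact Subalgebra.mul_mem ((pres v).alg 0) ((pres v).cr_mem_alg (Nat.zero_le _)) hx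
    exact Algebra.toSubmodule_eq_top.1 this
  internal := isInternal_component v

end KLRW
end

/-! ### Shuffles of segments span cyclic modules. -/

noncomputable section

namespace KLRW

variable {n : ℕ} {v : Fin n → ℕ}

theorem Words.lab_mv (i : Words v) {p m : ℕ} (h : p + m < size v) :
    (i.mv p m).lab p = i.lab (p + m) ∧ (∀ t < m, (i.mv p m).lab (p + 1 + t) = i.lab (p + t)) ∧
    ∀ s, (s < p ∨ p + m < s) → (i.mv p m).lab s = i.lab s := by
  induction m generalizing i with
  | zero => simp [mv]
  | succ m ih =>
    obtain ⟨h1, h2, h3⟩ := ih (i.sw (p + m)) (by omega)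
    refine ⟨?_, ?_, ?_⟩
    · rw [mv, h1, lab_sw_left _ (by omega), add_assoc]
    · intro t ht
      rw [mv]
      rcases Nat.lt_succ_iff_lt_or_eq.1 ht with ht' | rfl
      · rw [h2 t ht', lab_sw_of_ne _ (by omega) (by omega)]
      · rw [h3 _ (Or.inr (by omega)), show p + 1 + t = p + t + 1 by ring,
          lab_sw_right _ (by omega)]
    · intro s hs
      rw [mv, h3 s (by omega), lab_sw_of_ne _ (by omega) (by omega)]

/-- The flag of the first entry is set: what remains of a segment starts a segment. -/
def mark : List (ℕ × Bool) → List (ℕ × Bool)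
  | [] => []
  | a :: L => (a.1, true) :: L

theorem map_fst_mark (L : List (ℕ × Bool)) : (mark L).map Prod.fst = L.map Prod.fst := by
  cases L <;> rfl

theorem length_mark (L : List (ℕ × Bool)) : (mark L).length = L.length := by
  cases L <;> rfl

/-- The letters of `i` from position `p` on are those of `L`. -/
def Words.Agrees (i : Words v) (p : ℕ) (w : List ℕ) : Prop :=
  (List.range' p w.length).map i.lab = w ∧ p + w.length = size v

theorem Words.Agrees.split {i : Words v} {p : ℕ} {w1 w2 : List ℕ} {a : ℕ}
    (h : i.Agrees p (w1 ++ a :: w2)) :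
    (List.range' p w1.length).map i.lab = w1 ∧ i.lab (p + w1.length) = a ∧
      (List.range' (p + w1.length + 1) w2.length).map i.lab = w2 := by
  have h1 := h.1
  rw [List.length_append, ← List.range'_append_1, List.map_append] at h1
  obtain ⟨h2, h3⟩ := List.append_inj h1 (by simp)
  rw [List.length_cons, List.range'_succ, List.map_cons, List.cons_eq_cons] at h3
  exact ⟨h2, h3.1, h3.2⟩

theorem Words.Agrees.mv {i : Words v} {p : ℕ} {w1 w2 : List ℕ} {a : ℕ}
    (h : i.Agrees p (w1 ++ a :: w2)) :
    (i.mv p w1.length).Agrees (p + 1) (w1 ++ w2) ∧ (i.mv p w1.length).lab p = a := by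
  obtain ⟨h1, h2, h3⟩ := h.split
  have hl := h.2
  simp only [List.length_append, List.length_cons] at hl
  obtain ⟨g1, g2, g3⟩ := i.lab_mv (p := p) (m := w1.length) (by omega)
  refine ⟨⟨?_, by simp; omega⟩, by rw [g1, h2]⟩
  rw [List.length_append, ← List.range'_append_1, List.map_append]
  congr 1
  · conv_rhs => rw [← h1]
    apply List.ext_getElem (by simp)
    intro t ht _
    simp only [List.length_map, List.length_range'] at ht
    simp [g2 t ht]
  · conv_rhs => rw [← h3]
    apply List.ext_getElem (by simp)
    intro t ht _
    simp only [List.length_map, List.length_range'] at ht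
    simp only [List.getElem_map, List.getElem_range', one_mul]
    rw [g3 _ (Or.inr (by omega))]
    congr 1; ring

namespace Pres

variable {A : Type*} [Ring A] [Algebra ℂ A] (P : Pres v A)

/-- The shuffles of the segments of a flagged word `L` at the positions from `p` on: `Sh p L t w d`
says that `t` is a product of crossings of degree `d` that leads from `L` to the word `w`, in which
the letters of `w` are fetched one after the other. -/
inductive Sh : ℕ → List (ℕ × Bool) → A → List ℕ → ℤ → Prop
  | nil (p : ℕ) : Sh p [] 1 [] 0
  -- Only the first remaining letter of a segment may be fetched, which is what the flag `true`
  -- says; its successor then becomes the first one and is flagged by `mark`. A red letter may not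
  -- overtake another red letter.
  | cons {p : ℕ} {L1 : List (ℕ × Bool)} {a : ℕ} {L2 : List (ℕ × Bool)} {t : A} {w : List ℕ}
      {d : ℤ} : ¬ (a = n ∧ n ∈ L1.map Prod.fst) → Sh (p + 1) (L1 ++ mark L2) t w d →
      Sh p (L1 ++ (a, true) :: L2) (t * P.C p L1.length) (a :: w)
        (d + (L1.map fun b => cdeg b.1 a).sum)

variable {P} {G : ℤ → Submodule ℂ A}

theorem Grading.C_mem (hG : P.Grading G) (p m : ℕ) (i : Words v) :
    P.C p m * P.e i ∈ G (((List.range' p m).map fun t => cdeg (i.lab t) (i.lab (p + m))).sum) := by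
  induction m generalizing i with
  | zero => simpa using hG.e_mem i
  | succ m ih =>
    by_cases h : p + m + 1 < size v
    · have h1 := hG.mul_mem (ih (i.sw (p + m))) (hG.cr_mem (p + m) i)
      have h2 : P.C p (m + 1) * P.e i =
          P.C p m * P.e (i.sw (p + m)) * (P.cr (p + m) * P.e i) := by
        rw [mul_assoc, P.e_mul_cr_mul (P.e_mul_self i), C_succ, mul_assoc]
      rw [h2]
      convert h1 using 2
      rw [List.range'_1_concat, List.map_append, List.sum_append]
      congr 1
      · congr 1
        apply List.map_congr_left
        intro t ht
        rw [List.mem_range'_1] at ht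
        rw [Words.lab_sw_left _ h, Words.lab_sw_of_ne _ (by omega) (by omega), add_assoc]
      · simp [Words.cd, add_assoc]
    · rw [P.C_eq_zero (by omega) (by omega), zero_mul]
      exact Submodule.zero_mem _

/-- The fetched red strand would have to cross another red strand. -/
theorem C_mul_e_red {p m : ℕ} {i : Words v} (h : i.lab (p + m) = n)
    (h' : ∃ t < m, i.lab (p + t) = n) : P.C p m * P.e i = 0 := by
  induction m generalizing i with
  | zero => simp at h'
  | succ m ih =>
    by_cases hs : p + m + 1 < size v
    swap
    · rw [P.C_eq_zero (by omega) (by omega), zero_mul]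
    by_cases h0 : i.lab (p + m) = n
    · rw [C_succ, mul_assoc, P.cr_mul_e_red h0 h, mul_zero]
    · obtain ⟨t, ht, h2⟩ := h'
      have ht' : t < m := by
        rcases Nat.lt_succ_iff_lt_or_eq.1 ht with ht' | rfl
        · exact ht'
        · exact absurd h2 h0
      rw [C_succ, mul_assoc, P.cr_mul_e, ← mul_assoc, ih, zero_mul]
      · rw [Words.lab_sw_left _ hs]; exact h
      · exact ⟨t, ht', by rw [Words.lab_sw_of_ne _ (by omega) (by omega), h2]⟩

/-- A fetch touches positions from `p` on only, and its degree is the sum of the crossing degrees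
with the letters it passes, which is the summand recorded in `Sh`. So the combinatorial data `w` and
`d` are the actual word and degree. -/
theorem Sh.word (hG : P.Grading G) {p : ℕ} {L : List (ℕ × Bool)} {t : A} {w : List ℕ} {d : ℤ}
    (h : P.Sh p L t w d) {i : Words v} (hi : i.Agrees p (L.map Prod.fst)) :
    ∃ j : Words v, t * P.e i = P.e j * t ∧ (∀ m < p, j.lab m = i.lab m) ∧ j.Agrees p w ∧
      t * P.e i ∈ G d := by
  induction h generalizing i with
  | nil p => exact ⟨i, by simp, fun _ _ => rfl, hi, by simpa using hG.e_mem i⟩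
  | @cons p L1 a L2 t w d hr h ih =>
    rw [List.map_append, List.map_cons] at hi
    have hi' := hi.mv
    rw [List.length_map] at hi'
    obtain ⟨j, h1, h2, h3, h4⟩ := ih (i := i.mv p L1.length) (by
      rw [List.map_append, map_fst_mark]; exact hi'.1)
    have hl := hi.2
    simp only [List.length_append, List.length_cons, List.length_map] at hl
    obtain ⟨g1, g2, g3⟩ := i.lab_mv (p := p) (m := L1.length) (by omega)
    refine ⟨j, ?_, ?_, ⟨?_, ?_⟩, ?_⟩
    · rw [mul_assoc, P.C_mul_e, ← mul_assoc, h1, mul_assoc]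
    · intro m hm
      rw [h2 m (by omega), g3 m (Or.inl hm)]
    · rw [List.length_cons, List.range'_succ, List.map_cons, h3.1, h2 p (by omega), hi'.2]
    · have := h3.2
      simp only [List.length_cons]; omega
    · have hC := hG.C_mem p L1.length i
      have e1 : t * P.C p L1.length * P.e i =
          t * P.e (i.mv p L1.length) * (P.C p L1.length * P.e i) := by
        rw [mul_assoc t (P.C _ _), P.C_mul_e, mul_assoc t (P.e _), ← mul_assoc (P.e _) (P.e _),
          P.e_mul_self]
      rw [e1]
      convert hG.mul_mem h4 hC using 3
      have hs := hi.split
      have := hs.1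
      rw [List.length_map] at this
      have h5 := hs.2.1
      rw [List.length_map] at h5
      have e2 : L1.map (fun b => cdeg b.1 a) = (L1.map Prod.fst).map fun b => cdeg b a := by
        rw [List.map_map]; rfl
      rw [e2, ← this, List.map_map, h5]; rfl

theorem Sh.length {p : ℕ} {L : List (ℕ × Bool)} {t : A} {w : List ℕ} {d : ℤ}
    (h : P.Sh p L t w d) : w.length = L.length := by
  induction h with
  | nil => rfl
  | cons _ _ ih =>
    simp only [List.length_append, List.length_cons, length_mark] at *; omega

/-- A shuffle is determined by the positions from which the letters are fetched. Keeping the degree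
in the pair serves both the finite dimension of standard modules and the upper bound for their
degrees. -/
theorem finite_Sh (p : ℕ) (L : List (ℕ × Bool)) :
    {x : A × ℤ | ∃ w, P.Sh p L x.1 w x.2}.Finite := by
  obtain ⟨r, hr⟩ : ∃ r, L.length = r := ⟨_, rfl⟩
  induction r generalizing p L with
  | zero =>
    obtain rfl := List.length_eq_zero_iff.1 hr
    refine (Set.finite_singleton ((1 : A), (0 : ℤ))).subset ?_
    rintro ⟨t, d⟩ ⟨w, h⟩
    generalize hL : ([] : List (ℕ × Bool)) = L at h
    cases h with
    | nil => rfl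
    | cons _ _ => simp at hL
  | succ r ih =>
    have : ∀ m : ℕ, {x : A × ℤ | ∃ w, P.Sh (p + 1) (L.take m ++ mark (L.drop (m + 1))) x.1 w x.2 ∧
        m < L.length}.Finite := by
      intro m
      by_cases hm : m < L.length
      · refine (ih (p + 1) (L.take m ++ mark (L.drop (m + 1))) ?_).subset ?_
        · simp [length_mark]; omega
        · rintro x ⟨w, h, _⟩; exact ⟨w, h⟩
      · convert Set.finite_empty
        ext x
        simp [hm]
    refine (Set.finite_iUnion fun m : Fin (L.length) =>
      (this m).image fun x => (x.1 * P.C p m,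
        x.2 + ((L.take m).map fun b => cdeg b.1 L[m].1).sum)).subset ?_
    rintro ⟨t, d⟩ ⟨w, h⟩
    cases h with
    | nil => simp at hr
    | @cons _ L1 a L2 t w d hr h =>
      refine Set.mem_iUnion.2 ⟨⟨L1.length, by simp⟩, (t, d), ⟨w, ?_, by simp⟩, ?_⟩
      · simpa using h
      · refine Prod.ext rfl ?_
        change d + _ = d + _
        simp

theorem smul_mem_of_generators {M : Type*} [AddCommGroup M] [Module A M] [Module ℂ M]
    [IsScalarTower ℂ A M] {p : ℕ} {S : Submodule ℂ M} (he : ∀ i, ∀ z ∈ S, P.e i • z ∈ S)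
    (hY : ∀ k, ∀ z ∈ S, P.Y k • z ∈ S) (hcr : ∀ k, p ≤ k → ∀ z ∈ S, P.cr k • z ∈ S) {a : A}
    (ha : a ∈ P.alg p) {z : M} (hz : z ∈ S) : a • z ∈ S := by
  induction ha using Algebra.adjoin_induction generalizing z with
  | mem x hx =>
    rcases hx with (⟨i, rfl⟩ | ⟨k, rfl⟩) | ⟨k, hk, rfl⟩
    · exact he i z hz
    · exact hY k z hz
    · exact hcr k hk z hz
  | algebraMap r => rw [algebraMap_smul]; exact S.smul_mem _ hz
  | add a b _ _ ha hb => rw [add_smul]; exact S.add_mem (ha hz) (hb hz)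
  | mul a b _ _ ha hb => rw [mul_smul]; exact ha (hb hz)

section

variable {M : Type*} [AddCommGroup M] [Module A M]

theorem e_smul_of_ne {i j : Words v} {x : M} (hx : P.e i • x = x) (h : i ≠ j) :
    P.e j • x = 0 := by
  rw [← hx, ← mul_smul, P.e_mul_ne h.symm, zero_smul]

theorem e_C_smul {i : Words v} {x : M} (hx : P.e i • x = x) (p m : ℕ) :
    P.e (i.mv p m) • P.C p m • x = P.C p m • x := by
  rw [← mul_smul, ← P.C_mul_e, mul_smul, hx]

end

variable {M : Type*} [AddCommGroup M] [Module A M] [Module ℂ M] [IsScalarTower ℂ A M]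

/-- If a vector `x` of weight `L` is an eigenvector of the dots and is killed by the crossings
inside the segments of `L`, up to elements of `D`, then `alg p` maps it into the span of the
shuffles of the segments. -/
theorem smul_mem_sup_span_Sh (p : ℕ) (L : List (ℕ × Bool)) (D : Submodule ℂ M)
    (hD : ∀ a ∈ P.alg p, ∀ z ∈ D, a • z ∈ D) (x : M) (i : Words v) (hx : P.e i • x = x)
    (hi : i.Agrees p (L.map Prod.fst)) (ζ : ℕ → ℂ) (hY : ∀ k, P.Y k • x - ζ k • x ∈ D)
    (hL : ∀ a L', L = a :: L' → a.2 = true)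
    (hcr : ∀ L1 b a L2, L = L1 ++ b :: (a, false) :: L2 → P.cr (p + L1.length) • x ∈ D)
    {a : A} (ha : a ∈ P.alg p) :
    a • x ∈ D ⊔ Submodule.span ℂ {z | ∃ t w d, P.Sh p L t w d ∧ z = t • x} := by
  obtain ⟨r, hr⟩ : ∃ r, L.length = r := ⟨_, rfl⟩
  induction r generalizing p L D x i ζ a with
  | zero =>
    obtain rfl := List.length_eq_zero_iff.1 hr
    have hp : p = size v := by simpa using hi.2
    have hx' : x ∈ D ⊔ Submodule.span ℂ {z | ∃ t w d, P.Sh p [] t w d ∧ z = t • x} :=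
      Submodule.mem_sup_right (Submodule.subset_span ⟨1, [], 0, .nil p, by simp⟩)
    have key : ∀ (g : A), (∀ z ∈ D, g • z ∈ D) → (∃ c : ℂ, g • x - c • x ∈ D) →
        ∀ z ∈ D ⊔ Submodule.span ℂ {x}, g • z ∈ D ⊔ Submodule.span ℂ {x} := by
      rintro g h1 ⟨c, h2⟩ z hz
      obtain ⟨d, hd, y, hy, rfl⟩ := Submodule.mem_sup.1 hz
      obtain ⟨c', rfl⟩ := Submodule.mem_span_singleton.1 hy
      rw [smul_add, smul_algebra_smul_comm, ← sub_add_cancel (g • x) (c • x), smul_add, ← add_assoc]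
      exact Submodule.add_mem _ (Submodule.mem_sup_left
        (D.add_mem (h1 d hd) (D.smul_mem _ h2)))
        (Submodule.mem_sup_right (Submodule.smul_mem _ _ (Submodule.smul_mem _ _
          (Submodule.mem_span_singleton_self x))))
    have hfin : a • x ∈ D ⊔ Submodule.span ℂ {x} := by
      refine smul_mem_of_generators (p := p) (P := P) ?_ ?_ ?_ ha
        (Submodule.mem_sup_right (Submodule.mem_span_singleton_self x))
      · intro j
        refine key _ (hD _ (P.e_mem_alg _ _)) ?_
        by_cases hij : i = j
        · exact ⟨1, by rw [← hij, hx, one_smul, sub_self]; exact D.zero_mem⟩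
        · exact ⟨0, by rw [e_smul_of_ne hx hij, zero_smul, sub_self]; exact D.zero_mem⟩
      · intro k
        exact key _ (hD _ (P.Y_mem_alg _ _)) ⟨ζ k, hY k⟩
      · intro k hk z _
        rw [P.cr_of_le (by omega), zero_smul]
        exact Submodule.zero_mem _
    refine (sup_le le_sup_left ?_ : D ⊔ Submodule.span ℂ {x} ≤ _) hfin
    rw [Submodule.span_singleton_le_iff_mem]
    exact hx'
  | succ r ih =>
    set F := D ⊔ Submodule.span ℂ {z | ∃ t w d, P.Sh p L t w d ∧ z = t • x} with hF
    -- `E q` adds to `D` everything reached with fewer than `q` crossings at the first position. It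
    -- is stable under `alg (p + 1)` and takes the role of `D` when the induction hypothesis is
    -- applied to `C p q • x` at position `p + 1`.
    let E : ℕ → Submodule ℂ M := fun q => D ⊔
      (P.cosets p q).map ((LinearMap.toSpanSingleton A M x).restrictScalars ℂ)
    have memE : ∀ {q : ℕ} {c : A}, c ∈ P.cosets p q → c • x ∈ E q := fun hc =>
      Submodule.mem_sup_right ⟨_, hc, rfl⟩
    have stE : ∀ q, ∀ a ∈ P.alg (p + 1), ∀ z ∈ E q, a • z ∈ E q := by
      intro q a ha z hz
      obtain ⟨d, hd, y, ⟨c, hc, rfl⟩, rfl⟩ := Submodule.mem_sup.1 hz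
      rw [smul_add]
      refine Submodule.add_mem _ (Submodule.mem_sup_left
        (hD _ (P.alg_anti (Nat.le_succ p) ha) d hd)) ?_
      change a • c • x ∈ _
      rw [← mul_smul]
      exact memE (P.mul_mem_cosets ha hc)
    have hE : ∀ q ≤ L.length, E q ≤ F := by
      intro q
      induction q with
      | zero =>
        intro _
        refine sup_le le_sup_left ?_
        rintro _ ⟨c, hc, rfl⟩
        have : P.cosets p 0 = ⊥ := by simp [cosets]
        rw [SetLike.mem_coe, this, Submodule.mem_bot] at hc
        subst hc
        simp
      | succ q ihq =>
        intro hq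
        have hEq := ihq (by omega)
        have hnew : ∀ b ∈ P.alg (p + 1), b • P.C p q • x ∈ F := by
          intro b hb
          obtain ⟨L1, ⟨a, f⟩, L2, rfl, rfl⟩ : ∃ L1 c L2, L = L1 ++ c :: L2 ∧ L1.length = q :=
            ⟨L.take q, L[q], L.drop (q + 1), by simp, by simp; omega⟩
          have hi0 := hi
          rw [List.map_append, List.map_cons] at hi
          have hs := hi.split
          rw [List.length_map] at hs
          cases f with
          | false =>
            -- The letter to be fetched lies inside a segment, and the crossing of `C` that acts
            -- first exchanges it with its predecessor there. This crossing sends `x` into `D`.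
            rcases List.eq_nil_or_concat L1 with rfl | ⟨L1', b', rfl⟩
            · exact absurd (hL _ _ rfl) (by simp)
            · refine Submodule.mem_sup_left (hD _ (P.alg_anti (Nat.le_succ p) hb) _ ?_)
              rw [List.concat_eq_append, List.length_append, List.length_singleton, C_succ, mul_smul]
              refine hD _ (P.C_mem_alg le_rfl _) _ (hcr L1' b' a L2 ?_)
              simp
          | true =>
            by_cases hred : a = n ∧ n ∈ L1.map Prod.fst
            · have : P.C p L1.length * P.e i = 0 := by
                apply C_mul_e_red (by rw [hs.2.1, hred.1])
                have := hred.2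
                rw [← hs.1, List.mem_map] at this
                obtain ⟨t, ht, h⟩ := this
                rw [List.mem_range'_1] at ht
                have e1 : p + (t - p) = t := by omega
                exact ⟨t - p, by omega, by rw [e1]; exact h⟩
              rw [← hx, ← mul_smul (P.C _ _), this, zero_smul, smul_zero]
              exact Submodule.zero_mem _
            · have hi' := hi.mv.1
              rw [List.length_map] at hi'
              -- Modulo shorter terms the dots pass through `C` with indices permuted by `σ`, so the
              -- new vector is again an eigenvector, with eigenvalues `ζ ∘ σ`.
              obtain ⟨σ, hσ⟩ := P.exists_perm_Y_mul_C p L1.length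
              refine (sup_le hEq ?_ : E L1.length ⊔ Submodule.span ℂ {z | ∃ t w d,
                P.Sh (p + 1) (L1 ++ mark L2) t w d ∧ z = t • P.C p L1.length • x} ≤ F)
                (ih (p + 1) (L1 ++ mark L2) (E L1.length) (stE _) (P.C p L1.length • x)
                  (i.mv p L1.length) (e_C_smul hx _ _) ?_ (ζ ∘ σ) ?_ ?_ ?_ hb ?_)
              · refine Submodule.span_le.2 ?_
                rintro _ ⟨t, w, d, h, rfl⟩
                refine Submodule.mem_sup_right (Submodule.subset_span ⟨_, _, _, .cons hred h, ?_⟩)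
                rw [mul_smul]
              · rwa [List.map_append, map_fst_mark]
              · intro k
                have h1 := memE (hσ k)
                rw [sub_smul, mul_smul, mul_smul] at h1
                have h2 := hD _ (P.C_mem_alg le_rfl L1.length) _ (hY (σ k))
                rw [smul_sub, smul_algebra_smul_comm] at h2
                have := Submodule.add_mem _ h1 (Submodule.mem_sup_left h2 : _ ∈ E L1.length)
                simpa using this
              · intro c L' hc
                cases L1 with
                | nil =>
                  cases L2 with
                  | nil => simp [mark] at hc
                  | cons => simp only [mark, List.nil_append, List.cons.injEq] at hc; rw [← hc.1]
                | cons c' L1 =>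
                  simp only [List.cons_append, List.cons.injEq] at hc
                  rw [← hc.1]
                  exact hL _ _ rfl
              · intro K1 b' a' K2 hK
                -- A crossing inside a segment of the remaining word lies to the right of the gap
                -- left by the fetched letter, where it commutes with `C`, or to the left, where it
                -- passes through `C` with its index shifted by one, modulo `E`. It cannot straddle
                -- the gap, because `mark` flags the letter behind it.
                rcases List.append_eq_append_iff.1 hK with ⟨K3, h1, h2⟩ | ⟨K3, h1, h2⟩
                · have hK' : ∃ K4 b'', K4.length = K3.length ∧
                      L2 = K4 ++ b'' :: (a', false) :: K2 := by
                    cases L2 with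
                    | nil => simp [mark] at h2
                    | cons c L2 =>
                      cases K3 with
                      | nil =>
                        simp only [mark, List.nil_append, List.cons.injEq] at h2
                        exact ⟨[], c, rfl, by rw [h2.2]; rfl⟩
                      | cons c' K3 =>
                        simp only [mark, List.cons_append, List.cons.injEq] at h2
                        exact ⟨c :: K3, b', rfl, by rw [h2.2]; rfl⟩
                  obtain ⟨K4, b'', h3, h4⟩ := hK'
                  have h5 := hcr (L1 ++ (a, true) :: K4) b'' a' K2 (by simp [h4])
                  have h6 : p + 1 + K1.length = p + (L1 ++ (a, true) :: K4).length := by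
                    rw [h1]; simp [h3]; ring
                  rw [h6, ← mul_smul, P.cr_mul_C_right (by simp), mul_smul]
                  exact Submodule.mem_sup_left (hD _ (P.C_mem_alg le_rfl _) _ h5)
                · cases K3 with
                  | nil =>
                    cases L2 with
                    | nil => simp [mark] at h2
                    | cons c L2 =>
                      simp only [mark, List.nil_append, List.cons.injEq] at h2
                      have h5 := hcr (L1 ++ [(a, true)]) c a' K2 (by simp [← h2.2])
                      have h6 : p + 1 + K1.length = p + (L1 ++ [(a, true)]).length := by
                        rw [h1]; simp; ring
                      rw [h6, ← mul_smul, P.cr_mul_C_right (by simp), mul_smul]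
                      exact Submodule.mem_sup_left (hD _ (P.C_mem_alg le_rfl _) _ h5)
                  | cons c K3 =>
                    cases K3 with
                    | nil =>
                      cases L2 with
                      | nil => simp [mark] at h2
                      | cons c L2 => simp [mark] at h2
                    | cons c' K3 =>
                      simp only [List.cons_append, List.cons.injEq] at h2
                      obtain ⟨rfl, rfl, h2⟩ := h2
                      have h5 := hcr K1 b' a' (K3 ++ (a, true) :: L2) (by rw [h1]; simp)
                      have h6 := P.C_mul_cr_sub (p := p) (m := L1.length) (k := p + K1.length)
                        (by omega) (by rw [h1]; simp; omega)
                      have h7 := memE h6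
                      have h8 := hD _ (P.C_mem_alg le_rfl L1.length) _ h5
                      rw [sub_smul, mul_smul, mul_smul] at h7
                      have := Submodule.sub_mem _ (Submodule.mem_sup_left h8 : _ ∈ E L1.length) h7
                      rw [sub_sub_cancel] at this
                      rwa [show p + 1 + K1.length = p + K1.length + 1 by ring]
              · simp only [List.length_append, List.length_cons, length_mark] at hr ⊢; omega
        refine sup_le le_sup_left ?_
        rintro _ ⟨c, hc, rfl⟩
        change c • x ∈ F
        induction hc using Submodule.span_induction with
        | mem c hc =>
          obtain ⟨s, hs, b, hb, rfl⟩ := hc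
          rcases Nat.lt_succ_iff_lt_or_eq.1 hs with hs' | rfl
          · exact hEq (memE (P.mul_C_mem_cosets hs' hb))
          · rw [mul_smul]
            exact hnew b hb
        | zero => rw [zero_smul]; exact Submodule.zero_mem _
        | add y z _ _ hy hz => rw [add_smul]; exact Submodule.add_mem _ hy hz
        | smul c y _ hy => rw [smul_assoc]; exact Submodule.smul_mem _ _ hy
    obtain ⟨m, hm⟩ := P.mem_cosets_of_mem_alg ha
    refine hE L.length le_rfl (memE ?_)
    refine (Submodule.span_le.2 ?_ : P.cosets p m ≤ _) hm
    rintro _ ⟨s, hs, b, hb, rfl⟩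
    -- A fetch from beyond the last letter involves a crossing out of range and is zero.
    by_cases hs' : s < L.length
    · exact P.mul_C_mem_cosets hs' hb
    · have := hi.2
      rw [List.length_map] at this
      rw [P.C_eq_zero (by omega) (by omega), mul_zero]
      exact Submodule.zero_mem _

end Pres

end KLRW
end

/-! ### Lower bound for the degrees; homogeneous components of vectors. -/

noncomputable section

namespace KLRW

variable {n : ℕ} {v : Fin n → ℕ}

namespace Pres

variable {A : Type*} [Ring A] [Algebra ℂ A] {P : Pres v A} {G : ℤ → Submodule ℂ A}

/-- The span of the homogeneous elements of degree at least `D`. -/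
def geSpan (G : ℤ → Submodule ℂ A) (D : ℤ) : Submodule ℂ A :=
  Submodule.span ℂ {x | ∃ d, D ≤ d ∧ x ∈ G d}

theorem mem_geSpan {D d : ℤ} {x : A} (h : D ≤ d) (hx : x ∈ G d) : x ∈ geSpan G D :=
  Submodule.subset_span ⟨d, h, hx⟩

namespace Grading

theorem mul_mem_geSpan (hG : P.Grading G) {D D' : ℤ} {a b : A} (ha : a ∈ geSpan G D)
    (hb : b ∈ geSpan G D') : a * b ∈ geSpan G (D + D') := by
  induction ha using Submodule.span_induction with
  | mem a ha =>
    obtain ⟨d, hd, ha⟩ := ha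
    induction hb using Submodule.span_induction with
    | mem b hb =>
      obtain ⟨d', hd', hb⟩ := hb
      exact mem_geSpan (add_le_add hd hd') (hG.mul_mem ha hb)
    | zero => rw [mul_zero]; exact zero_mem _
    | add x y _ _ hx hy => rw [mul_add]; exact add_mem hx hy
    | smul c x _ hx => rw [mul_smul_comm]; exact Submodule.smul_mem _ _ hx
  | zero => rw [zero_mul]; exact zero_mem _
  | add x y _ _ hx hy => rw [add_mul]; exact add_mem hx hy
  | smul c x _ hx => rw [smul_mul_assoc]; exact Submodule.smul_mem _ _ hx

theorem one_mem (hG : P.Grading G) : (1 : A) ∈ G 0 := by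
  rw [← P.sum_e]
  exact Submodule.sum_mem _ fun i _ => hG.e_mem i

theorem C_mem_geSpan (hG : P.Grading G) (p m : ℕ) : P.C p m ∈ geSpan G (-2 * size v) := by
  by_cases h : m ≠ 0 ∧ size v ≤ p + m
  · rw [P.C_eq_zero h.1 h.2]; exact zero_mem _
  refine P.mem_of_mul_e fun i => mem_geSpan ?_ (hG.C_mem p m i)
  have : ∀ l : List ℤ, (∀ x ∈ l, -2 ≤ x) → -2 * (l.length : ℤ) ≤ l.sum := by
    intro l hl
    induction l with
    | nil => simp
    | cons a l ih =>
      have h1 := hl a (by simp)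
      have h2 := ih fun x hx => hl x (by simp [hx])
      simp only [List.length_cons, List.sum_cons]; push_cast; linarith
  refine le_trans ?_ (this _ ?_)
  · rw [List.length_map, List.length_range']; omega
  · intro x hx
    obtain ⟨t, _, rfl⟩ := List.mem_map.1 hx
    exact neg_two_le_cdeg _ _

/-- For `p ≥ size v` no crossings are left and all degrees are nonnegative. In each step from `p +
1` to `p`, the coset factorization costs at most `2 * size v`, since a nonzero `C p m` has fewer
than `size v` crossings of degree at least `-2`. -/
theorem alg_bounded (hG : P.Grading G) (p : ℕ) :
    ∃ D, Subalgebra.toSubmodule (P.alg p) ≤ geSpan G D := by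
  obtain ⟨r, hr⟩ : ∃ r, size v - p = r := ⟨_, rfl⟩
  induction r generalizing p with
  | zero =>
    refine ⟨0, fun x hx => ?_⟩
    change x ∈ Algebra.adjoin _ _ at hx
    induction hx using Algebra.adjoin_induction with
    | mem x hx =>
      rcases hx with (⟨i, rfl⟩ | ⟨k, rfl⟩) | ⟨k, hk, rfl⟩
      · exact mem_geSpan le_rfl (hG.e_mem i)
      · exact mem_geSpan (by norm_num) (hG.Y_mem k)
      · rw [P.cr_of_le (by omega)]; exact zero_mem _
    | algebraMap r =>
      rw [Algebra.algebraMap_eq_smul_one]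
      exact Submodule.smul_mem _ _ (mem_geSpan le_rfl hG.one_mem)
    | add a b _ _ ha hb => exact add_mem ha hb
    | mul a b _ _ ha hb => simpa using hG.mul_mem_geSpan ha hb
  | succ r ih =>
    obtain ⟨D, hD⟩ := ih (p + 1) (by omega)
    refine ⟨D + -2 * size v, fun x hx => ?_⟩
    obtain ⟨m, hm⟩ := P.mem_cosets_of_mem_alg hx
    refine (Submodule.span_le.2 ?_ : P.cosets p m ≤ _) hm
    rintro _ ⟨b, _, a, ha, rfl⟩
    exact hG.mul_mem_geSpan (hD ha) (hG.C_mem_geSpan _ _)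

/-- The degrees of the algebra are bounded from below. -/
theorem bounded (hG : P.Grading G) : ∃ D, ∀ d < D, G d = ⊥ := by
  obtain ⟨D, hD⟩ := hG.alg_bounded 0
  rw [hG.alg_zero] at hD
  refine ⟨D, fun d hd => ?_⟩
  -- The components of degree at least `D` already span everything, so by independence nothing is
  -- left for `d < D`.
  have h1 := hG.internal.submodule_iSupIndep d
  rw [← h1.eq_bot_of_le]
  refine le_trans le_top (hD.trans (Submodule.span_le.2 ?_))
  rintro x ⟨d', hd', hx⟩
  exact (le_iSup₂_of_le d' (by omega : d' ≠ d) le_rfl : G d' ≤ _) hx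

end Grading

theorem mem_idem_mul_of_mem {A : Type*} [Ring A] [Algebra ℂ A] {P : Pres v A}
    {G : ℤ → Submodule ℂ A} (hG : P.Grading G) {d : ℤ} {a : A} (ha : a ∈ G d) (i : Words v) :
    P.e i * a ∈ G d := by
  simpa using hG.mul_mem (hG.e_mem i) ha

/-- A grading of a module over a graded algebra. -/
structure Grading.Module (hG : P.Grading G) {M : Type*} [AddCommGroup M] [Module A M] [Module ℂ M]
    (ℳ : ℤ → Submodule ℂ M) : Prop where
  smul_mem {d d' : ℤ} {a : A} {x : M} : a ∈ G d → x ∈ ℳ d' → a • x ∈ ℳ (d + d')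
  internal : DirectSum.IsInternal ℳ

end Pres

section projections

variable {M : Type*} [AddCommGroup M] [Module ℂ M] {ℳ : ℤ → Submodule ℂ M}

/-- The component of degree `d` of a vector. -/
def comp (h : DirectSum.IsInternal ℳ) (d : ℤ) : M →ₗ[ℂ] M :=
  (ℳ d).subtype ∘ₗ DirectSum.component ℂ ℤ (fun d => ℳ d) d ∘ₗ
    (LinearEquiv.ofBijective (DirectSum.coeLinearMap ℳ)
      (show Function.Bijective (DirectSum.coeLinearMap ℳ) from h)).symm.toLinearMap

variable (h : DirectSum.IsInternal ℳ)

theorem comp_mem (d : ℤ) (x : M) : comp h d x ∈ ℳ d := Subtype.coe_prop _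

theorem comp_of_mem {d : ℤ} {x : M} (hx : x ∈ ℳ d) (d' : ℤ) :
    comp h d' x = if d = d' then x else 0 := by
  have : (LinearEquiv.ofBijective (DirectSum.coeLinearMap ℳ)
      (show Function.Bijective (DirectSum.coeLinearMap ℳ) from h)).symm x =
      DirectSum.lof ℂ ℤ (fun d => ℳ d) d ⟨x, hx⟩ :=
    (LinearEquiv.symm_apply_eq _).2 (DirectSum.coeLinearMap_lof ℳ d ⟨x, hx⟩).symm
  simp only [comp, LinearMap.comp_apply, LinearEquiv.coe_coe, this]
  rw [DirectSum.component.of]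
  split_ifs with hd
  · subst hd; rfl
  · rfl

/-- The quantifier over all `t ⊇ s` allows a particular degree to be inserted into the index set
afterwards. -/
theorem exists_sum_comp (x : M) : ∃ s : Finset ℤ, ∀ t, s ⊆ t → x = ∑ d ∈ t, comp h d x := by
  obtain ⟨z, rfl⟩ := h.2 x
  induction z using DirectSum.induction_on with
  | zero => exact ⟨∅, fun t _ => by simp⟩
  | of d x =>
    refine ⟨{d}, fun t ht => ?_⟩
    rw [DirectSum.coeAddMonoidHom_of, Finset.sum_eq_single d]
    · rw [comp_of_mem h x.2, if_pos rfl]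
    · intro d' _ hd; rw [comp_of_mem h x.2, if_neg hd.symm]
    · intro hd; exact absurd (ht (by simp)) hd
  | add a b ha hb =>
    obtain ⟨s, hs⟩ := ha
    obtain ⟨s', hs'⟩ := hb
    refine ⟨s ∪ s', fun t ht => ?_⟩
    simp only [map_add, Finset.sum_add_distrib]
    rw [← hs t (Finset.union_subset_left ht), ← hs' t (Finset.union_subset_right ht)]

theorem eq_zero_of_comp {x : M} (hx : ∀ d, comp h d x = 0) : x = 0 := by
  obtain ⟨s, hs⟩ := exists_sum_comp h x
  rw [hs s subset_rfl]
  exact Finset.sum_eq_zero fun d _ => hx d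

theorem finite_comp (x : M) : {d | comp h d x ≠ 0}.Finite := by
  obtain ⟨s, hs⟩ := exists_sum_comp h x
  refine s.finite_toSet.subset fun d hd => ?_
  by_contra hd'
  have h1 := hs (insert d s) (Finset.subset_insert d s)
  rw [Finset.sum_insert hd', ← hs s subset_rfl] at h1
  exact hd (by simpa using h1)

theorem isInternal_of_comp {π : ℤ → M →ₗ[ℂ] M}
    (h1 : ∀ d, ∀ x ∈ ℳ d, ∀ d', π d' x = if d = d' then x else 0)
    (h2 : ⨆ d, ℳ d = ⊤) : DirectSum.IsInternal ℳ := by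
  constructor
  · have h : ∀ (z : DirectSum ℤ fun d => ℳ d) (d : ℤ),
        π d (DirectSum.coeAddMonoidHom ℳ z) = z d := by
      intro z d
      induction z using DirectSum.induction_on with
      | zero => rw [map_zero, map_zero]; rfl
      | of d' x =>
        rw [DirectSum.coeAddMonoidHom_of, h1 d' x x.2, DirectSum.coe_of_apply]
        split_ifs <;> rfl
      | add a b ha hb => rw [map_add, map_add, ha, hb]; rfl
    intro a b hab
    ext d
    rw [← h a, ← h b, hab]
  · intro x
    have : x ∈ ⨆ d, ℳ d := by rw [h2]; trivial
    induction this using Submodule.iSup_induction' with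
    | mem d x hx => exact ⟨DirectSum.of (fun d => ℳ d) d ⟨x, hx⟩, DirectSum.coeAddMonoidHom_of _ _ _⟩
    | zero => exact ⟨0, map_zero _⟩
    | add x y _ _ hx hy =>
      obtain ⟨a, rfl⟩ := hx
      obtain ⟨b, rfl⟩ := hy
      exact ⟨a + b, map_add _ _ _⟩

end projections

namespace Pres.Grading

variable {A : Type*} [Ring A] [Algebra ℂ A] {P : Pres v A} {G : ℤ → Submodule ℂ A}
  {hG : P.Grading G} {M : Type*} [AddCommGroup M] [_root_.Module A M] [_root_.Module ℂ M]
  {ℳ : ℤ → Submodule ℂ M}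

theorem Module.comp_smul (hM : hG.Module ℳ) {d : ℤ} {a : A} (ha : a ∈ G d) (x : M) (d' : ℤ) :
    comp hM.internal (d + d') (a • x) = a • comp hM.internal d' x := by
  obtain ⟨z, rfl⟩ := hM.internal.2 x
  induction z using DirectSum.induction_on with
  | zero => simp
  | of d1 x =>
    rw [DirectSum.coeAddMonoidHom_of, comp_of_mem hM.internal (hM.smul_mem ha x.2),
      comp_of_mem hM.internal x.2]
    by_cases h : d1 = d'
    · rw [if_pos h, if_pos (by omega)]
    · rw [if_neg h, if_neg (by omega), smul_zero]
  | add x y hx hy => rw [map_add, smul_add, map_add, map_add, hx, hy, smul_add]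

end Pres.Grading

end KLRW
end

/-! ### Combinatorics of segments: the words and degrees of shuffles. -/

noncomputable section

namespace KLRW

/-- The letters `k, k - 1, …` (`m` of them), none of which starts a segment. -/
def run : ℕ → ℕ → List (ℕ × Bool)
  | _, 0 => []
  | k, m + 1 => (k, false) :: run (k - 1) m

/-- The flagged word of a list of segments `(k, k - 1, …, k - s)`, given as pairs `(k, s)`. -/
def flat : List (ℕ × ℕ) → List (ℕ × Bool)
  | [] => []
  | c :: S => (c.1, true) :: (run (c.1 - 1) c.2 ++ flat S)

theorem flat_append (S S' : List (ℕ × ℕ)) : flat (S ++ S') = flat S ++ flat S' := by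
  induction S with
  | nil => rfl
  | cons c S ih => simp [flat, ih]

theorem mark_flat (S : List (ℕ × ℕ)) : mark (flat S) = flat S := by
  cases S <;> rfl

theorem length_run (k m : ℕ) : (run k m).length = m := by
  induction m generalizing k with
  | zero => rfl
  | succ m ih => simp [run, ih]

theorem snd_of_mem_run {k m : ℕ} {a : ℕ × Bool} (h : a ∈ run k m) : a.2 = false := by
  induction m generalizing k with
  | zero => simp [run] at h
  | succ m ih =>
    rcases List.mem_cons.1 h with rfl | h
    · rfl
    · exact ih h

theorem exists_of_mem_flat {S : List (ℕ × ℕ)} {a : ℕ} (h : (a, true) ∈ flat S) :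
    ∃ s, (a, s) ∈ S := by
  induction S with
  | nil => simp [flat] at h
  | cons c S ih =>
    simp only [flat, List.mem_cons, List.mem_append] at h
    rcases h with h | h | h
    · have h' := (Prod.ext_iff.1 h).1
      dsimp only at h'
      subst h'
      exact ⟨c.2, by simp⟩
    · exact absurd (snd_of_mem_run h) (by simp)
    · obtain ⟨s, hs⟩ := ih h
      exact ⟨s, by simp [hs]⟩

/-- Flagged letters are exactly the first letters of segments, so a split at a flagged letter is a
split between segments. -/
theorem flat_eq_append {S : List (ℕ × ℕ)} {L1 : List (ℕ × Bool)} {a : ℕ} {L2 : List (ℕ × Bool)}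
    (h : flat S = L1 ++ (a, true) :: L2) :
    ∃ S1 s S2, S = S1 ++ (a, s) :: S2 ∧ L1 = flat S1 ∧ L2 = run (a - 1) s ++ flat S2 := by
  induction S generalizing L1 with
  | nil => simp [flat] at h
  | cons c S ih =>
    cases L1 with
    | nil =>
      simp only [flat, List.nil_append, List.cons.injEq, Prod.mk.injEq, and_true] at h
      refine ⟨[], c.2, S, by simp [← h.1], rfl, ?_⟩
      rw [← h.2, h.1]
    | cons b L1 =>
      simp only [flat, List.cons_append, List.cons.injEq] at h
      rcases List.append_eq_append_iff.1 h.2 with ⟨K, h1, h2⟩ | ⟨K, h1, h2⟩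
      · obtain ⟨S1, s, S2, h3, h4, h5⟩ := ih h2
        refine ⟨c :: S1, s, S2, by simp [h3], ?_, h5⟩
        rw [h1, h4, ← h.1]; rfl
      · cases K with
        | nil =>
          obtain ⟨S1, s, S2, h3, h4, h5⟩ := ih (L1 := []) (by simpa using h2.symm)
          refine ⟨c :: S1, s, S2, by simp [h3], ?_, h5⟩
          rw [flat, ← h4, ← h.1, h1]; simp
        | cons b' K =>
          simp only [List.cons_append, List.cons.injEq] at h2
          have : (a, true) ∈ run (c.1 - 1) c.2 := by rw [h1]; simp [h2.1]
          exact absurd (snd_of_mem_run this) (by simp)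

/-- The segments `c`, `c'` may occur in this order in the word of a simple module. -/
def SegLE (n : ℕ) (c c' : ℕ × ℕ) : Prop :=
  c.1 < c'.1 ∨ (c.1 = c'.1 ∧ (c.1 = n ∨ c'.2 ≤ c.2))

/-- An increasing list of segments with letters in `[1, n]`. -/
def Lyn (n : ℕ) (S : List (ℕ × ℕ)) : Prop :=
  S.Pairwise (SegLE n) ∧ ∀ c ∈ S, c.2 < c.1 ∧ c.1 ≤ n

/-- The number of pairs of equal black segments. -/
def ell (n : ℕ) : List (ℕ × ℕ) → ℤ
  | [] => 0
  | c :: S => ell n S + (if c.1 = n then 0 else (S.count c : ℤ))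

theorem sum_cdeg_run {k m j : ℕ} (hm : m + 1 ≤ k) :
    ((run k (m + 1)).map fun b => cdeg b.1 (k + 1 + j)).sum = if j = 0 then 1 else 0 := by
  induction m generalizing k j with
  | zero =>
    simp only [run, List.map_cons, List.map_nil, List.sum_cons, List.sum_nil, add_zero]
    split_ifs with h
    · rw [cdeg_adj (by omega)]
    · rw [cdeg, if_neg (by omega), if_neg (by omega)]
  | succ m ih =>
    have := ih (k := k - 1) (j := j + 1) (by omega)
    rw [run, List.map_cons, List.sum_cons, show k + 1 + j = k - 1 + 1 + (j + 1) by omega, this]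
    dsimp only
    rw [if_neg (by omega), add_zero]
    split_ifs with h
    · rw [cdeg_adj (by omega)]
    · rw [cdeg, if_neg (by omega), if_neg (by omega)]

/-- Up to sign `cdeg` is the Cartan form of type A, and a segment is a positive root, which pairs
with itself to `2`. The induction splits off the first letter: it contributes `-2` with itself and
`1` from each side. -/
theorem sum_cdeg_block {k m : ℕ} (hm : m < k) :
    ((run k (m + 1)).map fun a => ((run k (m + 1)).map fun b => cdeg b.1 a.1).sum).sum = -2 := by
  induction m generalizing k with
  | zero => simp [run, cdeg_self]
  | succ m ih =>
    have h1 := ih (k := k - 1) (by omega)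
    have h2 := sum_cdeg_run (k := k - 1) (m := m) (j := 0) (by omega)
    rw [show k - 1 + 1 + 0 = k by omega, if_pos rfl] at h2
    have h3 : ((run (k - 1) (m + 1)).map fun a => cdeg k a.1).sum = 1 := by
      rw [← h2]; congr 1; apply List.map_congr_left; intro a _; exact cdeg_comm _ _
    rw [run]
    simp only [List.map_cons, List.sum_cons, List.sum_map_add]
    rw [h1, h2, h3, cdeg_self]; norm_num

/-- When a whole segment passes `q` equal ones, each of them contributes `-2` by `sum_cdeg_block`.
-/
theorem sum_cdeg_replicate {k s : ℕ} (hs : s < k) (q : ℕ) :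
    ((run (k - 1) s).map fun a =>
        ((flat (List.replicate q (k, s))).map fun b => cdeg b.1 a.1).sum).sum +
      ((flat (List.replicate q (k, s))).map fun b => cdeg b.1 k).sum = -2 * q := by
  have e1 : ∀ g : ℕ → ℤ, ((flat (List.replicate q (k, s))).map fun b => g b.1).sum =
      q * ((run k (s + 1)).map fun b => g b.1).sum := by
    intro g
    induction q with
    | zero => simp [flat]
    | succ q ih =>
      rw [List.replicate_succ, flat, List.map_cons, List.map_append, List.sum_cons,
        List.sum_append, ih, run]
      simp only [List.map_cons, List.sum_cons]
      push_cast; ring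
  have h := sum_cdeg_block hs
  have e2 : ∀ x, ((flat (List.replicate q (k, s))).map fun b => cdeg b.1 x).sum =
      q * ((run k (s + 1)).map fun b => cdeg b.1 x).sum := fun x => e1 fun b => cdeg b x
  simp only [e2]
  rw [List.sum_map_mul_left, ← mul_add]
  have h' : ((run k (s + 1)).map fun a => ((run k (s + 1)).map fun b => cdeg b.1 a.1).sum).sum =
      ((run k (s + 1)).map fun b => cdeg b.1 k).sum +
      ((run (k - 1) s).map fun a => ((run k (s + 1)).map fun b => cdeg b.1 a.1).sum).sum := by
    conv_lhs => rw [run, List.map_cons, List.sum_cons]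
    rfl
  rw [add_comm, ← h', h]; ring

theorem append_lt_append {l a b : List ℕ} (h : a < b) : l ++ a < l ++ b := by
  induction l with
  | nil => exact h
  | cons c l ih => exact List.cons_lt_cons_iff.2 (Or.inr ⟨rfl, ih⟩)

variable {n : ℕ} {v : Fin n → ℕ} {A : Type*} [Ring A] [Algebra ℂ A] {P : Pres v A}

/-- This follows a shuffle after the first letter of a segment has been fetched. The next fetch
takes either the next letter of the opened segment or the first letter of another one, which is
larger and makes the word larger. The comparison is with a run of length `m' ≥ m`, because the
opened segment may be shorter than the one it competes with; in that case a larger letter appears as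
soon as it is exhausted. -/
theorem Pres.Sh.run_aux {Q1 Q2 : List (ℕ × Bool)} {m m' k p : ℕ} {t : A} {w : List ℕ} {d : ℤ}
    (h1 : ∀ a, (a, true) ∈ Q1 → k < a) (h2 : ∀ a, (a, true) ∈ Q2 → k < a)
    (h3 : mark Q2 = Q2) (hm : m ≤ m') (hk : m' ≤ k)
    (h : P.Sh p (Q1 ++ mark (run k m ++ Q2)) t w d) :
    (∀ R, R.length + m' = w.length → (run k m').map Prod.fst ++ R < w) ∨
    (m = m' ∧ ∃ t' w' d', P.Sh (p + m) (Q1 ++ Q2) t' w' d' ∧ w = (run k m).map Prod.fst ++ w' ∧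
      d = d' + ((run k m).map fun a => (Q1.map fun b => cdeg b.1 a.1).sum).sum ∧
      (Q1 = [] → t = t')) := by
  induction m generalizing k m' p t w d with
  | zero =>
    rw [run, List.nil_append, h3] at h
    rcases Nat.eq_zero_or_pos m' with rfl | hm'
    · exact Or.inr ⟨rfl, t, w, d, h, rfl, by simp [run], fun _ => rfl⟩
    · left
      intro R hR
      obtain ⟨m', rfl⟩ := Nat.exists_eq_succ_of_ne_zero hm'.ne'
      generalize hL : Q1 ++ Q2 = L at h
      cases h with
      | nil => simp at hR
      | @cons _ L1 a L2 t w d hr h =>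
        have ha : (a, true) ∈ Q1 ++ Q2 := by rw [hL]; simp
        have : k < a := by
          rcases List.mem_append.1 ha with ha | ha
          · exact h1 a ha
          · exact h2 a ha
        exact List.cons_lt_cons_iff.2 (Or.inl this)
  | succ m ih =>
    obtain ⟨m', rfl⟩ := Nat.exists_eq_succ_of_ne_zero (show m' ≠ 0 by omega)
    generalize hL : Q1 ++ mark (run k (m + 1) ++ Q2) = L at h
    cases h with
    | nil => simp [run, mark] at hL
    | @cons _ L1 a L2 t w d hr h =>
      have key : k < a ∨ (k = a ∧ L1 = Q1 ∧ L2 = run (k - 1) m ++ Q2) := by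
        simp only [run, List.cons_append, mark] at hL
        rcases List.append_eq_append_iff.1 hL with ⟨K, h4, h5⟩ | ⟨K, h4, h5⟩
        · cases K with
          | nil =>
            simp only [List.nil_append, List.cons.injEq, Prod.mk.injEq, and_true] at h5
            exact Or.inr ⟨h5.1, by simpa using h4, h5.2.symm⟩
          | cons b K =>
            simp only [List.cons_append, List.cons.injEq] at h5
            have ha : (a, true) ∈ run (k - 1) m ++ Q2 := by rw [h5.2]; simp
            rcases List.mem_append.1 ha with ha | ha
            · exact absurd (snd_of_mem_run ha) (by simp)
            · exact Or.inl (h2 a ha)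
        · cases K with
          | nil =>
            simp only [List.nil_append, List.cons.injEq, Prod.mk.injEq, and_true] at h5
            exact Or.inr ⟨h5.1.symm, by simpa using h4.symm, h5.2⟩
          | cons b K =>
            simp only [List.cons_append, List.cons.injEq] at h5
            exact Or.inl (h1 a (by rw [h4, h5.1]; simp))
      rcases key with key | ⟨rfl, rfl, rfl⟩
      · left
        intro R _
        exact List.cons_lt_cons_iff.2 (Or.inl key)
      · rcases ih (m' := m') (k := k - 1) (fun a ha => by have := h1 a ha; omega)
          (fun a ha => by have := h2 a ha; omega) (by omega) (by omega) h with h4 | h4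
        · left
          intro R hR
          refine List.cons_lt_cons_iff.2 (Or.inr ⟨rfl, h4 R ?_⟩)
          simp only [List.length_cons] at hR; omega
        · right
          obtain ⟨rfl, t', w', d', h5, h6, h7, h8⟩ := h4
          refine ⟨rfl, t', w', d', ?_, ?_, ?_, ?_⟩
          · rwa [show p + (m + 1) = p + 1 + m by ring]
          · rw [h6]; rfl
          · rw [h7, run, List.map_cons, List.sum_cons]; ring
          · intro h9
            rw [h8 h9, h9]; simp

theorem Lyn.tail {c : ℕ × ℕ} {S : List (ℕ × ℕ)} (h : Lyn n (c :: S)) : Lyn n S :=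
  ⟨(List.pairwise_cons.1 h.1).2, fun c' hc => h.2 c' (by simp [hc])⟩

theorem eq_append_of_cons_eq {α : Type*} {c : α} {S' S1 S2 : List α} (h : c :: S' = S1 ++ c :: S2)
    (h1 : ∀ b ∈ S1, b = c) : S' = S1 ++ S2 := by
  rw [List.eq_replicate_of_mem h1] at h ⊢
  rw [← List.singleton_append (l := S2), ← List.append_assoc, ← List.replicate_succ',
    List.replicate_succ, List.cons_append] at h
  exact (List.cons.inj h).2

/-- The shuffles of an increasing list of segments: apart from permutations of equal black segments
they all lead to lexicographically larger words. -/
theorem Pres.Sh.lyn {S : List (ℕ × ℕ)} (hS : Lyn n S) {p : ℕ} {t : A} {w : List ℕ} {d : ℤ}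
    (h : P.Sh p (flat S) t w d) :
    (flat S).map Prod.fst < w ∨
      (w = (flat S).map Prod.fst ∧ -2 * ell n S ≤ d ∧ d ≤ 0 ∧ (d = 0 → t = 1)) := by
  obtain ⟨r, hr⟩ : ∃ r, S.length = r := ⟨_, rfl⟩
  induction r generalizing S p t w d with
  | zero =>
    obtain rfl := List.length_eq_zero_iff.1 hr
    generalize hL : flat [] = L at h
    cases h with
    | nil => right; simp [ell]
    | cons => simp [flat] at hL
  | succ r ih =>
    cases S with
    | nil => simp at hr
    | cons c S' =>
    obtain ⟨k, s⟩ := c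
    have hlen := h.length
    generalize hL : flat ((k, s) :: S') = L at h
    cases h with
    | nil => simp [flat] at hL
    | @cons _ L1 a L2 t w d hred h =>
      obtain ⟨S1, s', S2, h3, rfl, rfl⟩ := flat_eq_append hL
      have hks := hS.2 (k, s) (by simp)
      have hpw := List.pairwise_cons.1 hS.1
      dsimp only at hks
      have hR : ∀ c ∈ S', k ≤ c.1 := fun c hc => by
        rcases hpw.1 c hc with h | h
        · exact h.le
        · exact h.1.le
      have hka : k ≤ a := by
        cases S1 with
        | nil => simp only [List.nil_append, List.cons.injEq, Prod.mk.injEq] at h3; exact h3.1.1.le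
        | cons c S1 =>
          simp only [List.cons_append, List.cons.injEq] at h3
          exact hR (a, s') (by rw [h3.2]; simp)
      rcases hka.lt_or_eq with hka | rfl
      · left
        rw [← hL, flat]
        exact List.cons_lt_cons_iff.2 (Or.inl hka)
      -- The segments passed over start with the same letter, as the list increases. This letter is
      -- black, because red letters do not overtake each other, so the lengths decrease weakly and
      -- are squeezed between those of the fetched and the first segment.
      have hS1 : ∀ b ∈ S1, b.1 = k ∧ k ≠ n ∧ s' ≤ b.2 ∧ b.2 ≤ s := by
        intro b hb
        have hkn : k ≠ n := by
          rintro rfl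
          refine hred ⟨rfl, ?_⟩
          cases S1 with
          | nil => simp at hb
          | cons c S1 =>
            simp only [List.cons_append, List.cons.injEq] at h3
            rw [← h3.1]; simp [flat]
        have hb1 : SegLE n b (k, s') := by
          have := hS.1
          rw [h3] at this
          exact (List.pairwise_append.1 this).2.2 b hb _ (by simp)
        have hb2 : (k, s) = b ∨ SegLE n (k, s) b := by
          cases S1 with
          | nil => simp at hb
          | cons c S1 =>
            simp only [List.cons_append, List.cons.injEq] at h3
            rcases List.mem_cons.1 hb with hb | hb
            · left; rw [h3.1, hb]
            · right; exact hpw.1 b (by rw [h3.2]; simp [hb])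
        rcases hb2 with rfl | hb2
        · refine ⟨rfl, hkn, ?_, le_rfl⟩
          rcases hb1 with hb1 | ⟨_, hb1 | hb1⟩
          · simp at hb1
          · exact absurd hb1 hkn
          · exact hb1
        · simp only [SegLE] at hb1 hb2
          refine ⟨?_, hkn, ?_, ?_⟩ <;> omega
      have hs' : s' ≤ s := by
        cases S1 with
        | nil =>
          simp only [List.nil_append, List.cons.injEq, Prod.mk.injEq] at h3; exact h3.1.2.ge
        | cons c S1 =>
          have := hS1 c (by simp)
          omega
      have hS2 : ∀ c ∈ S2, k ≤ c.1 := by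
        intro c hc
        cases S1 with
        | nil => simp only [List.nil_append, List.cons.injEq] at h3; exact hR c (by rw [h3.2, ]; exact hc)
        | cons c' S1 =>
          simp only [List.cons_append, List.cons.injEq] at h3
          exact hR c (by rw [h3.2]; simp [hc])
      -- The opened segment has `s' ≤ s` further letters and is compared with the first segment,
      -- which has `s`.
      rcases Pres.Sh.run_aux (m' := s) (fun a ha => by
          obtain ⟨s1, h4⟩ := exists_of_mem_flat ha
          have := (hS1 _ h4).1
          dsimp only at this; omega) (fun a ha => by
          obtain ⟨s1, h4⟩ := exists_of_mem_flat ha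
          have := hS2 _ h4
          dsimp only at this; omega) (mark_flat S2) hs' (by omega) h with h4 | h4
      · left
        rw [← hL, flat]
        refine List.cons_lt_cons_iff.2 (Or.inr ⟨rfl, ?_⟩)
        dsimp only
        rw [List.map_append]
        refine h4 _ ?_
        simp only [flat, List.length_cons, List.length_append, length_run] at hlen
        rw [List.length_map]; omega
      · obtain ⟨rfl, t', w', d', h5, h6, h7, h8⟩ := h4
        -- Equality of words forces `s' = s`, so all segments passed over equal the fetched one, and
        -- each of them costs degree `-2`.
        have hS1' : ∀ b ∈ S1, b = (k, s') := fun b hb => by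
          have := hS1 b hb
          exact Prod.ext this.1 (by dsimp only; omega)
        have hS' := eq_append_of_cons_eq h3 hS1'
        rw [← flat_append, ← hS'] at h5
        have hrep := List.eq_replicate_of_mem hS1'
        have hd : d + ((flat S1).map fun b => cdeg b.1 k).sum = d' + -2 * S1.length := by
          rw [h7, add_assoc, hrep, sum_cdeg_replicate (by omega), List.length_replicate]
        have hcount : (if k = n then 0 else (S'.count (k, s') : ℤ)) ≥ S1.length := by
          split_ifs with hkn
          · cases S1 with
            | nil => simp
            | cons b S1 => exact absurd hkn (hS1 b (by simp)).2.1
          · rw [hS', List.count_append, List.count_eq_length.2 fun b hb => (hS1' b hb).symm]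
            push_cast; omega
        have hflat : (flat ((k, s') :: S')).map Prod.fst =
            k :: ((run (k - 1) s').map Prod.fst ++ (flat S').map Prod.fst) := by
          simp [flat]
        rw [← hL, hflat, h6, hd]
        rcases ih hS.tail h5 (by simpa using hr) with h9 | ⟨h9, h10, h11, h12⟩
        · left
          exact List.cons_lt_cons_iff.2 (Or.inr ⟨rfl, append_lt_append h9⟩)
        · right
          refine ⟨by rw [h9], ?_, by omega, ?_⟩
          · rw [ell]; dsimp only; linarith
          · intro h0
            have : S1 = [] := List.length_eq_zero_iff.1 (by omega)
            subst this
            rw [h8 rfl, h12 (by simp at h0; exact h0)]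
            simp [flat]

end KLRW
end

/-! ### The permutation representation: relations for dots, bigons and triple points. -/

noncomputable section

namespace KLRW

/-! The action of the KLRW algebra on the functions on the permutations of the strands. -/

/-- The coefficient of the transposed argument in the action of a crossing, for strands with labels
`a`, `b` and eigenvalues `z`, `w` of the dots. -/
def transCoeff (n a b : ℕ) (z w : ℂ) : ℂ :=
  if a = b then if a = n then 0 else (w - z)⁻¹ else if a + 1 = b then w - z else 1

/-- The coefficient of the unchanged argument in the action of a crossing. -/
def diagCoeff (n a b : ℕ) (z w : ℂ) : ℂ :=
  if a = b then if a = n then 0 else -(w - z)⁻¹ else 0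

/-- The cases in the definition of `transCoeff` and `diagCoeff`. -/
theorem coeff_cases (n a b : ℕ) (z w : ℂ) :
    ((transCoeff n a b z w = 0 ∧ diagCoeff n a b z w = 0) ∧ a = b ∧ a = n) ∨
    ((transCoeff n a b z w = (w - z)⁻¹ ∧ diagCoeff n a b z w = -(w - z)⁻¹) ∧ a = b ∧ a ≠ n) ∨
    ((transCoeff n a b z w = w - z ∧ diagCoeff n a b z w = 0) ∧ a + 1 = b) ∨
    ((transCoeff n a b z w = 1 ∧ diagCoeff n a b z w = 0) ∧ b + 1 = a) ∨
    ((transCoeff n a b z w = 1 ∧ diagCoeff n a b z w = 0) ∧ a ≠ b ∧ a + 1 ≠ b ∧ b + 1 ≠ a) := by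
  unfold transCoeff diagCoeff
  split_ifs <;> simp <;> omega

/-- The coefficients of `f σ` and of the transposed value in the square of a crossing. At equal
black labels the crossing is a divided difference, whose square is zero; at adjacent labels only one
direction carries the factor `w - z`, so the square has it once. -/
theorem coeff_swap {n a b : ℕ} {z w : ℂ} (h : a = b → z ≠ w) :
    transCoeff n a b z w * transCoeff n b a w z + diagCoeff n a b z w * diagCoeff n a b z w =
      (if a = b then 0 else if a + 1 = b then w - z else if b + 1 = a then z - w else 1) ∧
    transCoeff n a b z w * diagCoeff n b a w z + diagCoeff n a b z w * transCoeff n a b z w = 0 := by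
  unfold transCoeff diagCoeff
  by_cases hab : a = b
  · have h1 := sub_ne_zero.2 (h hab)
    have h2 := sub_ne_zero.2 (h hab).symm
    subst hab
    by_cases hn : a = n
    · simp [hn]
    · simp only [if_neg hn, if_true]
      constructor <;> field_simp <;> ring
  · have hba : b ≠ a := fun h => hab h.symm
    simp only [if_neg hab, if_neg hba]
    split_ifs <;> first | omega | simp

/-- The coefficients of the six rearrangements in the difference of the two sides of a triple
point. -/
theorem coeff_triple {n a b c : ℕ} {x z w : ℂ} (h1 : a = b → x ≠ z) (h2 : b = c → z ≠ w)
    (h3 : a = c → x ≠ w) (f0 f1 f2 f3 f4 f5 : ℂ) :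
    let A := transCoeff n a b x z
    let B := transCoeff n b c z w
    let C := transCoeff n a c x w
    let A' := transCoeff n b a z x
    let B' := transCoeff n c b w z
    let a' := diagCoeff n b a z x
    let b' := diagCoeff n c b w z
    let α := diagCoeff n a b x z
    let β := diagCoeff n b c z w
    let γ := diagCoeff n a c x w
    A * (C * (B * f5 + β * f3) + γ * (A' * f0 + a' * f1)) + α * (B * (C * f4 + γ * f2) + β * (A * f1 + α * f0))
      - (B * (C * (A * f5 + α * f4) + γ * (B' * f0 + b' * f2)) +
        β * (A * (C * f3 + γ * f1) + α * (B * f2 + β * f0))) =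
      if a = c ∧ a ≠ n ∧ b + 1 = a then f0 else if a = c ∧ a + 1 = b ∧ a ≠ n then -f0 else 0 := by
  have g1 : a = b → z - x ≠ 0 ∧ x - z ≠ 0 := fun h => ⟨sub_ne_zero.2 (h1 h).symm, sub_ne_zero.2 (h1 h)⟩
  have g2 : b = c → w - z ≠ 0 ∧ z - w ≠ 0 := fun h => ⟨sub_ne_zero.2 (h2 h).symm, sub_ne_zero.2 (h2 h)⟩
  have g3 : a = c → w - x ≠ 0 := fun h => sub_ne_zero.2 (h3 h).symm
  intro A B C A' B' a' b' α β γ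
  -- The relative positions of the three labels determine all coefficients; each consistent case is
  -- an identity of rational functions.
  rcases coeff_cases n a b x z with p | p | p | p | p <;>
  rcases coeff_cases n b c z w with q | q | q | q | q <;>
  first
  | (exfalso; omega)
  | rcases coeff_cases n a c x w with r | r | r | r | r <;>
    first
    | (exfalso; omega)
    | rcases coeff_cases n b a z x with p' | p' | p' | p' | p' <;>
      first
      | (exfalso; omega)
      | rcases coeff_cases n c b w z with q' | q' | q' | q' | q' <;>
        first
        | (exfalso; omega)
        | (simp only [A, B, C, A', B', a', b', α, β, γ, p.1, q.1, r.1, p'.1, q'.1]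
           split_ifs <;>
           first
           | (exfalso; omega)
           | ring1
           | (have := (g1 (by omega)).1
              have := (g1 (by omega)).2
              have := (g2 (by omega)).1
              have := (g2 (by omega)).2
              have := g3 (by omega)
              field_simp
              ring1)
           | (have := g3 (by omega)
              field_simp
              ring1))

variable {n : ℕ} {v : Fin n → ℕ}

/-- The word with its letters permuted. -/
def Words.perm (i : Words v) (σ : Equiv.Perm (Fin (size v))) : Words v :=
  ⟨fun m => i.1 (σ m), fun a => by
    rw [← i.2 a]
    refine Finset.card_bij (fun m _ => σ m) ?_ ?_ ?_
    · intro m hm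
      simpa using hm
    · intro m _ m' _ h
      exact σ.injective h
    · intro m hm
      exact ⟨σ⁻¹ m, by simpa using hm, by simp⟩⟩

/-- The transposition of `k` and `k + 1`, if these exist. -/
def adjSwap (V k : ℕ) : Equiv.Perm (Fin V) :=
  if h : k + 1 < V then Equiv.swap ⟨k, by omega⟩ ⟨k + 1, h⟩ else 1

/-- The strand at position `k`. -/
def strand {V : ℕ} (σ : Equiv.Perm (Fin V)) (k : ℕ) : ℕ := if h : k < V then σ ⟨k, h⟩ else k

theorem strand_mul_adjSwap {V k : ℕ} (h : k + 1 < V) (σ : Equiv.Perm (Fin V)) (m : ℕ) :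
    strand (σ * adjSwap V k) m = strand σ (Equiv.swap k (k + 1) m) := by
  unfold adjSwap
  rw [dif_pos h]
  by_cases h1 : m = k
  · subst h1
    rw [Equiv.swap_apply_left, strand, strand, dif_pos (by omega), dif_pos h, Equiv.Perm.mul_apply,
      Equiv.swap_apply_left]
  · by_cases h2 : m = k + 1
    · subst h2
      rw [Equiv.swap_apply_right, strand, strand, dif_pos h, dif_pos (by omega),
        Equiv.Perm.mul_apply, Equiv.swap_apply_right]
    · rw [Equiv.swap_apply_of_ne_of_ne h1 h2, strand, strand]
      split_ifs with hm
      · rw [Equiv.Perm.mul_apply, Equiv.swap_apply_of_ne_of_ne] <;> simpa [Fin.ext_iff]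
      · rfl

theorem strand_lt {V k : ℕ} (σ : Equiv.Perm (Fin V)) (h : k < V) : strand σ k < V := by
  rw [strand, dif_pos h]; exact Fin.is_lt _

theorem strand_inj {V k l : ℕ} (σ : Equiv.Perm (Fin V)) (h : k < V) (h' : l < V)
    (hkl : strand σ k = strand σ l) : k = l := by
  rw [strand, strand, dif_pos h, dif_pos h'] at hkl
  simpa using σ.injective (Fin.ext hkl)

theorem Words.lab_perm (i : Words v) (σ : Equiv.Perm (Fin (size v))) (k : ℕ) :
    (i.perm σ).lab k = i.lab (strand σ k) := by
  by_cases h : k < size v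
  · rw [lab_of_lt _ h, lab_of_lt _ (strand_lt σ h)]
    simp [perm, strand, h]
  · simp [lab, h, strand]

theorem Words.perm_mul_adjSwap (i : Words v) (σ : Equiv.Perm (Fin (size v))) (k : ℕ) :
    i.perm (σ * adjSwap (size v) k) = (i.perm σ).sw k := by
  apply lab_ext
  intro m _
  by_cases h : k + 1 < size v
  · rw [lab_perm, strand_mul_adjSwap h, lab_sw _ h, lab_perm]
  · rw [sw, dif_neg (by omega), adjSwap, dif_neg h, mul_one]

theorem adjSwap_mul_self (V k : ℕ) : adjSwap V k * adjSwap V k = 1 := by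
  unfold adjSwap; split_ifs <;> simp

theorem adjSwap_comm {V k l : ℕ} (h : k + 1 < l) :
    adjSwap V k * adjSwap V l = adjSwap V l * adjSwap V k := by
  unfold adjSwap
  split_ifs <;> try simp
  refine (Equiv.Perm.Disjoint.commute ?_).eq
  rw [Equiv.Perm.disjoint_iff_disjoint_support, Equiv.Perm.support_swap (by simp),
    Equiv.Perm.support_swap (by simp)]
  simp [Fin.ext_iff]
  omega

theorem swap_braid {α : Type*} [DecidableEq α] {a b c : α} (h1 : a ≠ b) (h2 : b ≠ c)
    (h3 : a ≠ c) : Equiv.swap a b * Equiv.swap b c * Equiv.swap a b =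
      Equiv.swap b c * Equiv.swap a b * Equiv.swap b c := by
  rw [Equiv.swap_mul_swap_mul_swap h1 h3, Equiv.swap_comm a b, Equiv.swap_comm b c,
    Equiv.swap_mul_swap_mul_swap h2.symm h3.symm, Equiv.swap_comm]

theorem adjSwap_braid {V k : ℕ} (h : k + 2 < V) :
    adjSwap V k * adjSwap V (k + 1) * adjSwap V k =
      adjSwap V (k + 1) * adjSwap V k * adjSwap V (k + 1) := by
  rw [adjSwap, adjSwap, dif_pos (by omega), dif_pos (by omega)]
  have h1 : (⟨k, by omega⟩ : Fin V) ≠ ⟨k + 1, by omega⟩ := by simp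
  have h2 : (⟨k + 1, by omega⟩ : Fin V) ≠ ⟨k + 1 + 1, by omega⟩ := by simp
  have h3 : (⟨k, by omega⟩ : Fin V) ≠ ⟨k + 1 + 1, by omega⟩ := by simp; omega
  exact swap_braid h1 h2 h3

/-- The eigenvalue of a dot on the strand that starts at position `a`. -/
def dotValue (i : Words v) (a : ℕ) : ℂ := a + i.lab a

/-- The position enters the eigenvalue for this reason: the denominators of the divided differences
must not vanish. -/
theorem dotValue_ne {i : Words v} {a b : ℕ} (h : i.lab a = i.lab b) (hab : a ≠ b) :
    dotValue i a ≠ dotValue i b := by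
  unfold dotValue
  rw [h]
  simpa using hab

variable (i : Words v)

/-- The functions on the permutations of the strands. -/
abbrev PermFun (v : Fin n → ℕ) : Type := Equiv.Perm (Fin (size v)) → ℂ

/-- The action of an idempotent. -/
def permIdem (j : Words v) : Module.End ℂ (PermFun v) where
  toFun f σ := if i.perm σ = j then f σ else 0
  map_add' f g := by funext σ; by_cases h : i.perm σ = j <;> simp [h]
  map_smul' c f := by funext σ; by_cases h : i.perm σ = j <;> simp [h]

/-- The action of a dot. -/
def permDot (k : ℕ) : Module.End ℂ (PermFun v) where
  toFun f σ := if k < size v then dotValue i (strand σ k) * f σ else 0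
  map_add' f g := by funext σ; by_cases h : k < size v <;> simp [h, mul_add]
  map_smul' c f := by funext σ; by_cases h : k < size v <;> simp [h]; ring

/-- `transCoeff` at the strands `a`, `b`. -/
def tc (a b : ℕ) : ℂ := transCoeff n (i.lab a) (i.lab b) (dotValue i a) (dotValue i b)

/-- `diagCoeff` at the strands `a`, `b`. -/
def dc (a b : ℕ) : ℂ := diagCoeff n (i.lab a) (i.lab b) (dotValue i a) (dotValue i b)

/-- The action of a crossing. -/
def permCross (k : ℕ) : Module.End ℂ (PermFun v) where
  toFun f σ := if k + 1 < size v then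
    tc i (strand σ k) (strand σ (k + 1)) * f (σ * adjSwap (size v) k) +
      dc i (strand σ k) (strand σ (k + 1)) * f σ else 0
  map_add' f g := by funext σ; by_cases h : k + 1 < size v <;> simp [h]; ring
  map_smul' c f := by funext σ; by_cases h : k + 1 < size v <;> simp [h]; ring

variable {i}

theorem permIdem_apply (j : Words v) (f : PermFun v) (σ) :
    permIdem i j f σ = if i.perm σ = j then f σ else 0 := rfl

theorem permDot_apply (k : ℕ) (f : PermFun v) (σ) :
    permDot i k f σ = if k < size v then dotValue i (strand σ k) * f σ else 0 := rfl

theorem permCross_apply {k : ℕ} (h : k + 1 < size v) (f : PermFun v) (σ) :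
    permCross i k f σ = tc i (strand σ k) (strand σ (k + 1)) * f (σ * adjSwap (size v) k) +
      dc i (strand σ k) (strand σ (k + 1)) * f σ := if_pos h

theorem permCross_of_le {k : ℕ} (h : size v ≤ k + 1) : permCross i k = 0 := by
  exact LinearMap.ext fun f => funext fun σ => if_neg (by omega)

theorem dc_of_ne {a b : ℕ} (h : i.lab a ≠ i.lab b) : dc i a b = 0 := if_neg h

theorem permDot_idem (k : ℕ) (j : Words v) :
    permDot i k * permIdem i j = permIdem i j * permDot i k := by
  refine LinearMap.ext fun f => funext fun σ => ?_
  simp only [Module.End.mul_apply, permDot_apply, permIdem_apply]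
  split_ifs <;> simp

theorem Words.sw_eq_self {j : Words v} {k : ℕ} (h : j.lab k = j.lab (k + 1)) : j.sw k = j := by
  apply lab_ext
  intro m _
  by_cases hk : k + 1 < size v
  · rw [lab_sw _ hk]
    by_cases h1 : m = k
    · rw [h1, Equiv.swap_apply_left, h]
    · by_cases h2 : m = k + 1
      · rw [h2, Equiv.swap_apply_right, h]
      · rw [Equiv.swap_apply_of_ne_of_ne h1 h2]
  · rw [sw, dif_neg (by omega)]

/-- The unchanged argument has a nonzero coefficient only at equal labels, where the exchange fixes
the word. -/
theorem permCross_idem (k : ℕ) (j : Words v) :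
    permCross i k * permIdem i j = permIdem i (j.sw k) * permCross i k := by
  by_cases hk : k + 1 < size v
  swap
  · rw [permCross_of_le (by omega), zero_mul, mul_zero]
  refine LinearMap.ext fun f => funext fun σ => ?_
  simp only [Module.End.mul_apply, permCross_apply hk, permIdem_apply, Words.perm_mul_adjSwap]
  have h1 : (i.perm σ).sw k = j ↔ i.perm σ = j.sw k :=
    ⟨fun h => by rw [← h, Words.sw_sw], fun h => by rw [h, Words.sw_sw]⟩
  by_cases hl : i.lab (strand σ k) = i.lab (strand σ (k + 1))
  · have h2 : (i.perm σ).sw k = i.perm σ :=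
      Words.sw_eq_self (by rw [Words.lab_perm, Words.lab_perm, hl])
    rw [h2] at h1 ⊢
    by_cases h3 : i.perm σ = j
    · simp [h3, h1.1 h3 ▸ h3]
    · have h4 : i.perm σ ≠ j.sw k := fun h => h3 (h1.2 h)
      simp [h3, h4]
  · rw [dc_of_ne hl]
    by_cases h3 : i.perm σ = j.sw k
    · rw [if_pos (h1.2 h3), if_pos h3]; simp
    · have h4 : (i.perm σ).sw k ≠ j := fun h => h3 (h1.1 h)
      simp [h3, h4]

/-- An identity between endomorphisms can be checked on functions and permutations of the right
weight. -/
theorem perm_ext {X Z : Module.End ℂ (PermFun v)} {j j' : Words v}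
    (hX : X * permIdem i j = permIdem i j' * X) (hZ : Z * permIdem i j = permIdem i j' * Z)
    (h : ∀ f σ, i.perm σ = j' → X f σ = Z f σ) : X * permIdem i j = Z * permIdem i j := by
  rw [hX, hZ]
  refine LinearMap.ext fun f => funext fun σ => ?_
  simp only [Module.End.mul_apply, permIdem_apply]
  split_ifs with hσ
  · exact h f σ hσ
  · rfl

theorem lab_strand {σ : Equiv.Perm (Fin (size v))} {j : Words v} (h : i.perm σ = j) (k : ℕ) :
    i.lab (strand σ k) = j.lab k := by rw [← h, Words.lab_perm]

theorem dotValue_strand_ne {σ : Equiv.Perm (Fin (size v))} {k l : ℕ} (hkl : k ≠ l)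
    (hk : k < size v) (hl : l < size v) (h : i.lab (strand σ k) = i.lab (strand σ l)) :
    dotValue i (strand σ k) ≠ dotValue i (strand σ l) :=
  dotValue_ne h fun h => hkl (strand_inj σ hk hl h)

theorem strand_adjSwap_left {V k : ℕ} (h : k + 1 < V) (σ : Equiv.Perm (Fin V)) :
    strand (σ * adjSwap V k) k = strand σ (k + 1) := by
  rw [strand_mul_adjSwap h, Equiv.swap_apply_left]

theorem strand_adjSwap_right {V k : ℕ} (h : k + 1 < V) (σ : Equiv.Perm (Fin V)) :
    strand (σ * adjSwap V k) (k + 1) = strand σ k := by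
  rw [strand_mul_adjSwap h, Equiv.swap_apply_right]

theorem strand_adjSwap_of_ne {V k m : ℕ} (h1 : m ≠ k) (h2 : m ≠ k + 1)
    (σ : Equiv.Perm (Fin V)) : strand (σ * adjSwap V k) m = strand σ m := by
  by_cases h : k + 1 < V
  · rw [strand_mul_adjSwap h, Equiv.swap_apply_of_ne_of_ne h1 h2]
  · rw [adjSwap, dif_neg h, mul_one]

theorem permCross_sq {k : ℕ} (hk : k + 1 < size v) (f : PermFun v) (σ) :
    permCross i k (permCross i k f) σ =
      (if i.lab (strand σ k) = i.lab (strand σ (k + 1)) then 0 else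
        if i.lab (strand σ k) + 1 = i.lab (strand σ (k + 1)) then
          dotValue i (strand σ (k + 1)) - dotValue i (strand σ k) else
        if i.lab (strand σ (k + 1)) + 1 = i.lab (strand σ k) then
          dotValue i (strand σ k) - dotValue i (strand σ (k + 1)) else 1) * f σ := by
  obtain ⟨h1, h2⟩ := coeff_swap (n := n) (dotValue_strand_ne (i := i) (σ := σ) (k := k)
    (l := k + 1) (by omega) (by omega) hk)
  rw [← h1]
  simp only [permCross_apply hk, strand_adjSwap_left hk, strand_adjSwap_right hk, mul_assoc,
    adjSwap_mul_self, mul_one]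
  simp only [tc, dc] at h2 ⊢
  linear_combination (f (σ * adjSwap (size v) k)) * h2

/-- Both dot relations at once. The eigenvalue travels with the strand, so the terms with transposed
argument cancel. What is left is `dc` times the difference of the two eigenvalues, which is `eps` up
to a sign depending on the end of the crossing. -/
theorem permDot_sub_permCross {k : ℕ} (j : Words v) (l l' : ℕ) (hl : l = k ∧ l' = k + 1 ∨
      l = k + 1 ∧ l' = k) :
    (permDot i l * permCross i k - permCross i k * permDot i l') * permIdem i j =
      ((if l = k then 1 else -1) * eps j k) • permIdem i j := by
  by_cases hk : k + 1 < size v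
  swap
  · rw [permCross_of_le (by omega), zero_mul, mul_zero, sub_zero, zero_mul, eps,
      if_neg (fun h => hk h.1 : ¬ (k + 1 < size v ∧ _)), mul_zero, zero_smul]
  have h : ((if l = k then 1 else -1) * eps j k) • permIdem i j =
      (((if l = k then 1 else -1) * eps j k) • (1 : Module.End ℂ (PermFun v))) * permIdem i j := by
    rw [smul_mul_assoc, one_mul]
  rw [h]
  refine perm_ext (j' := j.sw k) ?_ ?_ ?_
  · rw [sub_mul, mul_sub, mul_assoc, mul_assoc, permDot_idem, permCross_idem, ← mul_assoc,
      ← mul_assoc, permDot_idem, permCross_idem, mul_assoc, mul_assoc]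
  · rw [smul_mul_assoc, one_mul, mul_smul_comm, mul_one, eps]
    by_cases h1 : k + 1 < size v ∧ j.lab k = j.lab (k + 1) ∧ j.lab k ≠ n
    · rw [Words.sw_eq_self h1.2.1]
    · rw [if_neg h1, mul_zero, zero_smul, zero_smul]
  · intro f σ hσ
    have h1 := lab_strand hσ k
    have h2 := lab_strand hσ (k + 1)
    rw [Words.lab_sw_left _ hk] at h1
    rw [Words.lab_sw_right _ hk] at h2
    have h3 := dotValue_strand_ne (i := i) (σ := σ) (k := k) (l := k + 1) (by omega) (by omega) hk
    have hk' : k < size v := by omega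
    have h4 : tc i (strand σ k) (strand σ (k + 1)) = tc i (strand σ k) (strand σ (k + 1)) := rfl
    have h5 : dc i (strand σ k) (strand σ (k + 1)) * (dotValue i (strand σ (k + 1)) -
        dotValue i (strand σ k)) = - eps j k := by
      unfold dc diagCoeff eps
      rw [h1, h2] at h3 ⊢
      by_cases h6 : j.lab (k + 1) = j.lab k
      · have := sub_ne_zero.2 (h3 h6).symm
        rw [if_pos h6, h6]
        by_cases h7 : j.lab k = n
        · simp [h7]
        · simp [hk, h7, this]
      · rw [if_neg h6, if_neg (fun h => h6 h.2.1.symm)]; simp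
    simp only [LinearMap.sub_apply, Module.End.mul_apply, Pi.sub_apply, LinearMap.smul_apply,
      Module.End.one_apply, Pi.smul_apply, smul_eq_mul]
    rcases hl with ⟨rfl, rfl⟩ | ⟨rfl, rfl⟩
    · simp only [permDot_apply, permCross_apply hk, if_pos hk, if_pos hk', strand_adjSwap_right hk,
        if_true]
      linear_combination (- f σ) * h5
    · simp only [permDot_apply, permCross_apply hk, if_pos hk, if_pos hk', strand_adjSwap_left hk,
        if_neg (Nat.succ_ne_self _)]
      linear_combination (f σ) * h5

theorem Words.sw_braid (j : Words v) {k : ℕ} (h : k + 2 < size v) :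
    ((j.sw k).sw (k + 1)).sw k = ((j.sw (k + 1)).sw k).sw (k + 1) := by
  have h1 : k + 1 < size v := by omega
  apply lab_ext
  intro m _
  simp only [lab_sw _ h1, lab_sw _ h]
  congr 1
  have := swap_braid (a := k) (b := k + 1) (c := k + 1 + 1) (by omega) (by omega) (by omega)
  exact DFunLike.congr_fun this m

theorem permCross_triple {k : ℕ} (hk : k + 2 < size v) (j : Words v) :
    (permCross i k * permCross i (k + 1) * permCross i k -
      permCross i (k + 1) * permCross i k * permCross i (k + 1)) * permIdem i j =
      (if j.lab k = j.lab (k + 2) ∧ j.lab k ≠ n ∧ j.lab (k + 1) + 1 = j.lab k then (1 : ℂ) else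
        if j.lab k = j.lab (k + 2) ∧ j.lab k + 1 = j.lab (k + 1) ∧ j.lab k ≠ n then -1 else 0) •
        permIdem i j := by
  set c : ℂ := if j.lab k = j.lab (k + 2) ∧ j.lab k ≠ n ∧ j.lab (k + 1) + 1 = j.lab k then (1 : ℂ)
    else if j.lab k = j.lab (k + 2) ∧ j.lab k + 1 = j.lab (k + 1) ∧ j.lab k ≠ n then -1 else 0
    with hc
  have hk1 : k + 1 < size v := by omega
  have h : c • permIdem i j = (c • (1 : Module.End ℂ (PermFun v))) * permIdem i j := by
    rw [smul_mul_assoc, one_mul]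
  have hl : (((j.sw k).sw (k + 1)).sw k).lab k = j.lab (k + 2) ∧
      (((j.sw k).sw (k + 1)).sw k).lab (k + 1) = j.lab (k + 1) ∧
      (((j.sw k).sw (k + 1)).sw k).lab (k + 2) = j.lab k := by
    refine ⟨?_, ?_, ?_⟩
    · rw [Words.lab_sw_left _ hk1, Words.lab_sw_left _ hk, Words.lab_sw_of_ne _ (by omega) (by omega)]
    · rw [Words.lab_sw_right _ hk1, Words.lab_sw_of_ne _ (by omega) (by omega),
        Words.lab_sw_left _ hk1]
    · rw [Words.lab_sw_of_ne _ (by omega) (by omega), Words.lab_sw_right _ hk,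
        Words.lab_sw_right _ hk1]
  rw [h]
  refine perm_ext (j' := ((j.sw k).sw (k + 1)).sw k) ?_ ?_ ?_
  · have h3 : ∀ a b c, permCross i a * permCross i b * permCross i c * permIdem i j =
        permIdem i (((j.sw c).sw b).sw a) * (permCross i a * permCross i b * permCross i c) := by
      intro a b c
      rw [mul_assoc _ _ (permIdem i j), permCross_idem, ← mul_assoc, mul_assoc (permCross i a),
        permCross_idem, ← mul_assoc, permCross_idem]
      simp only [mul_assoc]
    rw [sub_mul, mul_sub, h3, h3, Words.sw_braid j hk]
  · rw [smul_mul_assoc, one_mul, mul_smul_comm, mul_one]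
    by_cases h1 : j.lab k = j.lab (k + 2)
    · have : ((j.sw k).sw (k + 1)).sw k = j := by
        apply Words.lab_ext
        intro m _
        by_cases e0 : m = k
        · rw [e0, hl.1, h1]
        · by_cases e1 : m = k + 1
          · rw [e1, hl.2.1]
          · by_cases e2 : m = k + 2
            · rw [e2, hl.2.2, h1]
            · rw [Words.lab_sw_of_ne _ e0 e1, Words.lab_sw_of_ne _ e1 e2,
                Words.lab_sw_of_ne _ e0 e1]
      rw [this]
    · rw [hc, if_neg (fun h => h1 h.1), if_neg (fun h => h1 h.1), zero_smul, zero_smul]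
  · intro f σ hσ
    have h0 := lab_strand hσ k
    have h1 := lab_strand hσ (k + 1)
    have h2 := lab_strand hσ (k + 2)
    rw [hl.1] at h0
    rw [hl.2.1] at h1
    rw [hl.2.2] at h2
    have e0 := dotValue_strand_ne (i := i) (σ := σ) (k := k) (l := k + 1) (by omega) (by omega) hk1
    have e1 := dotValue_strand_ne (i := i) (σ := σ) (k := k + 1) (l := k + 2) (by omega) hk1 hk
    have e2 := dotValue_strand_ne (i := i) (σ := σ) (k := k) (l := k + 2) (by omega) (by omega) hk
    -- Both sides of a triple point are combinations of the values of `f` at the six permutations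
    -- obtained from `σ` by the two transpositions acting from the right.
    have main := coeff_triple (n := n) e0 e1 e2 (f σ) (f (σ * adjSwap (size v) k))
      (f (σ * adjSwap (size v) (k + 1))) (f (σ * adjSwap (size v) k * adjSwap (size v) (k + 1)))
      (f (σ * adjSwap (size v) (k + 1) * adjSwap (size v) k))
      (f (σ * adjSwap (size v) k * adjSwap (size v) (k + 1) * adjSwap (size v) k))
    simp only [h0, h1, h2] at main
    have s1 := strand_adjSwap_left hk1
    have s2 := strand_adjSwap_right hk1
    have s3 := strand_adjSwap_left hk
    have s4 := strand_adjSwap_right hk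
    have s5 := strand_adjSwap_of_ne (V := size v) (k := k) (m := k + 2) (by omega) (by omega)
    have s6 := strand_adjSwap_of_ne (V := size v) (k := k + 1) (m := k) (by omega) (by omega)
    have hb : σ * adjSwap (size v) (k + 1) * adjSwap (size v) k * adjSwap (size v) (k + 1) =
        σ * adjSwap (size v) k * adjSwap (size v) (k + 1) * adjSwap (size v) k := by
      have := congrArg (σ * ·) (adjSwap_braid hk)
      simpa only [mul_assoc] using this.symm
    have hq : ∀ τ : Equiv.Perm (Fin (size v)), ∀ k, τ * adjSwap (size v) k * adjSwap (size v) k = τ :=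
      fun τ k => by rw [mul_assoc, adjSwap_mul_self, mul_one]
    simp only [LinearMap.sub_apply, Module.End.mul_apply, Pi.sub_apply, LinearMap.smul_apply,
      Module.End.one_apply, Pi.smul_apply, smul_eq_mul, permCross_apply hk1, permCross_apply hk,
      s1, s2, s3, s4, s5, s6, hq, hb, show k + 1 + 1 = k + 2 from rfl, tc, dc, h0, h1, h2]
    refine Eq.trans ?_ (main.trans ?_)
    · ring
    · rw [hc]
      split_ifs <;> first | (exfalso; omega) | ring

end KLRW
end

/-! ### The permutation representation and its distinguished vector. -/

noncomputable section

namespace KLRW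

variable {n : ℕ} {v : Fin n → ℕ} (i : Words v)

theorem permDot_cross_far {k l : ℕ} (h1 : l ≠ k) (h2 : l ≠ k + 1) :
    permDot i l * permCross i k = permCross i k * permDot i l := by
  by_cases hk : k + 1 < size v
  swap
  · rw [permCross_of_le (by omega), zero_mul, mul_zero]
  refine LinearMap.ext fun f => funext fun σ => ?_
  simp only [Module.End.mul_apply, permDot_apply, permCross_apply hk,
    strand_adjSwap_of_ne h1 h2]
  split_ifs
  · ring
  · simp

theorem permCross_comm {k l : ℕ} (h : k + 1 < l) :
    permCross i k * permCross i l = permCross i l * permCross i k := by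
  by_cases hl : l + 1 < size v
  swap
  · rw [permCross_of_le (k := l) (by omega), zero_mul, mul_zero]
  have hk : k + 1 < size v := by omega
  have hc : ∀ σ : Equiv.Perm (Fin (size v)), σ * adjSwap (size v) k * adjSwap (size v) l =
      σ * adjSwap (size v) l * adjSwap (size v) k := fun σ => by
    rw [mul_assoc, adjSwap_comm h, mul_assoc]
  refine LinearMap.ext fun f => funext fun σ => ?_
  simp only [Module.End.mul_apply, permCross_apply hk, permCross_apply hl, hc,
    strand_adjSwap_of_ne (k := k) (m := l) (by omega) (by omega),
    strand_adjSwap_of_ne (k := k) (m := l + 1) (by omega) (by omega),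
    strand_adjSwap_of_ne (k := l) (m := k) (by omega) (by omega),
    strand_adjSwap_of_ne (k := l) (m := k + 1) (by omega) (by omega)]
  ring

theorem permCross_red {k : ℕ} {j : Words v} (h1 : j.lab k = n) (h2 : j.lab (k + 1) = n) :
    permCross i k * permIdem i j = 0 := by
  by_cases hk : k + 1 < size v
  swap
  · rw [permCross_of_le (by omega), zero_mul]
  rw [permCross_idem, Words.sw_eq_self (by rw [h1, h2])]
  refine LinearMap.ext fun f => funext fun σ => ?_
  simp only [Module.End.mul_apply, permCross_apply hk, permIdem_apply]
  split_ifs with hσ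
  · have h3 := lab_strand hσ k
    have h4 := lab_strand hσ (k + 1)
    simp [tc, dc, transCoeff, diagCoeff, h3, h4, h1, h2]
  · rfl

theorem permCross_sq_idem {k : ℕ} (hk : k + 1 < size v) (j : Words v) :
    permCross i k * permCross i k * permIdem i j =
      (if j.lab k = j.lab (k + 1) then 0 else
        if j.lab k + 1 = j.lab (k + 1) then permDot i (k + 1) - permDot i k else
        if j.lab (k + 1) + 1 = j.lab k then permDot i k - permDot i (k + 1) else 1) *
        permIdem i j := by
  refine perm_ext (j' := j) ?_ ?_ ?_
  · rw [mul_assoc, permCross_idem, ← mul_assoc, permCross_idem, Words.sw_sw, mul_assoc]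
  · split_ifs <;> simp only [sub_mul, mul_sub, permDot_idem, zero_mul, mul_zero, one_mul, mul_one]
  · intro f σ hσ
    rw [Module.End.mul_apply, permCross_sq hk, lab_strand hσ, lab_strand hσ]
    have hk' : k < size v := by omega
    split_ifs <;> simp [permDot_apply, hk, hk', sub_mul]

theorem permEnd_neg_smul (c : ℂ) (x : Module.End ℂ (PermFun v)) : (-c) • x = -(c • x) :=
  neg_smul c x

/-- The KLRW algebra acts on the functions on the permutations of the strands. -/
def permPres : Pres v (Module.End ℂ (PermFun v)) where
  e := permIdem i
  Y := permDot i
  cr := permCross i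
  e_mul_self j := by
    refine LinearMap.ext fun f => funext fun σ => ?_
    simp only [Module.End.mul_apply, permIdem_apply]
    split_ifs <;> rfl
  e_mul_ne {j j'} h := by
    refine LinearMap.ext fun f => funext fun σ => ?_
    simp only [Module.End.mul_apply, permIdem_apply, LinearMap.zero_apply, Pi.zero_apply]
    split_ifs with h1 h2
    · exact absurd (h1.symm.trans h2) h
    all_goals rfl
  sum_e := by
    refine LinearMap.ext fun f => funext fun σ => ?_
    simp [LinearMap.sum_apply, Finset.sum_apply, permIdem_apply]
  Y_mul_e k j := permDot_idem k j
  cr_mul_e k j := permCross_idem k j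
  cr_of_le h := permCross_of_le h
  Y_of_le {k} h := LinearMap.ext fun f => funext fun σ => if_neg (by omega)
  cr_mul_e_red h1 h2 := permCross_red i h1 h2
  Y_mul_Y k l := by
    refine LinearMap.ext fun f => funext fun σ => ?_
    simp only [Module.End.mul_apply, permDot_apply]
    split_ifs
    · ring
    all_goals simp
  Y_mul_cr_far h1 h2 := permDot_cross_far i h1 h2
  cr_mul_cr_far h := permCross_comm i h
  Y_mul_cr_left k j := by
    have := permDot_sub_permCross (i := i) j k (k + 1) (Or.inl ⟨rfl, rfl⟩)
    rw [if_pos rfl, one_mul, sub_mul] at this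
    rw [← this]; abel
  cr_mul_Y_left k j := by
    have := permDot_sub_permCross (i := i) j (k + 1) k (Or.inr ⟨rfl, rfl⟩)
    rw [if_neg (Nat.succ_ne_self k), neg_one_mul, permEnd_neg_smul, sub_mul, sub_eq_iff_eq_add] at this
    rw [this]; abel
  cr_sq_eq {k j} h := by
    by_cases hk : k + 1 < size v
    · rw [permCross_sq_idem i hk, if_pos h, zero_mul]
    · rw [permCross_of_le (by omega), zero_mul, zero_mul]
  cr_sq_far {k j} hk h h1 h2 := by
    rw [permCross_sq_idem i hk, if_neg h, if_neg h1, if_neg h2, one_mul]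
  cr_sq_up {k j} h := by
    have hk : k + 1 < size v := by
      by_contra hk
      simp [Words.lab, hk] at h
    rw [permCross_sq_idem i hk, if_neg (by omega), if_pos h]
  cr_sq_down {k j} hk h := by
    rw [permCross_sq_idem i hk, if_neg (by omega), if_neg (by omega), if_pos h]
  triple_down {k j} hk h1 h2 h3 := by
    rw [permCross_triple hk, if_pos ⟨h1, h3, h2⟩, one_smul]
  triple_up {k j} hk h1 h2 := by
    -- The letter above `j.lab k` is at most `n`, so the outer strands are not red.
    have h3 := j.lab_le (k + 1)
    rw [permCross_triple hk, if_neg (by omega), if_pos ⟨h1, h2, by omega⟩, permEnd_neg_smul, one_smul]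
  triple_far {k j} h := by
    by_cases hk : k + 2 < size v
    · rw [permCross_triple hk, if_neg (by tauto), if_neg (by tauto), zero_smul]
    · rw [permCross_of_le (k := k + 1) (by omega), mul_zero, zero_mul, zero_mul, sub_zero, zero_mul]

/-- The indicator function of the trivial permutation. -/
def permOne (v : Fin n → ℕ) : PermFun v := fun σ => if σ = 1 then 1 else 0

theorem permOne_ne_zero : permOne v ≠ 0 := fun h => by
  simpa [permOne] using congrFun h 1

theorem permIdem_permOne : permIdem i i (permOne v) = permOne v := by
  funext σ
  rw [permIdem_apply]
  split_ifs with h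
  · rfl
  · rw [permOne, if_neg]
    rintro rfl
    exact h rfl

theorem permDot_permOne (k : ℕ) :
    permDot i k (permOne v) = (if k < size v then dotValue i k else 0) • permOne v := by
  funext σ
  rw [permDot_apply, Pi.smul_apply, smul_eq_mul, permOne]
  by_cases hσ : σ = 1
  · subst hσ
    by_cases h : k < size v <;> simp [strand, h]
  · simp [hσ]

/-- At a descent by one the position rises by one while the label drops by one, so the two dots have
the same eigenvalue. The coefficient `w - z` of the transposed argument is therefore zero. -/
theorem permCross_permOne {k : ℕ} (h : i.lab (k + 1) + 1 = i.lab k) :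
    permCross i k (permOne v) = 0 := by
  by_cases hk : k + 1 < size v
  swap
  · rw [permCross_of_le (by omega)]; rfl
  funext σ
  rw [permCross_apply hk]
  have h0 : dc i (strand σ k) (strand σ (k + 1)) * permOne v σ = 0 := by
    rw [permOne]
    split_ifs with hσ
    · subst hσ
      rw [dc_of_ne, zero_mul]
      simp [strand, hk, (by omega : k < size v)]
      omega
    · rw [mul_zero]
  rw [h0, add_zero, permOne]
  split_ifs with hσ
  · have h1 : σ = adjSwap (size v) k := by
      rw [← mul_one σ, ← adjSwap_mul_self (size v) k, ← mul_assoc, hσ, one_mul]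
    have h2 : strand σ k = k + 1 := by
      rw [h1, ← one_mul (adjSwap _ _), strand_adjSwap_left hk]; simp [strand, hk]
    have h3 : strand σ (k + 1) = k := by
      rw [h1, ← one_mul (adjSwap _ _), strand_adjSwap_right hk]
      simp [strand, (by omega : k < size v)]
    rw [h2, h3, tc, transCoeff, if_neg (by omega), if_pos h, dotValue, dotValue, ← h]
    push_cast; ring_nf; rfl
  · simp

end KLRW
end

/-! ### Exchange of equal segments, and words forbidden as smallest words of modules. -/

noncomputable section

namespace KLRW

variable {n : ℕ} {v : Fin n → ℕ}

namespace Pres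

variable {A : Type*} [Ring A] [Algebra ℂ A] (P : Pres v A)

/-- The product `ψ_{p+m-1} ⋯ ψ_{p+1} ψ_p`. -/
def D (p : ℕ) : ℕ → A
  | 0 => 1
  | m + 1 => P.cr (p + m) * D p m

theorem D_succ (p m : ℕ) : P.D p (m + 1) = P.cr (p + m) * P.D p m := rfl

theorem D_succ' (p m : ℕ) : P.D p (m + 1) = P.D (p + 1) m * P.cr p := by
  induction m with
  | zero => simp [D]
  | succ m ih => rw [D_succ, ih, D_succ, ← mul_assoc, add_right_comm, add_assoc]

theorem cr_mul_D_right {p m k : ℕ} (h : p + m < k) : P.cr k * P.D p m = P.D p m * P.cr k := by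
  induction m with
  | zero => simp [D]
  | succ m ih => rw [D_succ, ← mul_assoc, ← P.cr_mul_cr_far (by omega), mul_assoc, ih (by omega),
      mul_assoc]

theorem cr_mul_D_left {p m k : ℕ} (h : k + 1 < p) : P.cr k * P.D p m = P.D p m * P.cr k := by
  induction m with
  | zero => simp [D]
  | succ m ih => rw [D_succ, ← mul_assoc, P.cr_mul_cr_far (by omega), mul_assoc, ih, mul_assoc]

/-- The word obtained by moving the letter at position `p` to position `p + m`. -/
def _root_.KLRW.Words.vm (i : Words v) (p : ℕ) : ℕ → Words v
  | 0 => i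
  | m + 1 => (i.vm p m).sw (p + m)

theorem D_mul_e (p m : ℕ) (i : Words v) : P.D p m * P.e i = P.e (i.vm p m) * P.D p m := by
  induction m with
  | zero => simp [D, Words.vm]
  | succ m ih => rw [D_succ, mul_assoc, ih, ← mul_assoc, P.cr_mul_e, mul_assoc, Words.vm]

theorem _root_.KLRW.Words.lab_vm (i : Words v) {p m : ℕ} (h : p + m < size v) :
    (i.vm p m).lab (p + m) = i.lab p ∧ (∀ t < m, (i.vm p m).lab (p + t) = i.lab (p + 1 + t)) ∧
    ∀ s, (s < p ∨ p + m < s) → (i.vm p m).lab s = i.lab s := by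
  induction m with
  | zero => simp [Words.vm]
  | succ m ih =>
    obtain ⟨h1, h2, h3⟩ := ih (by omega)
    refine ⟨?_, ?_, ?_⟩
    · rw [Words.vm, ← add_assoc, Words.lab_sw_right _ (by omega), h1]
    · intro t ht
      rcases Nat.lt_succ_iff_lt_or_eq.1 ht with ht | rfl
      · rw [Words.vm, Words.lab_sw_of_ne _ (by omega) (by omega), h2 t ht]
      · rw [Words.vm, Words.lab_sw_left _ (by omega), h3 _ (by omega)]; congr 1; omega
    · intro s hs
      rw [Words.vm, Words.lab_sw_of_ne _ (by omega) (by omega), h3 s (by omega)]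

variable {M : Type*} [AddCommGroup M] [Module A M] {P}

theorem e_cr_smul {i : Words v} {x : M} (hx : P.e i • x = x) (k : ℕ) :
    P.e (i.sw k) • P.cr k • x = P.cr k • x := by
  rw [← mul_smul, ← P.cr_mul_e, mul_smul, hx]

theorem e_Y_smul {i : Words v} {x : M} (hx : P.e i • x = x) (k : ℕ) :
    P.e i • P.Y k • x = P.Y k • x := by
  rw [← mul_smul, ← P.Y_mul_e, mul_smul, hx]

theorem e_D_smul {i : Words v} {x : M} (hx : P.e i • x = x) (p m : ℕ) :
    P.e (i.vm p m) • P.D p m • x = P.D p m • x := by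
  rw [← mul_smul, ← P.D_mul_e, mul_smul, hx]

theorem smul_eq_of_mul_e {i : Words v} {x : M} (hx : P.e i • x = x) {a b : A}
    (h : a * P.e i = b * P.e i) : a • x = b • x := by
  rw [← hx, ← mul_smul, h, mul_smul]

theorem Y_cr_smul {i : Words v} {x : M} (hx : P.e i • x = x) {k : ℕ}
    (h : i.lab k ≠ i.lab (k + 1)) : P.Y k • P.cr k • x = P.cr k • P.Y (k + 1) • x := by
  have := P.Y_mul_cr_left k i
  rw [eps, if_neg (by tauto), zero_smul, add_zero] at this
  simpa only [mul_smul] using smul_eq_of_mul_e hx this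

theorem cr_Y_smul {i : Words v} {x : M} (hx : P.e i • x = x) {k : ℕ}
    (h : i.lab k ≠ i.lab (k + 1)) : P.cr k • P.Y k • x = P.Y (k + 1) • P.cr k • x := by
  have := P.cr_mul_Y_left k i
  rw [eps, if_neg (by tauto), zero_smul, add_zero] at this
  simpa only [mul_smul] using smul_eq_of_mul_e hx this

theorem lt_of_lab_eq {i : Words v} {k : ℕ} {a : ℕ} (h : i.lab k = a) (ha : 0 < a) :
    k < size v := by
  by_contra hk
  simp [Words.lab, hk] at h
  omega

theorem Y_cr_smul_self {i : Words v} {x : M} (hx : P.e i • x = x) {k : ℕ} (h0 : 0 < i.lab k)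
    (h : i.lab k = i.lab (k + 1)) (hn : i.lab k ≠ n) :
    P.Y k • P.cr k • x = P.cr k • P.Y (k + 1) • x + x := by
  have := P.Y_mul_cr_left k i
  rw [eps, if_pos ⟨lt_of_lab_eq h.symm h0, h, hn⟩, one_smul] at this
  have h2 := smul_eq_of_mul_e (b := P.cr k * P.Y (k + 1) + 1) hx (by rw [this, add_mul, one_mul])
  simpa only [mul_smul, add_smul, one_smul] using h2

theorem cr_Y_smul_self {i : Words v} {x : M} (hx : P.e i • x = x) {k : ℕ} (h0 : 0 < i.lab k)
    (h : i.lab k = i.lab (k + 1)) (hn : i.lab k ≠ n) :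
    P.cr k • P.Y k • x = P.Y (k + 1) • P.cr k • x + x := by
  have := P.cr_mul_Y_left k i
  rw [eps, if_pos ⟨lt_of_lab_eq h.symm h0, h, hn⟩, one_smul] at this
  have h2 := smul_eq_of_mul_e (b := P.Y (k + 1) * P.cr k + 1) hx (by rw [this, add_mul, one_mul])
  simpa only [mul_smul, add_smul, one_smul] using h2

theorem cr_cr_smul_self {i : Words v} {x : M} (hx : P.e i • x = x) {k : ℕ}
    (h : i.lab k = i.lab (k + 1)) : P.cr k • P.cr k • x = 0 := by
  have h2 := smul_eq_of_mul_e (b := 0) hx (by rw [P.cr_sq_eq h, zero_mul])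
  simpa only [mul_smul, zero_smul] using h2

theorem cr_cr_smul_far {i : Words v} {x : M} (hx : P.e i • x = x) {k : ℕ} (hk : k + 1 < size v)
    (h : i.lab k + 1 < i.lab (k + 1) ∨ i.lab (k + 1) + 1 < i.lab k) :
    P.cr k • P.cr k • x = x := by
  have h2 := smul_eq_of_mul_e (b := 1) hx
    (by rw [P.cr_sq_far hk (by omega) (by omega) (by omega), one_mul])
  simpa only [mul_smul, one_smul] using h2

theorem cr_cr_smul_down {i : Words v} {x : M} (hx : P.e i • x = x) {k : ℕ} (hk : k + 1 < size v)
    (h : i.lab (k + 1) + 1 = i.lab k) :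
    P.cr k • P.cr k • x = P.Y k • x - P.Y (k + 1) • x := by
  have h2 := smul_eq_of_mul_e hx (P.cr_sq_down hk h)
  simpa only [mul_smul, sub_smul] using h2

theorem triple_smul_down {i : Words v} {x : M} (hx : P.e i • x = x) {k : ℕ}
    (hk : k + 2 < size v) (h1 : i.lab k = i.lab (k + 2)) (h2 : i.lab (k + 1) + 1 = i.lab k)
    (h3 : i.lab k ≠ n) :
    P.cr k • P.cr (k + 1) • P.cr k • x - P.cr (k + 1) • P.cr k • P.cr (k + 1) • x = x := by
  have h2 := smul_eq_of_mul_e (b := 1) hx (by rw [P.triple_down hk h1 h2 h3, one_mul])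
  simpa only [mul_smul, sub_smul, one_smul] using h2

theorem triple_smul_far {i : Words v} {x : M} (hx : P.e i • x = x) {k : ℕ}
    (h : i.lab k ≠ i.lab (k + 2)) :
    P.cr k • P.cr (k + 1) • P.cr k • x = P.cr (k + 1) • P.cr k • P.cr (k + 1) • x := by
  have h2 := smul_eq_of_mul_e (b := 0) hx (by rw [P.triple_far (fun h' => h h'.1), zero_mul])
  simpa only [mul_smul, sub_smul, zero_smul, sub_eq_zero] using h2

omit [Algebra ℂ A] in
theorem comm_smul {a b : A} (h : a * b = b * a) (x : M) : a • b • x = b • a • x := by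
  rw [← mul_smul, h, mul_smul]

theorem Y_mul_C {p m l : ℕ} (h : l < p ∨ p + m < l) : P.Y l * P.C p m = P.C p m * P.Y l := by
  induction m with
  | zero => simp
  | succ m ih =>
    rw [C_succ, ← mul_assoc, ih (by omega), mul_assoc, mul_assoc,
      P.Y_mul_cr_far (by omega) (by omega)]

theorem Y_mul_D {p m l : ℕ} (h : l < p ∨ p + m < l) : P.Y l * P.D p m = P.D p m * P.Y l := by
  induction m with
  | zero => simp [D]
  | succ m ih =>
    rw [D_succ, ← mul_assoc, P.Y_mul_cr_far (by omega) (by omega), mul_assoc, ih (by omega),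
      mul_assoc]

/-- A letter may be moved to the left past letters far away, and back. -/
theorem D_C_smul {i : Words v} {x : M} (hx : P.e i • x = x) {p m : ℕ} (h : p + m < size v)
    (hf : ∀ t < m, i.lab (p + t) + 1 < i.lab (p + m)) : P.D p m • P.C p m • x = x := by
  induction m generalizing p with
  | zero => simp [D]
  | succ m ih =>
    have e1 := e_C_smul hx (p + 1) m
    obtain ⟨h1, h2, h3⟩ := i.lab_mv (p := p + 1) (m := m) (by omega)
    have h0 := hf 0 (by omega)
    rw [D_succ', C_succ', mul_smul, mul_smul, cr_cr_smul_far e1 (by omega)]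
    · refine ih (by omega) fun t ht => ?_
      have := hf (t + 1) (by omega)
      rwa [show p + 1 + t = p + (t + 1) by ring, show p + 1 + m = p + (m + 1) by ring]
    · left
      rw [h1, h3 p (by omega), show p + 1 + m = p + (m + 1) by ring]
      exact h0

/-- A letter may be moved to the right past letters far away, and back. -/
theorem C_D_smul {i : Words v} {x : M} (hx : P.e i • x = x) {p m : ℕ} (h : p + m < size v)
    (hf : ∀ t < m, i.lab (p + 1 + t) + 1 < i.lab p) : P.C p m • P.D p m • x = x := by
  induction m with
  | zero => simp [D]
  | succ m ih =>
    have e1 := e_D_smul hx p m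
    obtain ⟨h1, h2, h3⟩ := i.lab_vm (p := p) (m := m) (by omega)
    rw [D_succ, C_succ, mul_smul, mul_smul, cr_cr_smul_far e1 (by omega)]
    · exact ih (by omega) fun t ht => hf t (by omega)
    · right
      rw [h1, h3 _ (by omega), show p + m + 1 = p + 1 + m by ring]
      exact hf m (by omega)

/-- The letters `k, k - 1, …, k - s` appear in `i` from position `p` on. -/
def _root_.KLRW.Words.Run (i : Words v) (p k s : ℕ) : Prop :=
  s < k ∧ ∀ t ≤ s, i.lab (p + t) + t = k

variable (P)

/-- The exchange of two equal segments of length `s + 1`. -/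
def Phi : ℕ → ℕ → A
  | 0, p => P.cr p
  -- The head of the second segment is fetched to the front, the two tails, now adjacent, are
  -- exchanged, and the head of the first segment is moved behind the first tail. The sign
  -- compensates that of `TwoSegments.D_C_smul`.
  | s + 1, p => -(P.D (p + 1) (s + 1) * Phi s (p + 2) * P.C p (s + 2))

/-- A vector whose weight has two equal black segments from position `p` on, and which is killed by
the crossings inside these segments. -/
structure TwoSegments (i : Words v) (p k s : ℕ) (x : M) : Prop where
  weight : P.e i • x = x
  fst : i.Run p k s
  snd : i.Run (p + s + 1) k s
  black : k < n
  cr_fst : ∀ t < s, P.cr (p + t) • x = 0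
  cr_snd : ∀ t < s, P.cr (p + s + 1 + t) • x = 0

variable {P}

theorem cr_mul_Phi {s p l : ℕ} (h : l + 1 < p ∨ p + 2 * s + 1 < l) :
    P.cr l * P.Phi s p = P.Phi s p * P.cr l := by
  induction s generalizing p with
  | zero =>
    rw [Phi]
    rcases h with h | h
    · exact P.cr_mul_cr_far h
    · exact (P.cr_mul_cr_far (by omega)).symm
  | succ s ih =>
    have h1 : P.cr l * P.D (p + 1) (s + 1) = P.D (p + 1) (s + 1) * P.cr l := by
      rcases h with h | h
      · exact P.cr_mul_D_left (by omega)
      · exact P.cr_mul_D_right (by omega)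
    have h2 : P.cr l * P.C p (s + 2) = P.C p (s + 2) * P.cr l := by
      rcases h with h | h
      · exact P.cr_mul_C_left (by omega)
      · exact P.cr_mul_C_right (by omega)
    rw [Phi, mul_neg, neg_mul, ← mul_assoc, ← mul_assoc, h1, mul_assoc (P.D _ _), ih (by omega),
      mul_assoc, mul_assoc, mul_assoc, h2]
    simp only [mul_assoc]

theorem Y_mul_Phi {s p l : ℕ} (h : l < p ∨ p + 2 * s + 1 < l) :
    P.Y l * P.Phi s p = P.Phi s p * P.Y l := by
  induction s generalizing p with
  | zero => exact P.Y_mul_cr_far (by omega) (by omega)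
  | succ s ih =>
    rw [Phi, mul_neg, neg_mul, ← mul_assoc, ← mul_assoc, Y_mul_D (by omega), mul_assoc (P.D _ _),
      ih (by omega), mul_assoc, mul_assoc, mul_assoc, Y_mul_C (by omega)]
    simp only [mul_assoc]

theorem _root_.KLRW.Words.Run.mv {i : Words v} {p k s : ℕ} (h1 : i.Run p k (s + 1))
    (h2 : i.Run (p + (s + 1) + 1) k (s + 1)) :
    (i.mv p (s + 2)).Run (p + 2) (k - 1) s ∧ (i.mv p (s + 2)).Run (p + 2 + s + 1) (k - 1) s := by
  obtain ⟨hsk, h1⟩ := h1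
  have h2 := h2.2
  have h20 := h2 0 (by omega)
  have hp : p + (s + 2) < size v := lt_of_lab_eq (i := i) (a := k) (by
    rw [← h20]; rfl) (by omega)
  obtain ⟨g1, g2, g3⟩ := i.lab_mv hp
  refine ⟨⟨by omega, fun t ht => ?_⟩, ⟨by omega, fun t ht => ?_⟩⟩
  · rw [show p + 2 + t = p + 1 + (t + 1) by ring, g2 _ (by omega)]
    have := h1 (t + 1) (by omega)
    omega
  · rw [g3 _ (by omega)]
    have := h2 (t + 1) (by omega)
    rw [show p + (s + 1) + 1 + (t + 1) = p + 2 + s + 1 + t by ring] at this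
    omega

/-- The exact form of `C_mul_cr_sub`: the outer letters of the triple point differ, so there is no
error term. -/
theorem cr_C_smul {i : Words v} {x : M} (hx : P.e i • x = x) {p b r : ℕ}
    (h : p + (b + 2) + r < size v) (hl : i.lab (p + b) ≠ i.lab (p + (b + 2) + r)) :
    P.cr (p + b + 1) • P.C p (b + 2 + r) • x = P.C p (b + 2 + r) • P.cr (p + b) • x := by
  have hC : P.C p (b + 2 + r) = P.C p b * (P.cr (p + b) * (P.cr (p + b + 1) *
      P.C (p + (b + 2)) r)) := by
    rw [C_add, C_succ, C_succ, ← add_assoc p b 1]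
    simp only [mul_assoc]
  have hD := P.cr_mul_C_left (p := p + (b + 2)) (m := r) (k := p + b) (by omega)
  have hB := P.cr_mul_C_right (p := p) (m := b) (k := p + b + 1) (by omega)
  obtain ⟨h1, h2, h3⟩ := i.lab_mv (p := p + (b + 2)) (m := r) (by omega)
  have e1 := e_C_smul hx (p + (b + 2)) r
  have e2 := triple_smul_far e1 (k := p + b) (by
    rw [h3 _ (by omega), show p + b + 2 = p + (b + 2) by ring, h1]; exact hl)
  rw [hC]
  simp only [mul_smul]
  rw [comm_smul hB, ← e2, comm_smul hD]

/-- The first half of the exchange of two segments. -/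
theorem TwoSegments.C_smul {i : Words v} {p k s : ℕ} {x : M} (h : P.TwoSegments i p k (s + 1) x) :
    P.TwoSegments (i.mv p (s + 2)) (p + 2) (k - 1) s (P.C p (s + 2) • x) ∧
      P.cr p • P.C p (s + 2) • x = 0 := by
  have hr := h.fst.mv h.snd
  obtain ⟨hx, ⟨hsk, h1⟩, ⟨-, h2⟩, hk, hc1, hc2⟩ := h
  have h20 := h2 0 (by omega)
  have hp : p + (s + 2) < size v := lt_of_lab_eq (i := i) (a := k) (by
    rw [← h20]; rfl) (by omega)
  obtain ⟨g1, g2, g3⟩ := i.lab_mv hp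
  refine ⟨⟨e_C_smul hx _ _, hr.1, hr.2, by omega, fun t ht => ?_, fun t ht => ?_⟩, ?_⟩
  · obtain ⟨r, rfl⟩ := Nat.exists_eq_add_of_lt ht
    have e1 := cr_C_smul hx (p := p) (b := t + 1) (r := r) (by omega) (by
      have e2 := h1 (t + 1) (by omega)
      have e3 : i.lab (p + (t + 1 + 2) + r) = k := by
        rw [← h20]; simp only [add_zero]; congr 1; omega
      omega)
    rw [show p + (t + 1) + 1 = p + 2 + t by ring,
      show t + 1 + 2 + r = t + r + 1 + 2 by ring, hc1 _ (by omega), smul_zero] at e1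
    exact e1
  · rw [comm_smul (P.cr_mul_C_right (by omega))]
    have := hc2 (t + 1) (by omega)
    rw [show p + (s + 1) + 1 + (t + 1) = p + 2 + s + 1 + t by ring] at this
    rw [this, smul_zero]
  · obtain ⟨g1, g2, g3⟩ := i.lab_mv (p := p + 1) (m := s + 1) (by omega)
    rw [C_succ', mul_smul]
    refine cr_cr_smul_self (e_C_smul hx _ _) ?_
    rw [g3 _ (by omega), g1]
    have := h1 0 (by omega)
    simp only [add_zero] at this h20
    rw [this, ← h20]; congr 1; omega

/-- Moving the first letter of the second segment to the left, and back. -/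
theorem TwoSegments.D_C_smul {i : Words v} {p k s : ℕ} {x : M}
    (h : P.TwoSegments i p k (s + 1) x) : P.D (p + 1) (s + 1) • P.C p (s + 2) • x = -x := by
  obtain ⟨hx, ⟨hsk, h1⟩, ⟨-, h2⟩, hk, hc1, hc2⟩ := h
  have h20 : i.lab (p + 2 + s) = k := by
    rw [← h2 0 (by omega)]; simp only [add_zero]; congr 1; omega
  have hp : p + 2 + s < size v := lt_of_lab_eq h20 (by omega)
  have hC : P.C p (s + 2) = P.cr p * (P.cr (p + 1) * P.C (p + 2) s) := by
    rw [C_succ', C_succ']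
  obtain ⟨g1, g2, g3⟩ := i.lab_mv hp
  have e0 := h1 0 (by omega)
  have e1 := h1 1 (by omega)
  simp only [add_zero] at e0
  -- In the triple point relation for `k, k - 1, k` the term that begins with `cr p` vanishes, since
  -- `cr p` kills `x`. The other term gives `-1`; the remaining crossings move the letter `k` past
  -- letters far away and back.
  have e2 := triple_smul_down (e_C_smul hx (p + 2) s) (k := p) (by omega)
    (by rw [g3 _ (by omega), g1, e0, h20]) (by rw [g3 _ (by omega), g3 _ (by omega), e0, e1])
    (by rw [g3 _ (by omega)]; omega)
  have e3 : P.cr p • x = 0 := by simpa using hc1 0 (by omega)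
  rw [comm_smul (P.cr_mul_C_left (by omega)), e3, smul_zero, smul_zero, smul_zero, zero_sub] at e2
  rw [hC, D_succ', mul_smul, mul_smul, mul_smul, ← neg_eq_iff_eq_neg, ← smul_neg, e2]
  refine Pres.D_C_smul hx hp fun t ht => ?_
  have := h1 (t + 2) (by omega)
  rw [h20, show p + 2 + t = p + (t + 2) by ring]
  omega

/-- The crossings past far letters cancel, and the bigon at `p + 1` becomes a difference of two
dots. The right dot commutes with `cr p`, which kills `x`; the left one gives `-x` by the nilHecke
relation. This is used for the square of `Phi`. -/
theorem C_D_smul_of_cr {i : Words v} {p k s : ℕ} {x : M} (hx : P.e i • x = x)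
    (h : p + (s + 2) < size v) (h1 : i.lab p = k) (h2 : i.Run (p + 1) k (s + 1)) (hk : k < n)
    (h3 : P.cr p • x = 0) : P.C p (s + 2) • P.D (p + 1) (s + 1) • x = -x := by
  have hC : P.C p (s + 2) = P.cr p * (P.cr (p + 1) * P.C (p + 2) s) := by
    rw [C_succ', C_succ']
  have e0 := h2.2 0 (by omega)
  have e1 := h2.2 1 (by omega)
  have hs := h2.1
  simp only [add_zero] at e0
  have e2 : P.C (p + 2) s • P.D (p + 2) s • P.cr (p + 1) • x = P.cr (p + 1) • x := by
    refine C_D_smul (e_cr_smul hx (p + 1)) (by omega) fun t ht => ?_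
    rw [Words.lab_sw_of_ne _ (by omega) (by omega), Words.lab_sw_right _ (by omega), e0]
    have := h2.2 (t + 2) (by omega)
    rw [show p + 1 + (t + 2) = p + 2 + 1 + t by ring] at this
    omega
  rw [hC, D_succ', mul_smul, mul_smul, mul_smul, e2, cr_cr_smul_down hx (by omega) (by omega),
    smul_sub]
  have e3 := Y_cr_smul_self hx (k := p) (by omega) (by omega) (by omega)
  rw [h3, smul_zero] at e3
  rw [comm_smul (a := P.cr p) (P.Y_mul_cr_far (l := p + 1 + 1) (by omega) (by omega)).symm x, h3,
    smul_zero, sub_zero]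
  exact eq_neg_of_add_eq_zero_left e3.symm

theorem _root_.KLRW.Words.Run.vm_mv {i : Words v} {p k s : ℕ} (h1 : i.Run p k (s + 1))
    (h2 : i.Run (p + (s + 1) + 1) k (s + 1)) : (i.mv p (s + 2)).vm (p + 1) (s + 1) = i := by
  have hsk := h1.1
  have e0 := h1.2 0 (by omega)
  simp only [add_zero] at e0
  have e2 : i.lab (p + s + 2) = k := h2.2 0 (by omega)
  have hp : p + s + 2 < size v := lt_of_lab_eq e2 (by omega)
  obtain ⟨g1, g2, g3⟩ := i.lab_mv (p := p) (m := s + 2) (by omega)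
  obtain ⟨f1, f2, f3⟩ := (i.mv p (s + 2)).lab_vm (p := p + 1) (m := s + 1) (by omega)
  have f4 := g2 0 (by omega)
  simp only [add_zero] at f4
  apply Words.lab_ext
  intro m _
  by_cases m1 : m ≤ p
  · rw [f3 _ (by omega)]
    rcases m1.lt_or_eq with m1 | rfl
    · rw [g3 _ (by omega)]
    · rw [g1, e0, ← e2]; rfl
  · by_cases m2 : m < p + s + 2
    · obtain ⟨t, rfl⟩ := Nat.exists_eq_add_of_lt (not_le.1 m1)
      have := f2 t (by omega)
      rw [show p + t + 1 = p + 1 + t by ring, this,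
        show p + 1 + 1 + t = p + 1 + (t + 1) by ring, g2 _ (by omega)]
      congr 1; omega
    · by_cases m3 : m = p + s + 2
      · rw [m3, show p + s + 2 = p + 1 + (s + 1) by ring, f1, f4, e0,
          show p + 1 + (s + 1) = p + s + 2 by ring, e2]
      · rw [f3 _ (by omega), g3 _ (by omega)]

theorem Phi_mul_e {i : Words v} {p k s : ℕ} (h1 : i.Run p k s) (h2 : i.Run (p + s + 1) k s) :
    P.Phi s p * P.e i = P.e i * P.Phi s p := by
  induction s generalizing p i k with
  | zero =>
    have e1 := h1.2 0 le_rfl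
    have e2 := h2.2 0 le_rfl
    simp only [add_zero] at e1 e2
    rw [Phi, P.cr_mul_e, Words.sw_eq_self (by omega)]
  | succ s ih =>
    rw [Phi, neg_mul, mul_assoc, P.C_mul_e, ← mul_assoc, mul_assoc (P.D _ _),
      ih (h1.mv h2).1 (h1.mv h2).2, ← mul_assoc (P.D _ _), P.D_mul_e, h1.vm_mv h2, mul_neg]
    simp only [mul_assoc]

/-- `Phi` and the dots at the ends of the two segments satisfy nilHecke relations. By induction
these hold for the tails; the outer factors `D` and `C` carry the end dots along, and compose to
`-1`, which the sign in `Phi` compensates. -/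
theorem TwoSegments.phi {i : Words v} {p k s : ℕ} {x : M} (h : P.TwoSegments i p k s x) :
    P.e i • P.Phi s p • x = P.Phi s p • x ∧
    P.Phi s p • P.Y (p + s) • x = P.Y (p + 2 * s + 1) • P.Phi s p • x + x ∧
    P.Y (p + s) • P.Phi s p • x = P.Phi s p • P.Y (p + 2 * s + 1) • x + x ∧
    P.Phi s p • P.Phi s p • x = 0 := by
  induction s generalizing p i x k with
  | zero =>
    have he : P.e i • P.Phi 0 p • x = P.Phi 0 p • x := by
      rw [← mul_smul, ← Phi_mul_e h.fst h.snd, mul_smul, h.weight]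
    obtain ⟨hx, ⟨hsk, h1⟩, ⟨-, h2⟩, hk, -, -⟩ := h
    have e1 := h1 0 le_rfl
    have e2 := h2 0 le_rfl
    simp only [add_zero] at e1 e2 ⊢
    exact ⟨he, cr_Y_smul_self hx (by omega) (by omega) (by omega),
      Y_cr_smul_self hx (by omega) (by omega) (by omega), cr_cr_smul_self hx (by omega)⟩
  | succ s ih =>
    have he : P.e i • P.Phi (s + 1) p • x = P.Phi (s + 1) p • x := by
      rw [← mul_smul, ← Phi_mul_e h.fst h.snd, mul_smul, h.weight]
    obtain ⟨hw, hw0⟩ := h.C_smul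
    have hDC := h.D_C_smul
    obtain ⟨i1, i2, i3, i4⟩ := ih hw
    obtain ⟨hx, ⟨hsk, h1⟩, ⟨-, h2⟩, hk, hc1, hc2⟩ := h
    have e0 := h1 0 (by omega)
    have e1 := h1 (s + 1) le_rfl
    have e2 : i.lab (p + s + 2) = k := h2 0 (by omega)
    simp only [add_zero] at e0
    have hp : p + s + 2 < size v := lt_of_lab_eq e2 (by omega)
    obtain ⟨g1, g2, g3⟩ := i.lab_mv (p := p) (m := s + 2) (by omega)
    set w := P.C p (s + 2) • x with hwdef
    have hDY : ∀ u : M, P.e (i.mv p (s + 2)) • u = u →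
        P.Y (p + (s + 1)) • P.D (p + 1) (s + 1) • u =
          P.D (p + 1) (s + 1) • P.Y (p + 2 + s) • u := by
      intro u hu
      obtain ⟨f1, f2, f3⟩ := (i.mv p (s + 2)).lab_vm (p := p + 1) (m := s) (by omega)
      have f4 := g2 0 (by omega)
      have f5 := g2 (s + 1) (by omega)
      have f6 := Y_cr_smul (e_D_smul hu (p + 1) s) (k := p + 1 + s) (by
        rw [f1, f3 _ (by omega), show p + 1 + s + 1 = p + 1 + (s + 1) by ring, f5]
        simp only [add_zero] at f4
        omega)
      rw [D_succ, mul_smul, mul_smul, show p + (s + 1) = p + 1 + s by ring, f6,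
        comm_smul (Y_mul_D (by omega)), show p + 1 + s + 1 = p + 2 + s by ring]
    have hDY' : ∀ u : M, P.Y (p + 2 * (s + 1) + 1) • P.D (p + 1) (s + 1) • u =
        P.D (p + 1) (s + 1) • P.Y (p + 2 + 2 * s + 1) • u := by
      intro u
      rw [comm_smul (Y_mul_D (by omega)), show p + 2 * (s + 1) + 1 = p + 2 + 2 * s + 1 by ring]
    have hCY : P.C p (s + 2) • P.Y (p + (s + 1)) • x = P.Y (p + 2 + s) • w := by
      have f6 := cr_Y_smul hx (k := p + (s + 1)) (by
        rw [show p + (s + 1) + 1 = p + s + 2 by ring]; omega)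
      rw [hwdef, C_succ, mul_smul, mul_smul, f6, comm_smul (Y_mul_C (by omega)).symm,
        show p + (s + 1) + 1 = p + 2 + s by ring]
    have hCY' : P.C p (s + 2) • P.Y (p + 2 * (s + 1) + 1) • x = P.Y (p + 2 + 2 * s + 1) • w := by
      rw [hwdef, comm_smul (Y_mul_C (by omega)).symm,
        show p + 2 * (s + 1) + 1 = p + 2 + 2 * s + 1 by ring]
    have hPhi : ∀ u : M, P.Phi (s + 1) p • u =
        -(P.D (p + 1) (s + 1) • P.Phi s (p + 2) • P.C p (s + 2) • u) := by
      intro u; rw [Phi, neg_smul, mul_smul, mul_smul]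
    refine ⟨?_, ?_, ?_, ?_⟩
    · exact he
    · rw [hPhi, hCY, i2, smul_add, hDC, ← hDY', hPhi, smul_neg, neg_add, neg_neg]
    · rw [hPhi, smul_neg, hDY _ i1, i3, smul_add, hDC, hPhi, hCY', neg_add, neg_neg]
    -- In the square, the inner `C D` acts on a vector that is killed by `cr p`, since this crossing
    -- commutes with the exchange of the tails. So it acts by `-1`, and the square of the shorter
    -- exchange remains, which is zero.
    · have f4 := g2 0 (by omega)
      simp only [add_zero] at f4
      have := C_D_smul_of_cr (k := k) i1 (s := s) (by omega) (by rw [g1, ← e2]; rfl)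
        ⟨hsk, fun t ht => by rw [g2 t (by omega)]; exact h1 t ht⟩ hk
        (by rw [comm_smul (cr_mul_Phi (by omega)), hw0, smul_zero])
      rw [hPhi, hPhi, smul_neg, this]
      simp only [smul_neg, i4]
      simp

/-- If `e(j)` annihilates a module for the word `j` obtained from a word `… a + 1, a, a, …` by
exchanging `a + 1` and the first `a`, then so does the idempotent of this word. -/
theorem smul_eq_zero_of_sw {i : Words v} {q : ℕ} (h0 : 0 < i.lab (q + 1))
    (h1 : i.lab (q + 1) + 1 = i.lab q) (h2 : i.lab (q + 2) = i.lab (q + 1))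
    (h3 : ∀ x : M, P.e (i.sw q) • x = 0) {x : M} (hx : P.e i • x = x) : x = 0 := by
  have hq : q + 1 < size v := lt_of_lab_eq rfl h0
  have hn := i.lab_le q
  have hY : ∀ u : M, P.e i • u = u → P.Y q • u = P.Y (q + 1) • u := by
    intro u hu
    have e1 := cr_cr_smul_down hu hq h1
    rwa [← e_cr_smul hu q, h3, smul_zero, eq_comm, sub_eq_zero] at e1
  have hcr : ∀ u : M, P.e i • u = u → P.e i • P.cr (q + 1) • u = P.cr (q + 1) • u := by
    intro u hu
    have := e_cr_smul hu (q + 1)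
    rwa [Words.sw_eq_self h2.symm] at this
  -- `Y q` commutes with `cr (q + 1)` and agrees with `Y (q + 1)` on this weight space. With the
  -- nilHecke relation this makes `cr (q + 1)` surjective there; as its square is zero, the weight
  -- space is zero.
  have key : ∀ u : M, P.e i • u = u →
      P.cr (q + 1) • (P.Y (q + 1) • u - P.Y (q + 2) • u) = u := by
    intro u hu
    have e1 := hY _ (hcr u hu)
    have e2 := Y_cr_smul_self hu (k := q + 1) h0 h2.symm (by omega)
    rw [comm_smul (P.Y_mul_cr_far (by omega) (by omega)), hY u hu, e2] at e1
    rw [smul_sub, e1]; abel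
  have hcr0 : ∀ u : M, P.e i • u = u → P.cr (q + 1) • u = 0 := by
    intro u hu
    rw [← key u hu]
    refine cr_cr_smul_self (i := i) ?_ h2.symm
    rw [smul_sub, e_Y_smul hu, e_Y_smul hu]
  rw [← key x hx]
  exact hcr0 _ (by rw [smul_sub, e_Y_smul hx, e_Y_smul hx])

/-- The word `j` is lexicographically smaller than `i`. -/
def _root_.KLRW.Words.Smaller (j i : Words v) : Prop :=
  ∃ q, (∀ m < q, j.lab m = i.lab m) ∧ j.lab q < i.lab q

theorem _root_.KLRW.Words.sw_smaller {i : Words v} {k : ℕ} (hk : k + 1 < size v)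
    (h : i.lab (k + 1) < i.lab k) : (i.sw k).Smaller i :=
  ⟨k, fun m hm => Words.lab_sw_of_ne _ (by omega) (by omega), by rwa [Words.lab_sw_left _ hk]⟩

section minimal

variable {i : Words v} (hmin : ∀ j : Words v, j.Smaller i → ∀ x : M, P.e j • x = 0) {x : M}
  (hx : P.e i • x = x)

include hmin hx

theorem cr_smul_of_descent {k : ℕ} (h : i.lab (k + 1) < i.lab k) : P.cr k • x = 0 := by
  by_cases hk : k + 1 < size v
  · rw [← e_cr_smul hx k, hmin _ (Words.sw_smaller hk h)]
  · rw [P.cr_of_le (by omega), zero_smul]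

/-- Otherwise the bigon relation gives `cr k • cr k • x = x`, although `cr k • x = 0`. -/
theorem descent_eq (hx0 : x ≠ 0) {k : ℕ} (hk : k + 1 < size v) (h : i.lab (k + 1) < i.lab k) :
    i.lab (k + 1) + 1 = i.lab k := by
  by_contra hne
  have := cr_cr_smul_far hx hk (Or.inr (by omega))
  rw [cr_smul_of_descent hmin hx h, smul_zero] at this
  exact hx0 this.symm

theorem Y_smul_of_descent {k : ℕ} (hk : k + 1 < size v) (h : i.lab (k + 1) + 1 = i.lab k) :
    P.Y k • x = P.Y (k + 1) • x := by
  have := cr_cr_smul_down hx hk h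
  rwa [cr_smul_of_descent hmin hx (by omega), smul_zero, eq_comm, sub_eq_zero] at this

theorem twoSegments_of_minimal {p k s : ℕ} (h1 : i.Run p k s) (h2 : i.Run (p + s + 1) k s)
    (hk : k < n) : P.TwoSegments i p k s x := by
  refine ⟨hx, h1, h2, hk, fun t ht => ?_, fun t ht => ?_⟩
  · have e1 := h1.2 t (by omega)
    have e2 := h1.2 (t + 1) (by omega)
    rw [← add_assoc p] at e2
    exact cr_smul_of_descent hmin hx (by omega)
  · have e1 := h2.2 t (by omega)
    have e2 := h2.2 (t + 1) (by omega)
    rw [← add_assoc (p + s + 1)] at e2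
    exact cr_smul_of_descent hmin hx (by omega)

/-- In the minimal word of a module, the second of two black segments with the same first letter
is not longer than the first one. -/
theorem eq_zero_of_longer_segment {p k s : ℕ} (h1 : i.Run p k s)
    (h2 : i.Run (p + s + 1) k (s + 1)) (hk : k < n) : x = 0 := by
  have h2' : i.Run (p + s + 1) k s := ⟨by have := h2.1; omega, fun t ht => h2.2 t (by omega)⟩
  have hs := h2.1
  have e1 := h2.2 s (by omega)
  have e2 := h2.2 (s + 1) le_rfl
  rw [show p + s + 1 + s = p + 2 * s + 1 by ring] at e1
  rw [show p + s + 1 + (s + 1) = p + 2 * s + 1 + 1 by ring] at e2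
  have hV : p + 2 * s + 1 + 1 < size v := lt_of_lab_eq (i := i) rfl (by omega)
  have hPhi := fun u (hu : P.e i • u = u) => (twoSegments_of_minimal hmin hu h1 h2' hk).phi
  have hY := fun u (hu : P.e i • u = u) => Y_smul_of_descent hmin hu hV (by omega)
  -- The second segment goes on behind the part that is exchanged. So the dot at the end of that
  -- part agrees with the next dot, which commutes with `Phi`, and the nilHecke relation writes `u`
  -- as an image under `Phi`. Doing this twice puts `x` into the image of the square of `Phi`, which
  -- is zero.
  have key : ∀ u : M, P.e i • u = u →
      P.Phi s p • (P.Y (p + s) • u - P.Y (p + 2 * s + 1) • u) = u := by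
    intro u hu
    obtain ⟨i1, i2, i3, i4⟩ := hPhi u hu
    rw [hY _ i1, comm_smul (Y_mul_Phi (by omega)), ← hY u hu] at i2
    rw [smul_sub, i2]; abel
  have hw : P.e i • (P.Y (p + s) • x - P.Y (p + 2 * s + 1) • x) =
      P.Y (p + s) • x - P.Y (p + 2 * s + 1) • x := by
    rw [smul_sub, e_Y_smul hx, e_Y_smul hx]
  have hw' : P.e i • (P.Y (p + s) • (P.Y (p + s) • x - P.Y (p + 2 * s + 1) • x) -
      P.Y (p + 2 * s + 1) • (P.Y (p + s) • x - P.Y (p + 2 * s + 1) • x)) =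
      P.Y (p + s) • (P.Y (p + s) • x - P.Y (p + 2 * s + 1) • x) -
      P.Y (p + 2 * s + 1) • (P.Y (p + s) • x - P.Y (p + 2 * s + 1) • x) := by
    rw [smul_sub, e_Y_smul hw, e_Y_smul hw]
  rw [← key x hx, ← key _ hw]
  exact (hPhi _ hw').2.2.2

/-- In the minimal word of a module, the first letters of the segments do not decrease. -/
theorem eq_zero_of_smaller_segment {q a t : ℕ} (h0 : i.lab q = a + 1) (h1 : i.Run (q + 1) a t)
    (h2 : i.lab (q + t + 2) = a) : x = 0 := by
  have ha := h1.1
  have e0 := h1.2 0 (by omega)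
  simp only [add_zero] at e0
  have hn := i.lab_le q
  have hV : q + t + 2 < size v := lt_of_lab_eq h2 (by omega)
  have hsm := hmin _ (Words.sw_smaller (k := q) (by omega) (by omega))
  rcases Nat.eq_zero_or_pos t with rfl | ht
  · exact smul_eq_zero_of_sw (by omega) (by omega)
      (by rw [e0]; exact h2) hsm hx
  obtain ⟨t, rfl⟩ := Nat.exists_eq_succ_of_ne_zero ht.ne'
  rw [Nat.succ_eq_add_one] at *
  have e1 := h1.2 1 (by omega)
  rw [show q + 1 + 1 = q + 2 by rfl] at e1
  have h2' : i.lab (q + 3 + t) = a := by rw [← h2]; congr 1; omega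
  obtain ⟨g1, g2, g3⟩ := i.lab_mv (p := q + 3) (m := t) (by omega)
  have hw := e_C_smul hx (q + 3) t
  have hDC := D_C_smul hx (p := q + 3) (m := t) (by omega) (fun r hr => by
    have := h1.2 (r + 2) (by omega)
    rw [show q + 1 + (r + 2) = q + 3 + r by ring] at this
    omega)
  set w := P.C (q + 3) t • x
  have f1 : (i.mv (q + 3) t).lab (q + 1) = a := by rw [g3 _ (by omega), e0]
  have f2 : (i.mv (q + 3) t).lab (q + 2) + 1 = a := by rw [g3 _ (by omega), e1]
  have f3 : (i.mv (q + 3) t).lab (q + 3) = a := by rw [g1, h2']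
  have f0 : (i.mv (q + 3) t).lab q = a + 1 := by rw [g3 _ (by omega), h0]
  -- With the last letter fetched, the word reads `a + 1, a, a - 1, a` from `q` on. Both terms of
  -- the triple point relation for `a, a - 1, a` vanish, hence so does `w`.
  have key := triple_smul_down hw (k := q + 1) (by omega) (by rw [f1]; exact f3.symm)
    (by rw [f1]; exact f2) (by omega)
  have hw1 : P.cr (q + 1) • w = 0 := by
    rw [comm_smul (P.cr_mul_C_left (by omega)), cr_smul_of_descent hmin hx (by
      rw [show q + 1 + 1 = q + 2 by rfl]; omega), smul_zero]
  -- This crossing leads to `a + 1, a, a, …`; exchanging its first two letters gives a word smaller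
  -- than `i`, so `smul_eq_zero_of_sw` applies.
  have hw2 : P.cr (q + 1 + 1) • w = 0 := by
    have hV' : q + 1 + 1 + 1 < size v := by omega
    have k1 : ((i.mv (q + 3) t).sw (q + 1 + 1)).lab q = a + 1 := by
      rw [Words.lab_sw_of_ne _ (by omega) (by omega), f0]
    have k2 : ((i.mv (q + 3) t).sw (q + 1 + 1)).lab (q + 1) = a := by
      rw [Words.lab_sw_of_ne _ (by omega) (by omega), f1]
    have k3 : ((i.mv (q + 3) t).sw (q + 1 + 1)).lab (q + 2) = a := by
      rw [show q + 2 = q + 1 + 1 by rfl, Words.lab_sw_left _ hV']; exact f3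
    refine smul_eq_zero_of_sw (i := (i.mv (q + 3) t).sw (q + 1 + 1)) (q := q) (by omega) (by omega)
      (by omega) (hmin _ ⟨q, fun m hm => ?_, ?_⟩)
      (e_cr_smul hw (q + 1 + 1))
    · rw [Words.lab_sw_of_ne _ (by omega) (by omega), Words.lab_sw_of_ne _ (by omega) (by omega),
        g3 _ (by omega)]
    · rw [Words.lab_sw_left _ (by omega)]; omega
  simp only [hw1, hw2, smul_zero, sub_zero] at key
  rw [← hDC, ← key, smul_zero]

end minimal

end Pres

end KLRW
end

/-! ### From smallest words to increasing lists of segments; lexicographic order. -/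

noncomputable section

namespace KLRW

theorem run_add (k a b : ℕ) : run k (a + b) = run k a ++ run (k - a) b := by
  induction a generalizing k with
  | zero => simp [run]
  | succ a ih => rw [show a + 1 + b = a + b + 1 by ring, run, run, ih, List.cons_append,
      Nat.sub_sub, add_comm 1 a]

theorem SegLE.trans {n : ℕ} {a b c : ℕ × ℕ} (h : SegLE n a b) (h' : SegLE n b c) :
    SegLE n a c := by
  unfold SegLE at *; omega

theorem Lyn.cons {n : ℕ} {x c : ℕ × ℕ} {S : List (ℕ × ℕ)} (h : Lyn n (c :: S))
    (hx : x.2 < x.1 ∧ x.1 ≤ n) (hxc : SegLE n x c) : Lyn n (x :: c :: S) := by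
  refine ⟨List.pairwise_cons.2 ⟨fun d hd => ?_, h.1⟩, fun d hd => ?_⟩
  · rcases List.mem_cons.1 hd with rfl | hd
    · exact hxc
    · exact hxc.trans ((List.pairwise_cons.1 h.1).1 d hd)
  · rcases List.mem_cons.1 hd with rfl | hd
    · exact hx
    · exact h.2 d hd

/-- The word of a list of segments. -/
def letters (S : List (ℕ × ℕ)) : List ℕ := (flat S).map Prod.fst

theorem letters_cons (c : ℕ × ℕ) (S : List (ℕ × ℕ)) :
    letters (c :: S) = (run c.1 (c.2 + 1)).map Prod.fst ++ letters S := by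
  simp [letters, flat, run]

theorem letters_cons_split (c : ℕ × ℕ) (S : List (ℕ × ℕ)) {m : ℕ} (h : m ≤ c.2 + 1) :
    ∃ l, letters (c :: S) = (run c.1 m).map Prod.fst ++ l := by
  obtain ⟨b, hb⟩ := Nat.exists_eq_add_of_le h
  exact ⟨(run (c.1 - m) b).map Prod.fst ++ letters S, by rw [letters_cons, hb, run_add]; simp⟩

/-- A word with descents by one only is the word of an increasing list of segments, unless
it contains one of two patterns. -/
theorem exists_lyn {n : ℕ} {w : List ℕ} (hw : ∀ a ∈ w, 0 < a ∧ a ≤ n)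
    (h1 : ∀ l1 a b l2, w = l1 ++ a :: b :: l2 → b < a → b + 1 = a)
    (h2 : ∀ l1 a t l2, t < a → w ≠ l1 ++ (a + 1) :: ((run a (t + 1)).map Prod.fst ++ a :: l2))
    (h3 : ∀ l1 k s l2, k < n → s + 1 < k →
      w ≠ l1 ++ ((run k (s + 1)).map Prod.fst ++ ((run k (s + 2)).map Prod.fst ++ l2))) :
    ∃ S, Lyn n S ∧ w = letters S := by
  induction w with
  | nil => exact ⟨[], ⟨List.Pairwise.nil, by simp⟩, rfl⟩
  | cons a w ih =>
    obtain ⟨S, hS, rfl⟩ := ih (fun b hb => hw b (by simp [hb]))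
      (fun l1 b c l2 h => h1 (a :: l1) b c l2 (by rw [h]; rfl))
      (fun l1 b t l2 hb h => h2 (a :: l1) b t l2 hb (by rw [h]; rfl))
      (fun l1 k s l2 hk hs h => h3 (a :: l1) k s l2 hk hs (by rw [h]; rfl))
    have ha := hw a (by simp)
    cases S with
    | nil =>
      refine ⟨[(a, 0)], ⟨List.pairwise_singleton _ _, ?_⟩, rfl⟩
      intro c hc
      rw [List.mem_singleton] at hc
      subst hc
      exact ha
    | cons c S =>
      obtain ⟨b, s⟩ := c
      have hb := hS.2 (b, s) (by simp)
      dsimp only at hb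
      have hdesc := h1 [] a b ((run (b - 1) s).map Prod.fst ++ letters S) (by
        rw [letters_cons, run]; rfl)
      -- The new letter either is joined to the first segment, as its new head, or forms a segment
      -- of its own.
      by_cases hab : b < a
      · obtain rfl := hdesc hab
        have hlet : (b + 1) :: letters ((b, s) :: S) = letters ((b + 1, s + 1) :: S) := by
          rw [letters_cons, letters_cons]; rfl
        refine ⟨(b + 1, s + 1) :: S, ?_, hlet⟩
        cases S with
        | nil =>
          refine ⟨List.pairwise_singleton _ _, ?_⟩
          intro c hc
          rw [List.mem_singleton] at hc
          subst hc
          dsimp only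
          omega
        | cons c S =>
          refine hS.tail.cons (by dsimp only; omega) ?_
          have hbc := (List.pairwise_cons.1 hS.1).1 c (by simp)
          have hc := hS.2 c (by simp)
          -- The first pattern prevents the next segment from starting below the prolonged one, the
          -- second prevents it from being longer when both start with the same black letter.
          have p1 : c.1 ≠ b := by
            rintro rfl
            refine h2 [] c.1 s ((run (c.1 - 1) c.2).map Prod.fst ++ letters S) hb.1 ?_
            rw [letters_cons, letters_cons]; rfl
          have p2 : ¬ (c.1 = b + 1 ∧ b + 1 < n ∧ s + 2 ≤ c.2) := by
            rintro ⟨p3, p4, p5⟩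
            obtain ⟨l, hl⟩ := letters_cons_split c S (m := s + 3) (by omega)
            refine h3 [] (b + 1) (s + 1) l p4 (by omega) ?_
            rw [hlet, letters_cons, hl, p3]; rfl
          simp only [SegLE] at hbc ⊢
          omega
      · refine ⟨(a, 0) :: (b, s) :: S, hS.cons (by dsimp only; omega) ?_, ?_⟩
        · have p2 : ¬ (a = b ∧ a < n ∧ 1 ≤ s) := by
            rintro ⟨rfl, p4, p5⟩
            obtain ⟨l, hl⟩ := letters_cons_split (a, s) S (m := 2) (by dsimp only; omega)
            refine h3 [] a 0 l p4 (by omega) ?_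
            rw [hl]; rfl
          simp only [SegLE]
          omega
        · rw [letters_cons (a, 0)]; rfl

theorem getElem?_run {k m t : ℕ} (h : t < m) : (run k m)[t]? = some (k - t, false) := by
  induction m generalizing k t with
  | zero => omega
  | succ m ih =>
    cases t with
    | zero => simp [run]
    | succ t => rw [run, List.getElem?_cons_succ, ih (by omega), Nat.sub_sub, add_comm 1 t]

variable {n : ℕ} {v : Fin n → ℕ}

theorem Words.Agrees.getElem? {i : Words v} {w : List ℕ} (h : i.Agrees 0 w) {t a : ℕ}
    (ht : w[t]? = some a) : i.lab t = a := by
  rw [← h.1, List.getElem?_map, Option.map_eq_some_iff] at ht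
  obtain ⟨b, hb, rfl⟩ := ht
  rw [List.getElem?_eq_some_iff] at hb
  obtain ⟨h', hb⟩ := hb
  simp only [List.getElem_range'] at hb
  rw [← hb]; congr 1; omega

theorem Words.Agrees.run {i : Words v} {l1 l2 : List ℕ} {k m : ℕ}
    (h : i.Agrees 0 (l1 ++ ((KLRW.run k m).map Prod.fst ++ l2))) {t : ℕ} (ht : t < m) :
    i.lab (l1.length + t) = k - t := by
  apply h.getElem?
  rw [List.getElem?_append_right (by omega), Nat.add_sub_cancel_left,
    List.getElem?_append_left (by simpa [length_run] using ht), List.getElem?_map,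
    getElem?_run ht]
  rfl

theorem Words.agrees_self (i : Words v) : i.Agrees 0 ((List.range' 0 (size v)).map i.lab) :=
  ⟨by simp, by simp⟩

/-- The minimal word of a module is a concatenation of increasing segments. -/
theorem Pres.exists_lyn_of_minimal {A : Type*} [Ring A] [Algebra ℂ A] {P : Pres v A} {M : Type*}
    [AddCommGroup M] [Module A M] {i : Words v}
    (hmin : ∀ j : Words v, j.Smaller i → ∀ x : M, P.e j • x = 0) {x : M} (hx : P.e i • x = x)
    (hx0 : x ≠ 0) : ∃ S, Lyn n S ∧ i.Agrees 0 (letters S) := by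
  have hi := i.agrees_self
  obtain ⟨S, hS, h⟩ := exists_lyn (n := n) (w := (List.range' 0 (size v)).map i.lab) (by
      intro a ha
      obtain ⟨t, ht, rfl⟩ := List.mem_map.1 ha
      rw [List.mem_range'_1] at ht
      exact ⟨i.lab_pos (by omega), i.lab_le t⟩) (by
      intro l1 a b l2 hw hab
      rw [hw] at hi
      have e1 : i.lab l1.length = a := hi.getElem? (by simp)
      have e2 : i.lab (l1.length + 1) = b := hi.getElem? (by
        rw [List.getElem?_append_right (by omega)]; simp)
      have e3 := hi.2
      simp only [List.length_append, List.length_cons] at e3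
      rw [← e1, ← e2]
      exact Pres.descent_eq hmin hx hx0 (by omega) (by omega)) (by
      intro l1 a t l2 ha hw
      rw [hw] at hi
      refine hx0 (Pres.eq_zero_of_smaller_segment hmin hx (q := l1.length) (a := a) (t := t)
        (hi.getElem? (by simp)) ⟨ha, fun r hr => ?_⟩ ?_)
      · have hi' : i.Agrees 0 ((l1 ++ [a + 1]) ++ ((run a (t + 1)).map Prod.fst ++ a :: l2)) := by
          simpa using hi
        have := hi'.run (t := r) (by omega)
        rw [List.length_append, List.length_singleton] at this
        omega
      · apply hi.getElem?
        rw [List.getElem?_append_right (by omega), show l1.length + t + 2 - l1.length = t + 1 + 1 by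
          omega, List.getElem?_cons_succ, List.getElem?_append_right (by simp [length_run])]
        simp [length_run]) (by
      intro l1 k s l2 hk hs hw
      rw [hw] at hi
      refine hx0 (Pres.eq_zero_of_longer_segment hmin hx (p := l1.length) (k := k) (s := s)
        ⟨by omega, fun r hr => ?_⟩ ⟨by omega, fun r hr => ?_⟩ hk)
      · have := hi.run (t := r) (by omega)
        omega
      · rw [← List.append_assoc] at hi
        have := hi.run (t := r) (by omega)
        rw [List.length_append, List.length_map, length_run, ← add_assoc] at this
        omega)
  exact ⟨S, hS, h ▸ hi⟩

theorem segment_eq (c : ℕ × ℕ) : segment c = (run c.1 (c.2 + 1)).map Prod.fst := by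
  apply List.ext_getElem?
  intro t
  by_cases h : t < c.2 + 1
  · rw [segment, List.getElem?_map, List.getElem?_map, getElem?_run h, List.getElem?_range h]
    rfl
  · rw [List.getElem?_eq_none (by simp [segment]; omega),
      List.getElem?_eq_none (by simp [length_run]; omega)]

theorem letters_eq (S : List (ℕ × ℕ)) : letters S = (S.map segment).flatten := by
  induction S with
  | nil => rfl
  | cons c S ih => rw [letters_cons, ih, List.map_cons, List.flatten_cons, segment_eq]

theorem Words.toList_eq (i : Words v) : i.toList = (List.range' 0 (size v)).map i.lab := by
  apply List.ext_getElem
  · simp [toList]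
  · intro t h1 h2
    have ht : t < size v := by simpa [toList] using h1
    simp [toList, i.lab_of_lt ht]

theorem Words.agrees_iff_toList (i : Words v) (w : List ℕ) : i.Agrees 0 w ↔ i.toList = w := by
  rw [i.toList_eq]
  constructor
  · rintro ⟨h1, h2⟩
    rw [← h1, ← h2, zero_add]
  · rintro rfl
    exact i.agrees_self

theorem isLyndonConcat_iff (i : Words v) :
    IsLyndonConcat i ↔ ∃ S, Lyn n S ∧ i.Agrees 0 (letters S) := by
  constructor
  · rintro ⟨as, bs, h1, h2, h3, h4⟩
    refine ⟨as ++ bs.map fun p => (n, p), ⟨List.pairwise_append.2 ⟨?_, ?_, ?_⟩, ?_⟩, ?_⟩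
    · exact h2.imp fun {a b} h => by unfold SegLE; tauto
    · rw [List.pairwise_map]
      exact List.pairwise_of_forall fun a b => Or.inr ⟨rfl, Or.inl rfl⟩
    · intro a ha b hb
      obtain ⟨p, -, rfl⟩ := List.mem_map.1 hb
      exact Or.inl (h1 a ha).2
    · intro a ha
      rcases List.mem_append.1 ha with ha | ha
      · exact ⟨(h1 a ha).1, (h1 a ha).2.le⟩
      · obtain ⟨p, hp, rfl⟩ := List.mem_map.1 ha
        exact ⟨h3 p hp, le_rfl⟩
    · rw [Words.agrees_iff_toList, h4, letters_eq, List.map_append, List.flatten_append,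
        List.map_map]
      rfl
  · rintro ⟨S, hS, hi⟩
    have : ∃ (as : List (ℕ × ℕ)) (bs : List ℕ), S = as ++ bs.map (fun p => (n, p)) ∧
        ∀ a ∈ as, a.1 < n := by
      clear hi
      induction S with
      | nil => exact ⟨[], [], rfl, by simp⟩
      | cons c S ih =>
        obtain ⟨as, bs, rfl, h⟩ := ih hS.tail
        have hc := (hS.2 c (by simp)).2
        rcases hc.lt_or_eq with hc | hc
        · refine ⟨c :: as, bs, rfl, fun a ha => ?_⟩
          rcases List.mem_cons.1 ha with rfl | ha
          · exact hc
          · exact h a ha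
        · cases as with
          | nil => exact ⟨[], c.2 :: bs, by simp [← hc], by simp⟩
          | cons a as =>
            have h1 := (List.pairwise_cons.1 hS.1).1 a (by simp)
            have h2 := h a (by simp)
            unfold SegLE at h1
            omega
    obtain ⟨as, bs, rfl, h⟩ := this
    refine ⟨as, bs, fun a ha => ⟨(hS.2 a (by simp [ha])).1, h a ha⟩, ?_, fun p hp => ?_, ?_⟩
    · refine (List.pairwise_append.1 hS.1).1.imp_of_mem fun {a b} ha hb hab => ?_
      have := h a ha
      unfold SegLE at hab
      omega
    · exact (hS.2 (n, p) (by simp [hp])).1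
    · rw [Words.agrees_iff_toList, letters_eq, List.map_append, List.flatten_append,
        List.map_map] at hi
      exact hi

theorem Words.lexLT_iff {i j : Words v} : i.LexLT j ↔ i.Smaller j := by
  change (∃ k, (∀ m, m < k → i.1 m = j.1 m) ∧ i.1 k < j.1 k) ↔ _
  constructor
  · rintro ⟨k, h1, h2⟩
    refine ⟨k, fun m hm => ?_, ?_⟩
    · have hm' : m < size v := hm.trans k.2
      rw [i.lab_of_lt hm', j.lab_of_lt hm', h1 ⟨m, hm'⟩ hm]
    · rw [i.lab_of_lt k.2, j.lab_of_lt k.2]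
      exact Nat.succ_lt_succ h2
  · rintro ⟨q, h1, h2⟩
    have hq : q < size v := Pres.lt_of_lab_eq (i := j) rfl (by omega)
    refine ⟨⟨q, hq⟩, fun m hm => ?_, ?_⟩
    · have := h1 m hm
      rw [i.lab_of_lt m.2, j.lab_of_lt m.2] at this
      exact Fin.ext (by simpa using this)
    · rw [i.lab_of_lt hq, j.lab_of_lt hq] at h2
      exact Fin.lt_def.2 (by omega)

theorem Words.smaller_of_lt {i j : Words v} {w w' : List ℕ} (hi : i.Agrees 0 w)
    (hj : j.Agrees 0 w') (h : w < w') : i.Smaller j := by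
  have hl : w.length = w'.length := by have := hi.2; have := hj.2; omega
  rcases List.lt_iff_exists.1 h with ⟨-, h⟩ | ⟨q, h1, h2, h3, h4⟩
  · omega
  · refine ⟨q, fun m hm => ?_, ?_⟩
    · rw [hi.getElem? (List.getElem?_eq_getElem (by omega)),
        hj.getElem? (List.getElem?_eq_getElem (by omega))]
      exact h3 m hm
    · rw [hi.getElem? (List.getElem?_eq_getElem h1), hj.getElem? (List.getElem?_eq_getElem h2)]
      exact h4

theorem Words.lexLT_trichotomy (i j : Words v) : i.LexLT j ∨ i = j ∨ j.LexLT i := by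
  rcases lt_trichotomy (toLex i.1) (toLex j.1) with h | h | h
  · exact Or.inl h
  · exact Or.inr (Or.inl (Subtype.ext (toLex.injective h)))
  · exact Or.inr (Or.inr h)

theorem Words.not_lexLT_self (i : Words v) : ¬ i.LexLT i := lt_irrefl (toLex i.1)

/-- A nonempty set of words has a smallest element. -/
theorem Words.exists_minimal {p : Words v → Prop} (h : ∃ i, p i) :
    ∃ i, p i ∧ ∀ j, p j → i = j ∨ i.LexLT j := by
  classical
  obtain ⟨i, hi⟩ := h
  obtain ⟨i, hi, hmin⟩ := Finset.exists_min_image (Finset.univ.filter p) (fun j => toLex j.1)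
    ⟨i, by simpa using hi⟩
  refine ⟨i, by simpa using hi, fun j hj => ?_⟩
  rcases i.lexLT_trichotomy j with h | h | h
  · exact Or.inr h
  · exact Or.inl h
  · exact absurd h (not_lt.2 (hmin j (by simpa using hj)))

end KLRW
end

/-! ### Weights and degrees of standard modules. -/

noncomputable section

namespace KLRW

theorem run_eq_append {k m : ℕ} {L1 : List (ℕ × Bool)} {b a : ℕ × Bool} {L2 : List (ℕ × Bool)}
    (hm : m ≤ k) (h : run k m = L1 ++ b :: a :: L2) : a.1 + 1 = b.1 := by
  induction m generalizing k L1 with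
  | zero => simp [run] at h
  | succ m ih =>
    cases L1 with
    | nil =>
      cases m with
      | zero => simp [run] at h
      | succ m =>
        simp only [run, List.nil_append, List.cons.injEq] at h
        rw [← h.1, ← h.2.1]
        dsimp only; omega
    | cons c L1 =>
      simp only [run, List.cons_append, List.cons.injEq] at h
      exact ih (by omega) h.2

/-- Inside a segment, the letters decrease by one. -/
theorem flat_descent {S : List (ℕ × ℕ)} (hS : ∀ c ∈ S, c.2 < c.1) {L1 : List (ℕ × Bool)}
    {b : ℕ × Bool} {a : ℕ} {L2 : List (ℕ × Bool)} (h : flat S = L1 ++ b :: (a, false) :: L2) :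
    a + 1 = b.1 := by
  induction S generalizing L1 b with
  | nil => simp [flat] at h
  | cons c S ih =>
    have hc := hS c (by simp)
    have hS' : ∀ c ∈ S, c.2 < c.1 := fun d hd => hS d (by simp [hd])
    have key : ∀ L1 : List (ℕ × Bool), ∀ b : ℕ × Bool,
        run (c.1 - 1) c.2 ++ flat S = L1 ++ b :: (a, false) :: L2 → a + 1 = b.1 := by
      intro L1 b h
      rcases List.append_eq_append_iff.1 h with ⟨K, h1, h2⟩ | ⟨K, h1, h2⟩
      · exact ih hS' h2
      · cases K with
        | nil => exact ih hS' (L1 := []) (by simpa using h2.symm)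
        | cons d K =>
          simp only [List.cons_append, List.cons.injEq] at h2
          obtain ⟨rfl, h2⟩ := h2
          cases K with
          | nil =>
            cases S with
            | nil => simp [flat] at h2
            | cons d S => simp [flat] at h2
          | cons d' K =>
            simp only [List.cons_append, List.cons.injEq] at h2
            rw [← h2.1] at h1
            exact run_eq_append (by omega) h1
    cases L1 with
    | nil =>
      simp only [flat, List.nil_append, List.cons.injEq] at h
      obtain ⟨rfl, h⟩ := h
      dsimp only
      cases hs : c.2 with
      | zero =>
        rw [hs] at h
        cases S with
        | nil => simp [flat, run] at h
        | cons d S => simp [flat, run] at h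
      | succ m =>
        rw [hs, run] at h
        simp only [List.cons_append, List.cons.injEq, Prod.mk.injEq, and_true] at h
        omega
    | cons d L1 =>
      simp only [flat, List.cons_append, List.cons.injEq] at h
      exact key L1 b h.2

variable {n : ℕ} {v : Fin n → ℕ}

namespace Pres

variable {A : Type*} [Ring A] [Algebra ℂ A] {P : Pres v A} {G : ℤ → Submodule ℂ A}
  {hG : P.Grading G} {M : Type*} [AddCommGroup M] [Module A M] [Module ℂ M] [IsScalarTower ℂ A M]

variable (P) in
/-- The relations of the generator of a standard module. -/
structure IsHighest (i : Words v) (x : M) : Prop where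
  weight : P.e i • x = x
  Y_smul : ∀ k, P.Y k • x = 0
  cr_smul : ∀ k, i.lab (k + 1) + 1 = i.lab k → P.cr k • x = 0

/-- The case `D = ⊥` with all eigenvalues zero of `smul_mem_sup_span_Sh`: inside a segment the
letters descend by one, so those crossings kill the generator. -/
theorem IsHighest.smul_mem_span {i : Words v} {x : M} (hx : P.IsHighest i x) (hG : P.Grading G)
    {S : List (ℕ × ℕ)} (hS : Lyn n S) (hi : i.Agrees 0 (letters S)) (a : A) :
    a • x ∈ Submodule.span ℂ {z | ∃ t w d, P.Sh 0 (flat S) t w d ∧ z = t • x} := by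
  have ha : a ∈ P.alg 0 := by rw [hG.alg_zero]; trivial
  have := smul_mem_sup_span_Sh 0 (flat S) ⊥ (by
      intro a _ z hz
      rw [Submodule.mem_bot] at hz ⊢
      rw [hz, smul_zero]) x i hx.weight hi 0 (fun k => by simp [hx.Y_smul]) (by
      intro a L' h
      cases S with
      | nil => simp [flat] at h
      | cons c S =>
        simp only [flat, List.cons.injEq] at h
        rw [← h.1]) (by
      intro L1 b a L2 h
      rw [Submodule.mem_bot, zero_add]
      have h1 := flat_descent (fun c hc => (hS.2 c hc).1) h
      refine hx.cr_smul _ ?_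
      rw [letters, h, List.map_append, List.map_cons, List.map_cons] at hi
      have e1 : i.lab L1.length = b.1 := hi.getElem? (by
        rw [List.getElem?_append_right (by simp)]; simp)
      have e2 : i.lab (L1.length + 1) = a := hi.getElem? (by
        rw [List.getElem?_append_right (by simp)]; simp)
      rw [e1, e2, h1]) ha
  simpa using this

/-- A standard module is spanned by homogeneous vectors of larger weight and by homogeneous
vectors of the same weight whose degree is bounded. -/
theorem IsHighest.induction {i : Words v} {x : M} (hx : P.IsHighest i x)
    {ℳ : ℤ → Submodule ℂ M} (hM : hG.Module ℳ) (hx0 : x ∈ ℳ 0)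
    {S : List (ℕ × ℕ)} (hS : Lyn n S) (hi : i.Agrees 0 (letters S)) {U : Submodule ℂ M}
    (h : ∀ (z : M) (d : ℤ) (j : Words v), P.e j • z = z → z ∈ ℳ d →
      (i.Smaller j ∨ (j = i ∧ -2 * ell n S ≤ d ∧ d ≤ 0 ∧ (d = 0 → z = x))) → z ∈ U)
    (a : A) : a • x ∈ U := by
  refine (Submodule.span_le.2 ?_ : _ ≤ U) (hx.smul_mem_span hG hS hi a)
  rintro _ ⟨t, w, d, ht, rfl⟩
  obtain ⟨j, h1, -, h2, h3⟩ := ht.word hG hi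
  have h4 : t • x = (t * P.e i) • x := by rw [mul_smul, hx.weight]
  refine h _ d j ?_ ?_ ?_
  · rw [h4, ← mul_smul, h1, ← mul_assoc, P.e_mul_self]
  · rw [h4]; simpa using hM.smul_mem h3 hx0
  · rcases ht.lyn hS with h5 | ⟨h5, h6, h7, h8⟩
    · exact Or.inl (Words.smaller_of_lt hi h2 h5)
    · refine Or.inr ⟨?_, h6, h7, fun h => by rw [h8 h, one_smul]⟩
      apply Words.lab_ext
      intro k hk
      rw [h5] at h2
      have hl := hi.2
      have hk' : k < (letters S).length := by omega
      rw [hi.getElem? (List.getElem?_eq_getElem hk'), h2.getElem? (List.getElem?_eq_getElem hk')]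

end Pres

/-- A cyclic graded module generated by a vector that satisfies the relations of a standard
module. -/
structure Pres.IsStandard {A : Type*} [Ring A] [Algebra ℂ A] {P : Pres v A}
    {G : ℤ → Submodule ℂ A} (hG : P.Grading G) {M : Type*} [AddCommGroup M] [Module A M]
    [Module ℂ M] (ℳ : ℤ → Submodule ℂ M) (i : Words v) (S : List (ℕ × ℕ)) (x : M) : Prop where
  grading : hG.Module ℳ
  highest : P.IsHighest i x
  mem : x ∈ ℳ 0
  generates : ∀ z : M, ∃ a : A, z = a • x
  lyn : Lyn n S
  agrees : i.Agrees 0 (letters S)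

namespace Pres.IsStandard

variable {A : Type*} [Ring A] [Algebra ℂ A] {P : Pres v A} {G : ℤ → Submodule ℂ A}
  {hG : P.Grading G} {M : Type*} [AddCommGroup M] [Module A M] [Module ℂ M] [IsScalarTower ℂ A M]
  {ℳ : ℤ → Submodule ℂ M} {i : Words v} {S : List (ℕ × ℕ)} {x : M}

/-- The action of an element of the algebra, as a linear map over the complex numbers. -/
def act (A : Type*) [Ring A] [Algebra ℂ A] (M : Type*) [AddCommGroup M] [Module A M] [Module ℂ M]
    [IsScalarTower ℂ A M] (a : A) : M →ₗ[ℂ] M where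
  toFun z := a • z
  map_add' := smul_add a
  map_smul' c z := by
    rw [RingHom.id_apply, ← smul_one_smul A c z, ← smul_one_smul A c (a • z), ← mul_smul, ← mul_smul,
      mul_smul_comm, smul_mul_assoc, mul_one, one_mul]

theorem e_smul_of_smaller (h : IsStandard hG ℳ i S x) {j : Words v} (hj : j.Smaller i) (z : M) :
    P.e j • z = 0 := by
  obtain ⟨a, rfl⟩ := h.generates z
  refine h.highest.induction h.grading h.mem h.lyn h.agrees
    (U := LinearMap.ker (act A M (P.e j))) (fun z d j' h1 h2 h3 => ?_) a
  change P.e j • z = 0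
  refine e_smul_of_ne h1 ?_
  rintro rfl
  rcases h3 with h3 | ⟨rfl, -⟩
  · exact lt_asymm (Words.lexLT_iff.2 h3 : toLex _ < toLex _) (Words.lexLT_iff.2 hj)
  · exact Words.not_lexLT_self _ (Words.lexLT_iff.2 hj)

/-- Among the spanning shuffles only those with word `i` survive the idempotent. The bounds are
stated for projections because the inductive principle requires conditions that define subspaces. -/
theorem comp_e_smul (h : IsStandard hG ℳ i S x) (z : M) (d : ℤ) :
    ((d < -2 * ell n S ∨ 0 < d) → comp h.grading.internal d (P.e i • z) = 0) ∧
    (d = 0 → comp h.grading.internal d (P.e i • z) ∈ Submodule.span ℂ {x}) := by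
  obtain ⟨a, rfl⟩ := h.generates z
  have key : ∀ W : Submodule ℂ M, (∀ (z : M) (d' : ℤ), z ∈ ℳ d' → -2 * ell n S ≤ d' → d' ≤ 0 →
      (d' = 0 → z = x) → comp h.grading.internal d z ∈ W) →
      comp h.grading.internal d (P.e i • a • x) ∈ W := by
    intro W hW
    refine h.highest.induction h.grading h.mem h.lyn h.agrees
      (U := W.comap (comp h.grading.internal d ∘ₗ act A M (P.e i))) (fun z d j' h1 h2 h3 => ?_) a
    change comp h.grading.internal _ (P.e i • z) ∈ W
    rcases h3 with h3 | ⟨rfl, h4, h5, h6⟩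
    · rw [e_smul_of_ne h1, map_zero]
      · exact W.zero_mem
      · rintro rfl
        exact Words.not_lexLT_self _ (Words.lexLT_iff.2 h3)
    · rw [h1]
      exact hW z d h2 h4 h5 h6
  refine ⟨fun hd => ?_, fun hd => ?_⟩
  · rw [← Submodule.mem_bot ℂ]
    refine key ⊥ fun z d' h1 h2 h3 _ => ?_
    rw [comp_of_mem _ h1, if_neg (by omega)]
    exact zero_mem _
  · refine key _ fun z d' h1 h2 h3 h4 => ?_
    rw [comp_of_mem _ h1]
    split_ifs with hd'
    · rw [h4 (by omega)]; exact Submodule.mem_span_singleton_self x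
    · exact zero_mem _

theorem degree_bounds (h : IsStandard hG ℳ i S x) {z : M} {d : ℤ} (hz : P.e i • z = z)
    (hd : z ∈ ℳ d) (hz0 : z ≠ 0) : -2 * ell n S ≤ d ∧ d ≤ 0 := by
  have := (h.comp_e_smul z d).1
  rw [hz, comp_of_mem _ hd, if_pos rfl] at this
  by_contra hh
  exact hz0 (this (by omega))

theorem mem_span_of_degree_zero (h : IsStandard hG ℳ i S x) {z : M} (hz : P.e i • z = z)
    (hd : z ∈ ℳ 0) : ∃ c : ℂ, z = c • x := by
  have := (h.comp_e_smul z 0).2 rfl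
  rw [hz, comp_of_mem _ hd, if_pos rfl, Submodule.mem_span_singleton] at this
  obtain ⟨c, hc⟩ := this
  exact ⟨c, hc.symm⟩

/-- A standard module is finite dimensional, and its degrees are bounded. -/
theorem finite (h : IsStandard hG ℳ i S x) : Module.Finite ℂ M ∧ ∃ N, ∀ d > N, ℳ d = ⊥ := by
  have hfin := finite_Sh (P := P) 0 (flat S)
  have hspan : ∀ U : Submodule ℂ M, (∀ t w d, P.Sh 0 (flat S) t w d → t • x ∈ U) → U = ⊤ := by
    intro U hU
    rw [eq_top_iff]
    rintro z -
    obtain ⟨a, rfl⟩ := h.generates z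
    refine (Submodule.span_le.2 ?_ : _ ≤ U) (h.highest.smul_mem_span hG h.lyn h.agrees a)
    rintro _ ⟨t, w, d, ht, rfl⟩
    exact hU t w d ht
  constructor
  · refine ⟨⟨(hfin.image fun y => y.1 • x).toFinset, hspan _ fun t w d ht => ?_⟩⟩
    refine Submodule.subset_span ?_
    rw [Set.Finite.coe_toFinset]
    exact ⟨(t, d), ⟨w, ht⟩, rfl⟩
  · obtain ⟨N, hN⟩ := (hfin.image Prod.snd).bddAbove
    refine ⟨N, fun d hd => ?_⟩
    have h1 : LinearMap.ker (comp h.grading.internal d) = ⊤ := by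
      refine hspan _ fun t w d' ht => ?_
      obtain ⟨j, -, -, -, h3⟩ := ht.word hG h.agrees
      have h4 : t • x = (t * P.e i) • x := by rw [mul_smul, h.highest.weight]
      have h5 := h.grading.smul_mem h3 h.mem
      rw [← h4, add_zero] at h5
      have h6 : d' ≤ N := hN ⟨(t, d'), ⟨w, ht⟩, rfl⟩
      rw [LinearMap.mem_ker, comp_of_mem _ h5, if_neg (by omega)]
    rw [Submodule.eq_bot_iff]
    intro z hz
    have h2 : z ∈ LinearMap.ker (comp h.grading.internal d) := by rw [h1]; trivial
    rwa [LinearMap.mem_ker, comp_of_mem _ hz, if_pos rfl] at h2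

end Pres.IsStandard

end KLRW
end

/-! ### Staircase monomials in the dots at the ends of segments. -/

noncomputable section

namespace KLRW

/-- The position where segment number `r` starts. -/
def segStart (S : List (ℕ × ℕ)) (r : ℕ) : ℕ := (letters (S.take r)).length

theorem length_letters_append (S S' : List (ℕ × ℕ)) :
    (letters (S ++ S')).length = (letters S).length + (letters S').length := by
  simp [letters, flat_append]

theorem length_letters_singleton (c : ℕ × ℕ) : (letters [c]).length = c.2 + 1 := by
  simp [letters, flat, length_run]

theorem segStart_succ {S S' : List (ℕ × ℕ)} {r : ℕ} {c : ℕ × ℕ} (h : S.drop r = c :: S') :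
    segStart S (r + 1) = segStart S r + c.2 + 1 := by
  have hr : r < S.length := by
    by_contra hr
    rw [List.drop_eq_nil_of_le (by omega)] at h
    simp at h
  have h1 : S.take (r + 1) = S.take r ++ [c] := by
    rw [List.take_add_one, ← List.head?_drop, h]; rfl
  rw [segStart, h1, length_letters_append, length_letters_singleton, segStart, add_assoc]

theorem segStart_mono (S : List (ℕ × ℕ)) : Monotone (segStart S) := by
  refine monotone_nat_of_le_succ fun r => ?_
  cases h : S.drop r with
  | nil =>
    have hr := List.drop_eq_nil_iff.1 h
    rw [segStart, segStart, List.take_of_length_le hr, List.take_of_length_le (by omega)]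
  | cons c S' => rw [segStart_succ h]; omega

/-- The number of black segments equal to the first one. -/
def headCount (n : ℕ) : List (ℕ × ℕ) → ℕ
  | [] => 0
  | c :: S => if c.1 = n then 0 else S.count c

theorem ell_eq_sum (n : ℕ) (S : List (ℕ × ℕ)) :
    ell n S = ∑ r ∈ Finset.range S.length, (headCount n (S.drop r) : ℤ) := by
  induction S with
  | nil => simp [ell]
  | cons c S ih =>
    rw [ell, ih, List.length_cons, Finset.sum_range_succ']
    simp [headCount]

/-- Equal black segments are adjacent in an increasing list, so another copy of the first one comes
second. -/
theorem headCount_pos {n : ℕ} {S : List (ℕ × ℕ)} (hS : Lyn n S) (h : 0 < headCount n S) :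
    ∃ c S', S = c :: c :: S' ∧ c.1 < n ∧ headCount n S = headCount n (c :: S') + 1 := by
  cases S with
  | nil => simp [headCount] at h
  | cons c S =>
    have hc := hS.2 c (by simp)
    by_cases hn : c.1 = n
    · simp [headCount, hn] at h
    cases S with
    | nil => simp [headCount] at h
    | cons d S =>
      have hd : d = c := by
        simp only [headCount, if_neg hn] at h
        by_contra hdc
        rw [List.count_cons_of_ne hdc] at h
        have hmem := List.count_pos_iff.1 h
        have h1 := (List.pairwise_cons.1 hS.1).1 d (by simp)
        have h2 := (List.pairwise_cons.1 hS.tail.1).1 c hmem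
        unfold SegLE at h1 h2
        exact hdc (Prod.ext (by omega) (by omega))
      subst hd
      exact ⟨d, S, rfl, by omega, by simp [headCount, hn]⟩

variable {n : ℕ} {v : Fin n → ℕ}

namespace Pres

variable {A : Type*} [Ring A] [Algebra ℂ A] (P : Pres v A)

/-- The dot at the end of segment number `r`. -/
def segDot (S : List (ℕ × ℕ)) (r : ℕ) : A := P.Y (segStart S (r + 1) - 1)

/-- A monomial in the dots at the ends of the first `p` segments. -/
def dotMonomial (S : List (ℕ × ℕ)) (a : ℕ → ℕ) : ℕ → A
  | 0 => 1
  | p + 1 => dotMonomial S a p * P.segDot S p ^ a p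

theorem dotMonomial_congr (S : List (ℕ × ℕ)) {a b : ℕ → ℕ} {p : ℕ} (h : ∀ r < p, a r = b r) :
    P.dotMonomial S a p = P.dotMonomial S b p := by
  induction p with
  | zero => rfl
  | succ p ih => rw [dotMonomial, dotMonomial, ih fun r hr => h r (by omega), h p (by omega)]

variable {P}

theorem segDot_comm (S : List (ℕ × ℕ)) (r t : ℕ) :
    Commute (P.segDot S r) (P.segDot S t) := P.Y_mul_Y _ _

theorem segDot_comm_dotMonomial (S : List (ℕ × ℕ)) (r : ℕ) (a : ℕ → ℕ) (p : ℕ) :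
    Commute (P.segDot S r) (P.dotMonomial S a p) := by
  induction p with
  | zero => exact Commute.one_right _
  | succ p ih => exact ih.mul_right ((segDot_comm S r p).pow_right _)

theorem dotMonomial_succ_exponent (S : List (ℕ × ℕ)) {a b : ℕ → ℕ} {p q : ℕ} (hq : q < p)
    (h : ∀ r, r ≠ q → a r = b r) (hab : a q = b q + 1) :
    P.dotMonomial S a p = P.segDot S q * P.dotMonomial S b p := by
  induction p with
  | zero => omega
  | succ p ih =>
    rcases Nat.lt_succ_iff_lt_or_eq.1 hq with hq' | rfl
    · rw [dotMonomial, ih hq', dotMonomial, h p (by omega), mul_assoc]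
    · rw [dotMonomial, dotMonomial, hab, dotMonomial_congr P S (b := b) fun r hr => h r (by omega),
        pow_succ', ← mul_assoc, ← (segDot_comm_dotMonomial S q b q).eq, mul_assoc]

variable {M : Type*} [AddCommGroup M] [Module A M] {i : Words v}

theorem e_smul_dotMonomial {u : M} (hu : P.e i • u = u) (S : List (ℕ × ℕ)) (a : ℕ → ℕ) (p : ℕ) :
    P.e i • P.dotMonomial S a p • u = P.dotMonomial S a p • u := by
  have h1 : ∀ r, Commute (P.e i) (P.segDot S r) := fun r => (P.Y_mul_e _ i).symm
  have h2 : Commute (P.e i) (P.dotMonomial S a p) := by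
    induction p with
    | zero => exact Commute.one_right _
    | succ p ih => exact ih.mul_right ((h1 p).pow_right _)
  rw [comm_smul h2.eq, hu]

variable (P) in
/-- The exchange of the segments `r` and `r + 1`, which are equal to `c`. -/
def segSwap (S : List (ℕ × ℕ)) (r : ℕ) (c : ℕ × ℕ) : A := P.Phi c.2 (segStart S r)

section swaps

variable {S : List (ℕ × ℕ)} (hS : Lyn n S) (hi : i.Agrees 0 (letters S))

include hi in
theorem run_of_drop {S' : List (ℕ × ℕ)} {r : ℕ} {c : ℕ × ℕ} (h : S.drop r = c :: S')
    (hc : c.2 < c.1) : i.Run (segStart S r) c.1 c.2 := by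
  refine ⟨hc, fun t ht => ?_⟩
  have h1 : letters S = letters (S.take r) ++ ((run c.1 (c.2 + 1)).map Prod.fst ++ letters S') := by
    rw [← letters_cons, ← h]
    simp only [letters]
    rw [← List.map_append, ← flat_append, List.take_append_drop]
  rw [h1] at hi
  have := hi.run (t := t) (by omega)
  rw [segStart, this]; omega

theorem drop_succ_of_drop {S' : List (ℕ × ℕ)} {r : ℕ} {c : ℕ × ℕ} (h : S.drop r = c :: S') :
    S.drop (r + 1) = S' := by
  rw [← List.drop_drop, h]; rfl

include hS hi in
theorem run_two {S' : List (ℕ × ℕ)} {r : ℕ} {c : ℕ × ℕ} (h : S.drop r = c :: c :: S') :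
    i.Run (segStart S r) c.1 c.2 ∧ i.Run (segStart S r + c.2 + 1) c.1 c.2 := by
  have hc := hS.2 c (List.mem_of_mem_drop (i := r) (by rw [h]; simp))
  have h1 := run_of_drop hi (drop_succ_of_drop h) hc.1
  rw [segStart_succ h] at h1
  exact ⟨run_of_drop hi h hc.1, h1⟩

theorem segSwap_comm_segDot {S' : List (ℕ × ℕ)} {r t : ℕ} {c : ℕ × ℕ}
    (h : S.drop r = c :: c :: S') (ht : t < S.length) (h1 : t ≠ r) (h2 : t ≠ r + 1) :
    Commute (P.segSwap S r c) (P.segDot S t) := by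
  have e1 := segStart_succ h
  have e2 := segStart_succ (drop_succ_of_drop h)
  obtain ⟨d, S'', h3⟩ : ∃ d S'', S.drop t = d :: S'' := by
    cases h4 : S.drop t with
    | nil => rw [List.drop_eq_nil_iff] at h4; omega
    | cons d S'' => exact ⟨d, S'', rfl⟩
  have e3 := segStart_succ h3
  refine (Y_mul_Phi ?_).symm
  rcases Nat.lt_or_gt_of_ne h1 with h4 | h4
  · have := segStart_mono S (show t + 1 ≤ r by omega)
    omega
  · have := segStart_mono S (show r + 1 + 1 ≤ t by omega)
    omega

variable (hmin : ∀ j : Words v, j.Smaller i → ∀ x : M, P.e j • x = 0)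

include hS hi hmin in
theorem segSwap_relations {S' : List (ℕ × ℕ)} {r : ℕ} {c : ℕ × ℕ} (h : S.drop r = c :: c :: S')
    (hc : c.1 < n) {u : M} (hu : P.e i • u = u) :
    P.e i • P.segSwap S r c • u = P.segSwap S r c • u ∧
    P.segSwap S r c • P.segDot S r • u = P.segDot S (r + 1) • P.segSwap S r c • u + u ∧
    P.segDot S r • P.segSwap S r c • u = P.segSwap S r c • P.segDot S (r + 1) • u + u := by
  obtain ⟨h1, h2⟩ := run_two hS hi h
  have e1 := segStart_succ h
  have e2 := segStart_succ (drop_succ_of_drop h)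
  obtain ⟨i1, i2, i3, -⟩ := (twoSegments_of_minimal hmin hu h1 h2 hc).phi
  rw [segDot, segDot, e2, e1, show segStart S r + c.2 + 1 - 1 = segStart S r + c.2 by omega,
    show segStart S r + c.2 + 1 + c.2 + 1 - 1 = segStart S r + 2 * c.2 + 1 by omega]
  exact ⟨i1, i2, i3⟩

include hS hi hmin in
-- As the exponents at `r` and `r + 1` agree, these two dots enter only through powers of their
-- product, which commutes with the exchange by the nilHecke relations. The other dots commute with
-- it anyway.
theorem segSwap_comm_dotMonomial {S' : List (ℕ × ℕ)} {r : ℕ} {c : ℕ × ℕ}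
    (h : S.drop r = c :: c :: S') (hc : c.1 < n) {a : ℕ → ℕ} (ha : a r = a (r + 1)) {p : ℕ}
    (hp : r + 1 < p) (hp' : p ≤ S.length) {u : M} (hu : P.e i • u = u) :
    P.segSwap S r c • P.dotMonomial S a p • u = P.dotMonomial S a p • P.segSwap S r c • u := by
  have hdot : ∀ r, ∀ u : M, P.e i • u = u → P.e i • P.segDot S r • u = P.segDot S r • u :=
    fun r u hu => e_Y_smul hu _
  have hpow : ∀ r m, ∀ u : M, P.e i • u = u →
      P.e i • P.segDot S r ^ m • u = P.segDot S r ^ m • u := by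
    intro r m u hu
    induction m with
    | zero => simpa using hu
    | succ m ih => rw [pow_succ', mul_smul, hdot _ _ ih]
  obtain ⟨p, rfl⟩ := Nat.exists_eq_add_of_lt hp
  induction p generalizing u with
  | zero =>
    have h1 : Commute (P.segSwap S r c) (P.dotMonomial S a r) := by
      have : ∀ q ≤ r, Commute (P.segSwap S r c) (P.dotMonomial S a q) := by
        intro q hq
        induction q with
        | zero => exact Commute.one_right _
        | succ q ih =>
          exact (ih (by omega)).mul_right
            ((segSwap_comm_segDot h (by omega) (by omega) (by omega)).pow_right _)
      exact this r le_rfl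
    have h2 : ∀ u : M, P.e i • u = u →
        P.segSwap S r c • P.segDot S r • P.segDot S (r + 1) • u =
        P.segDot S r • P.segDot S (r + 1) • P.segSwap S r c • u := by
      intro u hu
      obtain ⟨i1, i2, i3⟩ := segSwap_relations hS hi hmin h hc hu
      rw [(segSwap_relations hS hi hmin h hc (hdot (r + 1) u hu)).2.1,
        comm_smul (segDot_comm S r (r + 1)).eq, i3, smul_add]
    have h3 : ∀ m, ∀ u : M, P.e i • u = u →
        P.segSwap S r c • (P.segDot S r * P.segDot S (r + 1)) ^ m • u =
        (P.segDot S r * P.segDot S (r + 1)) ^ m • P.segSwap S r c • u := by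
      intro m
      induction m with
      | zero => simp
      | succ m ih =>
        intro u hu
        rw [pow_succ, mul_smul, ih _ (by rw [mul_smul, hdot _ _ (hdot _ _ hu)]), mul_smul, h2 u hu,
          mul_smul, mul_smul]
    rw [show r + 1 + 0 + 1 = r + 1 + 1 by ring, dotMonomial, dotMonomial, ← ha, mul_assoc,
      ← (segDot_comm S r (r + 1)).mul_pow, mul_smul, mul_smul, comm_smul h1.eq, h3 _ _ hu]
  | succ p ih =>
    have h1 := (segSwap_comm_segDot (P := P) h (t := r + 1 + p + 1) (by omega) (by omega)
      (by omega)).pow_right (a (r + 1 + p + 1))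
    rw [show r + 1 + (p + 1) + 1 = r + 1 + p + 1 + 1 by ring, dotMonomial, mul_smul, mul_smul,
      ih (hpow _ _ _ hu) (by omega) (by omega), comm_smul h1.eq]

/-- The exponents at a stage of the construction of the staircase monomial. -/
def stairs (n : ℕ) (S : List (ℕ × ℕ)) (h q r : ℕ) : ℕ :=
  min (if r < q then h + 1 else h) (headCount n (S.drop r))

include hS hi hmin in
-- The exponents in a group of `m` equal black segments grow to `m - 1, …, 1, 0`. They are built up
-- row by row, raising one exponent at a time, so that each step only concerns one exchange.
theorem stairs_smul_ne_zero {u : M} (hu : P.e i • u = u) (hu0 : u ≠ 0)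
    (hswap : ∀ r c S', S.drop r = c :: c :: S' → c.1 < n → P.segSwap S r c • u = 0) (h q : ℕ)
    (hq : q ≤ S.length) : P.dotMonomial S (stairs n S h q) S.length • u ≠ 0 := by
  have hstep : ∀ h q, q < S.length → P.dotMonomial S (stairs n S h q) S.length • u ≠ 0 →
      P.dotMonomial S (stairs n S h (q + 1)) S.length • u ≠ 0 := by
    intro h q hq hne
    by_cases hcount : headCount n (S.drop q) ≤ h
    · rwa [dotMonomial_congr P S (b := stairs n S h q)]
      intro r _
      unfold stairs
      by_cases hrq : r = q
      · subst hrq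
        rw [if_pos (by omega), if_neg (by omega)]; omega
      · by_cases hr : r < q
        · rw [if_pos (by omega), if_pos hr]
        · rw [if_neg (by omega), if_neg hr]
    · have hdrop : Lyn n (S.drop q) :=
        ⟨hS.1.sublist (List.drop_sublist q S), fun c hc => hS.2 c (List.mem_of_mem_drop hc)⟩
      obtain ⟨c, S', h1, h2, h3⟩ := headCount_pos hdrop (by omega)
      have h4 := drop_succ_of_drop h1
      have hlen : q + 1 < S.length := by
        by_contra hlen
        rw [List.drop_eq_nil_of_le (by omega)] at h4
        simp at h4
      have e1 : P.dotMonomial S (stairs n S h (q + 1)) S.length =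
          P.segDot S q * P.dotMonomial S (stairs n S h q) S.length := by
        refine dotMonomial_succ_exponent S hq (fun r hr => ?_) ?_
        · unfold stairs
          by_cases hr : r < q
          · rw [if_pos (by omega), if_pos hr]
          · rw [if_neg (by omega), if_neg hr]
        · unfold stairs
          rw [if_pos (by omega), if_neg (by omega)]; omega
      have e2 : stairs n S h q q = stairs n S h q (q + 1) := by
        unfold stairs
        rw [if_neg (by omega), if_neg (by omega), h4]; omega
      -- The exponents at `q` and `q + 1` are both `h`, so the exchange commutes with the old
      -- monomial and kills its value at `u`. By the nilHecke relation it maps the value of the new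
      -- monomial to that of the old one, which is nonzero.
      have e3 := segSwap_comm_dotMonomial hS hi hmin h1 h2 e2 hlen le_rfl hu
      have e4 := (segSwap_relations hS hi hmin h1 h2
        (e_smul_dotMonomial hu S (stairs n S h q) S.length)).2.1
      rw [e3, hswap q c S' h1 h2, smul_zero, smul_zero, zero_add] at e4
      intro h0
      rw [e1, mul_smul] at h0
      rw [h0, smul_zero] at e4
      exact hne e4.symm
  have hrow : ∀ h, P.dotMonomial S (stairs n S h 0) S.length • u ≠ 0 →
      ∀ q ≤ S.length, P.dotMonomial S (stairs n S h q) S.length • u ≠ 0 := by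
    intro h h0 q
    induction q with
    | zero => exact fun _ => h0
    | succ q ih => exact fun hq => hstep h q (by omega) (ih (by omega))
  refine hrow h ?_ q hq
  clear hq q
  induction h with
  | zero =>
    have : ∀ p, P.dotMonomial S (stairs n S 0 0) p = 1 := by
      intro p
      induction p with
      | zero => rfl
      | succ p ih => rw [dotMonomial, ih]; simp [stairs]
    rw [this, one_smul]
    exact hu0
  | succ h ih =>
    have := hrow h ih S.length le_rfl
    rwa [dotMonomial_congr P S (b := stairs n S (h + 1) 0)] at this
    intro r hr
    unfold stairs
    rw [if_pos hr, if_neg (by omega)]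

end swaps

end Pres

end KLRW
end

/-! ### Vectors of smallest weight generate; the unique maximal submodule. -/

noncomputable section

namespace KLRW

variable {n : ℕ} {v : Fin n → ℕ}

namespace Pres

variable {A : Type*} [Ring A] [Algebra ℂ A] {P : Pres v A} {G : ℤ → Submodule ℂ A}

theorem Grading.D_mem (hG : P.Grading G) (p m : ℕ) (i : Words v) (h : p + m < size v) :
    P.D p m * P.e i ∈ G (((List.range' (p + 1) m).map fun t => cdeg (i.lab p) (i.lab t)).sum) := by
  induction m with
  | zero => simpa [D] using hG.e_mem i
  | succ m ih =>
    have h1 := hG.mul_mem (hG.cr_mem (p + m) (i.vm p m)) (ih (by omega))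
    have h2 : P.D p (m + 1) * P.e i = P.cr (p + m) * P.e (i.vm p m) * (P.D p m * P.e i) := by
      rw [P.D_mul_e p m i, mul_assoc (P.cr _), ← mul_assoc (P.e _) (P.e _), P.e_mul_self,
        ← P.D_mul_e, D_succ, mul_assoc]
    obtain ⟨g1, -, g3⟩ := i.lab_vm (p := p) (m := m) (by omega)
    rw [h2, List.range'_1_concat, List.map_append, List.sum_append]
    simp only [List.map_cons, List.map_nil, List.sum_cons, List.sum_nil, add_zero]
    rw [Words.cd, g1, g3 _ (by omega), add_comm] at h1
    rwa [show p + 1 + m = p + m + 1 by ring]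

theorem sum_cdeg_far {i : Words v} {p k s : ℕ} (h : ∀ t < s, i.lab (p + t) + 1 < k) :
    ((List.range' p s).map fun t => cdeg (i.lab t) k).sum = 0 := by
  refine List.sum_eq_zero fun x hx => ?_
  obtain ⟨t, ht, rfl⟩ := List.mem_map.1 hx
  rw [List.mem_range'_1] at ht
  obtain ⟨t, rfl⟩ := Nat.exists_eq_add_of_le ht.1
  have := h t (by omega)
  rw [cdeg, if_neg (by omega), if_neg (by omega)]

/-- Fetching the head past an equal letter and its neighbour has degree `-2 + 1`, returning the
other head past a neighbour has degree `1`, and the exchange of the tails has degree `-2` by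
induction. -/
theorem Grading.Phi_mem (hG : P.Grading G) {i : Words v} {p k s : ℕ} (h1 : i.Run p k s)
    (h2 : i.Run (p + s + 1) k s) : P.Phi s p * P.e i ∈ G (-2) := by
  induction s generalizing p i k with
  | zero =>
    have e1 := h1.2 0 le_rfl
    have e2 := h2.2 0 le_rfl
    simp only [add_zero] at e1 e2
    have := hG.cr_mem p i
    rwa [Words.cd, e1, e2, cdeg_self] at this
  | succ s ih =>
    have hs := h1.1
    have e0 := h1.2 0 (by omega)
    have e1 := h1.2 1 (by omega)
    have e2 : i.lab (p + s + 2) = k := h2.2 0 (by omega)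
    simp only [add_zero] at e0
    have hp : p + s + 2 < size v := lt_of_lab_eq e2 (by omega)
    obtain ⟨g1, g2, g3⟩ := i.lab_mv (p := p) (m := s + 2) (by omega)
    have hC : P.C p (s + 2) * P.e i ∈ G (-1) := by
      have := hG.C_mem p (s + 2) i
      rw [show p + (s + 2) = p + s + 2 by ring, e2, List.range'_succ, List.range'_succ,
        List.map_cons, List.map_cons, List.sum_cons, List.sum_cons, sum_cdeg_far, e0, cdeg_self,
        cdeg_adj (by omega)] at this
      · exact this
      · intro t ht
        have := h1.2 (t + 2) (by omega)
        rw [show p + (t + 2) = p + 1 + 1 + t by ring] at this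
        omega
    have hD : P.D (p + 1) (s + 1) * P.e (i.mv p (s + 2)) ∈ G 1 := by
      have := hG.D_mem (p + 1) (s + 1) (i.mv p (s + 2)) (by omega)
      have f0 := g2 0 (by omega)
      simp only [add_zero] at f0
      have f1 := g2 1 (by omega)
      simp only [cdeg_comm ((i.mv p (s + 2)).lab (p + 1))] at this
      rw [f0, e0, List.range'_succ, List.map_cons, List.sum_cons, f1, cdeg_adj (by omega),
        sum_cdeg_far] at this
      · exact this
      · intro t ht
        rw [show p + 1 + 1 + 1 + t = p + 1 + (t + 2) by ring, g2 _ (by omega)]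
        have := h1.2 (t + 2) (by omega)
        omega
    have hPhi := ih (h1.mv h2).1 (h1.mv h2).2
    have h := Submodule.neg_mem _ (hG.mul_mem (hG.mul_mem hD hPhi) hC)
    have heq : P.Phi (s + 1) p * P.e i = -(P.D (p + 1) (s + 1) * P.e (i.mv p (s + 2)) *
        (P.Phi s (p + 2) * P.e (i.mv p (s + 2))) * (P.C p (s + 2) * P.e i)) := by
      have e5 := P.e_mul_self (i.mv p (s + 2))
      have e6 := Phi_mul_e (P := P) (h1.mv h2).1 (h1.mv h2).2
      have e7 := P.C_mul_e p (s + 2) i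
      generalize P.e (i.mv p (s + 2)) = E at *
      have e8 : E * (P.Phi s (p + 2) * E) = P.Phi s (p + 2) * E := by
        rw [e6, ← mul_assoc, e5]
      have e9 : E * (P.C p (s + 2) * P.e i) = P.C p (s + 2) * P.e i := by
        rw [e7, ← mul_assoc, e5]
      rw [mul_assoc (P.D _ _) E, e8, mul_assoc (P.D _ _), mul_assoc (P.Phi _ _), e9, Phi]
      simp only [neg_mul, mul_assoc]
    rw [heq]
    exact h

theorem Grading.dotMonomial_mem (hG : P.Grading G) (S : List (ℕ × ℕ)) (a : ℕ → ℕ) (p : ℕ) :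
    P.dotMonomial S a p ∈ G (2 * ∑ r ∈ Finset.range p, (a r : ℤ)) := by
  induction p with
  | zero => simpa [dotMonomial] using hG.one_mem
  | succ p ih =>
    have h : ∀ m : ℕ, P.segDot S p ^ m ∈ G (2 * m) := by
      intro m
      induction m with
      | zero => simpa using hG.one_mem
      | succ m ih =>
        rw [pow_succ]
        have := hG.mul_mem ih (hG.Y_mem (segStart S (p + 1) - 1))
        push_cast
        rwa [mul_add, mul_one]
    rw [dotMonomial, Finset.sum_range_succ, mul_add]
    exact hG.mul_mem ih (h _)

end Pres

namespace Pres.IsStandard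

variable {A : Type*} [Ring A] [Algebra ℂ A] {P : Pres v A} {G : ℤ → Submodule ℂ A}
  {hG : P.Grading G} {M : Type*} [AddCommGroup M] [Module A M] [Module ℂ M] [IsScalarTower ℂ A M]
  {ℳ : ℤ → Submodule ℂ M} {i : Words v} {S : List (ℕ × ℕ)} {x : M}

/-- A nonzero homogeneous vector of minimal weight generates a standard module. -/
theorem exists_smul_eq_of_mem (h : IsStandard hG ℳ i S x) {z : M} {d : ℤ} (hz : P.e i • z = z)
    (hd : z ∈ ℳ d) (hz0 : z ≠ 0) : ∃ a ∈ G (-d), a • z = x := by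
  have hmin : ∀ j : Words v, j.Smaller i → ∀ x : M, P.e j • x = 0 :=
    fun j hj x => h.e_smul_of_smaller hj x
  obtain ⟨N, hN⟩ : ∃ N : ℕ, N = (d + 2 * ell n S).toNat := ⟨_, rfl⟩
  -- An exchange lowers the degree by `2`, and the degrees of weight `i` are at least `-2 * ell n
  -- S`, so only finitely many exchanges are possible.
  induction N using Nat.strong_induction_on generalizing z d with
  | _ N ih =>
    have hb := h.degree_bounds hz hd hz0
    by_cases hswap : ∀ r c S', S.drop r = c :: c :: S' → c.1 < n → P.segSwap S r c • z = 0
    -- At a height `b` above all values of `headCount` the staircase is complete, and its degree is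
    -- `2 * ell n S`.
    · obtain ⟨b, hbound⟩ : ∃ b, ∀ r ∈ Finset.range S.length, headCount n (S.drop r) ≤ b :=
        ⟨_, fun r hr => Finset.le_sup (f := fun r => headCount n (S.drop r)) hr⟩
      have hne := stairs_smul_ne_zero h.lyn h.agrees hmin hz hz0 hswap b 0 (Nat.zero_le _)
      have heq : P.dotMonomial S (stairs n S b 0) S.length =
          P.dotMonomial S (fun r => headCount n (S.drop r)) S.length := by
        refine dotMonomial_congr P S fun r hr => ?_
        unfold stairs
        rw [if_neg (by omega)]
        exact min_eq_right (hbound r (Finset.mem_range.2 hr))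
      rw [heq] at hne
      have hmem := hG.dotMonomial_mem S (fun r => headCount n (S.drop r)) S.length
      rw [← ell_eq_sum] at hmem
      have hw := e_smul_dotMonomial hz S (fun r => headCount n (S.drop r)) S.length
      have hmem' := h.grading.smul_mem hmem hd
      have hb' := h.degree_bounds hw hmem' hne
      -- The lower bound is applied to `z`, and the upper bound to its nonzero image in degree `d +
      -- 2 * ell n S`.
      have hd' : d = -(2 * ell n S) := by omega
      rw [hd', add_neg_cancel] at hmem'
      obtain ⟨c, hc⟩ := h.mem_span_of_degree_zero hw hmem'
      have hc0 : c ≠ 0 := by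
        rintro rfl
        rw [zero_smul] at hc
        exact hne hc
      refine ⟨c⁻¹ • P.dotMonomial S (fun r => headCount n (S.drop r)) S.length,
        Submodule.smul_mem _ _ ?_, ?_⟩
      · rwa [hd', neg_neg]
      · rw [smul_assoc, hc, smul_smul, inv_mul_cancel₀ hc0, one_smul]
    · push Not at hswap
      obtain ⟨r, c, S', h1, h2, h3⟩ := hswap
      obtain ⟨r1, r2⟩ := run_two h.lyn h.agrees h1
      have hPhi := hG.Phi_mem r1 r2
      have hz' : P.segSwap S r c • z = (P.Phi c.2 (segStart S r) * P.e i) • z := by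
        rw [mul_smul, hz]; rfl
      have hw := (segSwap_relations h.lyn h.agrees hmin h1 h2 hz).1
      have hd' : P.segSwap S r c • z ∈ ℳ (-2 + d) := by
        rw [hz']; exact h.grading.smul_mem hPhi hd
      have hb' := h.degree_bounds hw hd' h3
      obtain ⟨a, ha, hax⟩ := ih (-2 + d + 2 * ell n S).toNat (by omega) hw hd' h3 rfl
      refine ⟨a * (P.Phi c.2 (segStart S r) * P.e i), ?_, ?_⟩
      · have := hG.mul_mem ha hPhi
        rwa [show -(-2 + d) + -2 = -d by ring] at this
      · rw [mul_smul, ← hz', hax]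

/-- A nonzero vector of minimal weight generates a standard module. -/
theorem exists_smul_eq (h : IsStandard hG ℳ i S x) {z : M} (hz : P.e i • z = z) (hz0 : z ≠ 0) :
    ∃ a : A, a • z = x := by
  classical
  have hI := h.grading.internal
  have hcw : ∀ d, P.e i • comp hI d z = comp hI d z := by
    intro d
    have := h.grading.comp_smul (hG.e_mem i) z d
    rw [zero_add, hz] at this
    exact this.symm
  have hfin := finite_comp hI z
  have hne : hfin.toFinset.Nonempty := by
    by_contra hne
    rw [Finset.not_nonempty_iff_eq_empty] at hne
    refine hz0 (eq_zero_of_comp hI fun d => ?_)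
    by_contra hd
    have : d ∈ hfin.toFinset := by simpa using hd
    rw [hne] at this
    simp at this
  set d := hfin.toFinset.min' hne with hdef
  have hd : comp hI d z ≠ 0 := by
    have := hfin.toFinset.min'_mem hne
    simpa using this
  -- Here `d` is the lowest degree that occurs in `z`. An element of degree `-d` takes that
  -- component to the generator; the other components land in positive degrees, where weight `i`
  -- does not occur.
  obtain ⟨a, ha, hax⟩ := h.exists_smul_eq_of_mem (hcw d) (comp_mem hI d z) hd
  have hea : P.e i * a ∈ G (-d) := mem_idem_mul_of_mem hG ha i
  refine ⟨P.e i * a, ?_⟩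
  obtain ⟨s, hs⟩ := exists_sum_comp hI ((P.e i * a) • z)
  rw [hs (insert 0 s) (Finset.subset_insert _ _), Finset.sum_eq_single 0]
  · have := h.grading.comp_smul hea z d
    rw [neg_add_cancel] at this
    rw [this, mul_smul, hax, h.highest.weight]
  · intro d' _ hd'
    by_contra hne'
    have h1 := h.grading.comp_smul hea z (d' + d)
    rw [show -d + (d' + d) = d' by ring] at h1
    have h2 : comp hI (d' + d) z ≠ 0 := by
      intro h0
      rw [h0, smul_zero] at h1
      exact hne' h1
    have h3 : d ≤ d' + d := hfin.toFinset.min'_le _ (by simpa using h2)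
    have h4 : P.e i • comp hI d' ((P.e i * a) • z) = comp hI d' ((P.e i * a) • z) := by
      rw [h1, mul_smul, ← mul_smul, P.e_mul_self]
    have h5 := h.degree_bounds h4 (comp_mem hI _ _) hne'
    omega
  · intro h0; exact absurd (Finset.mem_insert_self 0 s) h0

/-- The vectors that generate a submodule without vectors of minimal weight. -/
def radical (P : Pres v A) (M : Type*) [AddCommGroup M] [Module A M] (i : Words v) :
    Submodule A M where
  carrier := {z | ∀ a : A, P.e i • a • z = 0}
  zero_mem' a := by rw [smul_zero, smul_zero]
  add_mem' hx hy a := by rw [smul_add, smul_add, hx a, hy a, add_zero]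
  smul_mem' b z hz a := by rw [← mul_smul a b]; exact hz _

/-- A submodule with a nonzero vector of weight `i` contains the generator. -/
theorem le_radical_or_eq_top (h : IsStandard hG ℳ i S x) (N : Submodule A M) :
    N ≤ radical P M i ∨ N = ⊤ := by
  by_contra! hN
  obtain ⟨z, hzN, hz⟩ := SetLike.not_le_iff_exists.1 hN.1
  have : ∃ a : A, P.e i • a • z ≠ 0 := by
    by_contra! h0
    exact hz h0
  obtain ⟨a, ha⟩ := this
  obtain ⟨b, hb⟩ := h.exists_smul_eq (by rw [← mul_smul, P.e_mul_self]) ha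
  refine hN.2 (eq_top_iff.2 ?_)
  rintro y -
  obtain ⟨c, rfl⟩ := h.generates y
  rw [← hb]
  exact N.smul_mem _ (N.smul_mem _ (N.smul_mem _ (N.smul_mem _ hzN)))

theorem isCoatom_iff (h : IsStandard hG ℳ i S x) (hx : x ≠ 0) (K : Submodule A M) :
    IsCoatom K ↔ K = radical P M i := by
  have hne : radical P M i ≠ ⊤ := by
    intro htop
    have : x ∈ radical P M i := by rw [htop]; trivial
    have := this 1
    rw [one_smul, h.highest.weight] at this
    exact hx this
  have hco : IsCoatom (radical P M i) := by
    refine ⟨hne, fun N hN => ?_⟩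
    rcases h.le_radical_or_eq_top N with h1 | h1
    · exact absurd (hN.trans_le h1) (lt_irrefl _)
    · exact h1
  refine ⟨fun hK => ?_, fun hK => hK ▸ hco⟩
  rcases h.le_radical_or_eq_top K with h1 | h1
  · by_contra hne'
    exact hne (hK.2 _ (lt_of_le_of_ne h1 hne'))
  · exact absurd h1 hK.1

theorem jacobson_eq (h : IsStandard hG ℳ i S x) (hx : x ≠ 0) :
    Module.jacobson A M = radical P M i := by
  rw [Module.jacobson]
  have : {m : Submodule A M | IsCoatom m} = {radical P M i} := by
    ext K
    rw [Set.mem_ofPred_eq, h.isCoatom_iff hx, Set.mem_singleton_iff]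
  rw [this, sInf_singleton]

end Pres.IsStandard

/-- In a graded module, the vectors that generate a submodule without vectors of weight `i` form
a homogeneous submodule. -/
theorem Pres.Grading.comp_mem_radical {A : Type*} [Ring A] [Algebra ℂ A] {P : Pres v A}
    {G : ℤ → Submodule ℂ A} {hG : P.Grading G} {M : Type*} [AddCommGroup M] [_root_.Module A M]
    [_root_.Module ℂ M] {ℳ : ℤ → Submodule ℂ M} (hM : hG.Module ℳ) {i : Words v} {z : M}
    (hz : z ∈ Pres.IsStandard.radical P M i) (d : ℤ) :
    comp hM.internal d z ∈ Pres.IsStandard.radical P M i := by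
  intro a
  obtain ⟨s, hs⟩ := exists_sum_comp hG.internal a
  rw [hs s subset_rfl, Finset.sum_smul, Finset.smul_sum]
  refine Finset.sum_eq_zero fun d' _ => ?_
  have h1 : P.e i * comp hG.internal d' a ∈ G d' :=
    mem_idem_mul_of_mem hG (comp_mem _ _ _) i
  rw [← mul_smul, ← hM.comp_smul h1, mul_smul, hz, map_zero]

end KLRW
end

/-! ### Graded quotients, and standard modules are nonzero. -/

noncomputable section

namespace KLRW

variable {n : ℕ} {v : Fin n → ℕ}

namespace Pres

variable {A : Type*} [Ring A] [Algebra ℂ A] {P : Pres v A} {G : ℤ → Submodule ℂ A}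
  {hG : P.Grading G}

theorem Grading.self_module (hG : P.Grading G) : hG.Module G where
  smul_mem ha hx := hG.mul_mem ha hx
  internal := hG.internal

section quotient

variable {M : Type*} [AddCommGroup M] [_root_.Module A M] [_root_.Module ℂ M]
  [IsScalarTower ℂ A M]
  {ℳ : ℤ → Submodule ℂ M}

/-- The images of the homogeneous components in a quotient. -/
def quotComponent (N : Submodule A M) (ℳ : ℤ → Submodule ℂ M) (d : ℤ) : Submodule ℂ (M ⧸ N) :=
  (ℳ d).map (N.mkQ.restrictScalars ℂ)

theorem mkQ_mem_quotComponent (N : Submodule A M) {d : ℤ} {x : M} (hx : x ∈ ℳ d) :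
    N.mkQ x ∈ quotComponent N ℳ d := ⟨x, hx, rfl⟩

theorem Grading.Module.quotient (hM : hG.Module ℳ) {N : Submodule A M}
    (hN : ∀ z ∈ N, ∀ d, comp hM.internal d z ∈ N) : hG.Module (quotComponent N ℳ) where
  smul_mem := by
    rintro d d' a _ ha ⟨x, hx, rfl⟩
    exact ⟨a • x, hM.smul_mem ha hx, N.mkQ.map_smul a x⟩
  internal := by
    let π : ℤ → (M ⧸ N) →ₗ[ℂ] (M ⧸ N) := fun d =>
      (N.restrictScalars ℂ).liftQ (N.mkQ.restrictScalars ℂ ∘ₗ comp hM.internal d) (fun z hz => by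
        rw [LinearMap.mem_ker]
        exact (Submodule.Quotient.mk_eq_zero N).2 (hN z hz d)) ∘ₗ
        (Submodule.Quotient.restrictScalarsEquiv ℂ N).symm.toLinearMap
    have hπ : ∀ d x, π d (N.mkQ x) = N.mkQ (comp hM.internal d x) := fun d x => rfl
    refine isInternal_of_comp (π := π) ?_ ?_
    · rintro d _ ⟨x, hx, rfl⟩ d'
      change π d' (N.mkQ x) = if d = d' then N.mkQ x else 0
      rw [hπ, comp_of_mem _ hx]
      split_ifs
      · rfl
      · exact map_zero _
    · rw [eq_top_iff]
      rintro z -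
      obtain ⟨x, rfl⟩ := N.mkQ_surjective z
      obtain ⟨s, hs⟩ := exists_sum_comp hM.internal x
      rw [hs s subset_rfl, map_sum]
      exact Submodule.sum_mem _ fun d _ => Submodule.mem_iSup_of_mem d
        (mkQ_mem_quotComponent N (comp_mem hM.internal d x))

theorem Grading.Module.comp_mkQ (hM : hG.Module ℳ) {N : Submodule A M}
    (hN : ∀ z ∈ N, ∀ d, comp hM.internal d z ∈ N) (x : M) (d : ℤ) :
    comp (hM.quotient hN).internal d (N.mkQ x) = N.mkQ (comp hM.internal d x) := by
  obtain ⟨s, hs⟩ := exists_sum_comp hM.internal x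
  rw [hs (insert d s) (Finset.subset_insert _ _), map_sum, map_sum, map_sum, map_sum]
  refine Finset.sum_congr rfl fun d' _ => ?_
  have h := comp_mem hM.internal d' x
  rw [comp_of_mem _ h, comp_of_mem _ (mkQ_mem_quotComponent N h)]
  split_ifs
  · rfl
  · rw [map_zero]

omit [IsScalarTower ℂ A M] in
/-- A submodule generated by vectors whose components it contains is homogeneous. -/
theorem Grading.Module.comp_mem_span (hM : hG.Module ℳ) {s : Set M}
    (hs : ∀ z ∈ s, ∀ d, comp hM.internal d z ∈ Submodule.span A s) {z : M}
    (hz : z ∈ Submodule.span A s) (d : ℤ) : comp hM.internal d z ∈ Submodule.span A s := by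
  induction hz using Submodule.span_induction generalizing d with
  | mem z hz => exact hs z hz d
  | zero => rw [map_zero]; exact zero_mem _
  | add x y _ _ hx hy => rw [map_add]; exact add_mem (hx d) (hy d)
  | smul a x _ hx =>
    obtain ⟨s', hs'⟩ := exists_sum_comp hG.internal a
    rw [hs' s' subset_rfl, Finset.sum_smul, map_sum]
    refine Submodule.sum_mem _ fun d' _ => ?_
    have := hM.comp_smul (comp_mem hG.internal d' a) x (d - d')
    rw [add_sub_cancel] at this
    rw [this]
    exact Submodule.smul_mem _ _ (hx _)

end quotient

variable (P) in
/-- The relations of the generator of a standard module, as elements of the algebra. -/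
def standardRel (i : Words v) : Set A :=
  {1 - P.e i} ∪ {x | ∃ k, i.lab (k + 1) + 1 = i.lab k ∧ x = P.cr k} ∪ {x | ∃ k, x = P.Y k}

section standard

variable {i : Words v} {I : Submodule A A} (hI : I = Submodule.span A (P.standardRel i))

include hI

theorem one_sub_e_mem : 1 - P.e i ∈ I :=
  hI ▸ Submodule.subset_span (Or.inl (Or.inl rfl))

theorem cr_mem_standard {k : ℕ} (h : i.lab (k + 1) + 1 = i.lab k) : P.cr k ∈ I :=
  hI ▸ Submodule.subset_span (Or.inl (Or.inr ⟨k, h, rfl⟩))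

theorem Y_mem_standard (k : ℕ) : P.Y k ∈ I :=
  hI ▸ Submodule.subset_span (Or.inr ⟨k, rfl⟩)

theorem e_mem_standard {j : Words v} (h : j ≠ i) : P.e j ∈ I := by
  have := I.smul_mem (P.e j) (one_sub_e_mem hI)
  rwa [smul_eq_mul, mul_sub, mul_one, P.e_mul_ne h, sub_zero] at this

theorem isHighest_mkQ : P.IsHighest i (I.mkQ 1) where
  weight := by
    rw [← map_smul, smul_eq_mul, mul_one, eq_comm, ← sub_eq_zero, ← map_sub]
    exact (Submodule.Quotient.mk_eq_zero I).2 (one_sub_e_mem hI)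
  Y_smul k := by
    rw [← map_smul, smul_eq_mul, mul_one]
    exact (Submodule.Quotient.mk_eq_zero I).2 (Y_mem_standard hI k)
  cr_smul k h := by
    rw [← map_smul, smul_eq_mul, mul_one]
    exact (Submodule.Quotient.mk_eq_zero I).2 (cr_mem_standard hI h)

/-- The universal property of standard modules. -/
theorem exists_map_of_isHighest {M : Type*} [AddCommGroup M] [Module A M] {x : M}
    (hx : P.IsHighest i x) : ∃ f : (A ⧸ I) →ₗ[A] M, ∀ a, f (I.mkQ a) = a • x := by
  refine ⟨I.liftQ (LinearMap.toSpanSingleton A M x) ?_, fun a => ?_⟩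
  · rw [hI, Submodule.span_le]
    rintro _ ((rfl | ⟨k, hk, rfl⟩) | ⟨k, rfl⟩)
    · change (1 - P.e i) • x = 0
      rw [sub_smul, one_smul, hx.weight, sub_self]
    · exact hx.cr_smul k hk
    · exact hx.Y_smul k
  · rw [Submodule.mkQ_apply, Submodule.liftQ_apply, LinearMap.toSpanSingleton_apply]

/-- The components of the relations of a standard module. -/
theorem comp_standardRel (hG : P.Grading G) {x : A} (hx : x ∈ P.standardRel i) (d : ℤ)
    {Q : A → Prop} (h0 : Q 0) (hadd : ∀ a b, Q a → Q b → Q (a + b)) (h1 : d = 0 → Q (1 - P.e i))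
    (h2 : ∀ k, d = 2 → Q (P.Y k)) (h3 : ∀ k j, j ≠ i → Q (P.cr k * P.e j))
    (h4 : ∀ k, i.lab (k + 1) + 1 = i.lab k → Q (P.cr k * P.e i)) :
    Q (comp hG.internal d x) := by
  rcases hx with (rfl | ⟨k, hk, rfl⟩) | ⟨k, rfl⟩
  · rw [comp_of_mem _ (sub_mem hG.one_mem (hG.e_mem i))]
    split_ifs with h
    · exact h1 h.symm
    · exact h0
  -- The degree of a crossing depends on the word below it, so `cr k` has to be split by the
  -- idempotents.
  · rw [← mul_one (P.cr k), ← P.sum_e, Finset.mul_sum, map_sum]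
    refine Finset.sum_induction _ Q (fun a b => hadd a b) h0 fun j _ => ?_
    rw [comp_of_mem _ (hG.cr_mem k j)]
    split_ifs with h
    · by_cases hj : j = i
      · subst hj; exact h4 k hk
      · exact h3 k j hj
    · exact h0
  · rw [comp_of_mem _ (hG.Y_mem k)]
    split_ifs with h
    · exact h2 k h.symm
    · exact h0

/-- The ideal contains `e(j)` for all `j ≠ i`, hence all homogeneous pieces of its generators. -/
theorem comp_mem_standard (hG : P.Grading G) {z : A} (hz : z ∈ I) (d : ℤ) :
    comp hG.self_module.internal d z ∈ I := by
  have h1 := one_sub_e_mem hI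
  have h2 := Y_mem_standard hI
  have h3 : ∀ k j, j ≠ i → P.cr k * P.e j ∈ I := fun k j hj =>
    I.smul_mem (P.cr k) (e_mem_standard hI hj)
  have h4 : ∀ k, i.lab (k + 1) + 1 = i.lab k → P.cr k * P.e i ∈ I := fun k hk => by
    have := I.sub_mem (cr_mem_standard hI hk) (I.smul_mem (P.cr k) h1)
    rwa [smul_eq_mul, mul_sub, mul_one, sub_sub_cancel] at this
  have hI' := hI
  subst hI
  refine hG.self_module.comp_mem_span (fun z hz d => ?_) hz d
  exact comp_standardRel hI' hG hz d (Q := fun a => a ∈ Submodule.span A (P.standardRel i))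
    (zero_mem _) (fun _ _ => add_mem) (fun _ => h1) (fun k _ => h2 k) h3 h4

theorem isStandard (hG : P.Grading G) {S : List (ℕ × ℕ)} (hS : Lyn n S)
    (hi : i.Agrees 0 (letters S)) : IsStandard hG (quotComponent I G) i S (I.mkQ 1) where
  grading := hG.self_module.quotient fun _ hz d => comp_mem_standard hI hG hz d
  highest := isHighest_mkQ hI
  mem := mkQ_mem_quotComponent I hG.one_mem
  generates z := by
    obtain ⟨a, rfl⟩ := I.mkQ_surjective z
    exact ⟨a, by rw [← map_smul, smul_eq_mul, mul_one]⟩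
  lyn := hS
  agrees := hi

/-- A standard module is nonzero if the algebra acts on a space with a nonzero vector on which
the dots act as scalars and which satisfies the other relations. -/
theorem mkQ_one_ne_zero (hG : P.Grading G) {W : Type*} [AddCommGroup W] [Module ℂ W]
    (φ : A →ₐ[ℂ] Module.End ℂ W) {w : W} (hw0 : w ≠ 0) (h1 : φ (P.e i) w = w)
    (h2 : ∀ k, ∃ c : ℂ, φ (P.Y k) w = c • w)
    (h3 : ∀ k, i.lab (k + 1) + 1 = i.lab k → φ (P.cr k) w = 0) : I.mkQ 1 ≠ 0 := by
  -- The relation that kills a dot, of degree `2`, becomes a scalar on `w`, which is also the action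
  -- of an element of degree `0`; the other relations act by zero. So a component of degree `d` of
  -- an element of the ideal acts on `w` like an element of degree `d - 2`.
  have key : ∀ z ∈ I, ∀ d, ∃ s ∈ G (d - 2), φ (comp hG.internal d z) w = φ s w := by
    intro z hz
    rw [hI] at hz
    induction hz using Submodule.span_induction with
    | mem z hz =>
      intro d
      refine comp_standardRel hI hG hz d (Q := fun a => ∃ s ∈ G (d - 2), φ a w = φ s w)
        ⟨0, zero_mem _, rfl⟩ ?_ (fun _ => ⟨0, zero_mem _, ?_⟩) (fun k hd => ?_)
        (fun k j hj => ⟨0, zero_mem _, ?_⟩) (fun k hk => ⟨0, zero_mem _, ?_⟩)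
      · rintro a b ⟨s, hs, h⟩ ⟨s', hs', h'⟩
        exact ⟨s + s', add_mem hs hs', by
          rw [map_add, map_add, LinearMap.add_apply, LinearMap.add_apply, h, h']⟩
      · rw [map_sub, map_one, LinearMap.sub_apply, h1, map_zero, Module.End.one_apply, sub_self]
        rfl
      · obtain ⟨c, hc⟩ := h2 k
        refine ⟨c • 1, ?_, by rw [hc, map_smul, map_one]; rfl⟩
        rw [hd, sub_self]
        exact Submodule.smul_mem _ _ hG.one_mem
      · conv_lhs => rw [← h1]
        rw [← Module.End.mul_apply, ← map_mul, mul_assoc, P.e_mul_ne hj, mul_zero]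
      · rw [map_mul, Module.End.mul_apply, h1, h3 k hk, map_zero]
        rfl
    | zero => exact fun d => ⟨0, zero_mem _, by rw [map_zero]⟩
    | add x y _ _ hx hy =>
      intro d
      obtain ⟨s, hs, h⟩ := hx d
      obtain ⟨s', hs', h'⟩ := hy d
      exact ⟨s + s', add_mem hs hs', by
        rw [map_add, map_add, map_add, LinearMap.add_apply, LinearMap.add_apply, h, h']⟩
    | smul a x _ hx =>
      intro d
      obtain ⟨t, ht⟩ := exists_sum_comp hG.internal a
      rw [ht t subset_rfl, Finset.sum_smul, map_sum]
      refine Finset.sum_induction _ (fun a => ∃ s ∈ G (d - 2), φ a w = φ s w) ?_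
        ⟨0, zero_mem _, rfl⟩ fun d' _ => ?_
      · rintro a b ⟨s, hs, h⟩ ⟨s', hs', h'⟩
        exact ⟨s + s', add_mem hs hs', by
          rw [map_add, map_add, LinearMap.add_apply, LinearMap.add_apply, h, h']⟩
      · obtain ⟨s, hs, h⟩ := hx (d - d')
        have hc := comp_mem hG.internal d' a
        refine ⟨comp hG.internal d' a * s, ?_, ?_⟩
        · have := hG.mul_mem hc hs
          rwa [show d' + (d - d' - 2) = d - 2 by ring] at this
        · have := hG.self_module.comp_smul hc x (d - d')
          rw [add_sub_cancel] at this
          rw [this, smul_eq_mul, map_mul, map_mul, Module.End.mul_apply, Module.End.mul_apply, h]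
  intro h
  -- If `1` is in the ideal, then `w` is fixed by some `s` of degree `-2` and by all its powers; but
  -- high powers are zero, since the degrees are bounded below.
  obtain ⟨s, hs, h⟩ := key 1 ((Submodule.Quotient.mk_eq_zero I).1 h) 0
  rw [comp_of_mem _ hG.one_mem, if_pos rfl, map_one, Module.End.one_apply] at h
  obtain ⟨D, hD⟩ := hG.bounded
  have hpow : ∀ m : ℕ, s ^ m ∈ G (-2 * m) ∧ φ (s ^ m) w = w := by
    intro m
    induction m with
    | zero => exact ⟨by simpa using hG.one_mem, by rw [pow_zero, map_one, Module.End.one_apply]⟩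
    | succ m ih =>
      refine ⟨?_, ?_⟩
      · have := hG.mul_mem ih.1 hs
        rw [pow_succ]
        push_cast
        rwa [show -2 * (m : ℤ) + (0 - 2) = -2 * (m + 1) by ring] at this
      · rw [pow_succ, map_mul, Module.End.mul_apply, ← h, ih.2]
  have h4 := hpow (D.natAbs + 1)
  rw [hD _ (by omega), Submodule.mem_bot] at h4
  rw [h4.1, map_zero] at h4
  exact hw0 h4.2.symm

end standard

end Pres

end KLRW
end

/-! ### Classification of graded simple modules, and composition factors. -/

noncomputable section

namespace KLRW

variable {n : ℕ} {v : Fin n → ℕ}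

theorem Words.not_smaller_of_eq_or_lexLT {i j : Words v} (h : i = j ∨ i.LexLT j) :
    ¬ j.Smaller i := by
  rintro h'
  rw [← Words.lexLT_iff] at h'
  rcases h with rfl | h
  · exact i.not_lexLT_self h'
  · exact lt_asymm (h : toLex i.1 < toLex j.1) h'

namespace Pres

variable {A : Type*} [Ring A] [Algebra ℂ A] {P : Pres v A} {G : ℤ → Submodule ℂ A}
  {hG : P.Grading G}

section module

variable {M : Type*} [AddCommGroup M] [Module A M]

variable (P) in
/-- A nonzero module has a lexicographically smallest weight. -/
theorem exists_minimal_weight [Nontrivial M] : ∃ i : Words v, (∃ x : M, P.e i • x ≠ 0) ∧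
    ∀ j : Words v, (∃ x : M, P.e j • x ≠ 0) → i = j ∨ i.LexLT j := by
  refine Words.exists_minimal ?_
  by_contra! h
  obtain ⟨x, hx⟩ := exists_ne (0 : M)
  refine hx ?_
  rw [← one_smul A x, ← P.sum_e, Finset.sum_smul]
  exact Finset.sum_eq_zero fun i _ => h i x

theorem e_smul_of_smaller_of_minimal {i : Words v}
    (h : ∀ j : Words v, (∃ x : M, P.e j • x ≠ 0) → i = j ∨ i.LexLT j) (j : Words v)
    (hj : j.Smaller i) (x : M) : P.e j • x = 0 := by
  by_contra hx
  exact Words.not_smaller_of_eq_or_lexLT (h j ⟨x, hx⟩) hj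

theorem Y_pow_Y_smul (k l m : ℕ) (x : M) : P.Y k • P.Y l ^ m • x = P.Y l ^ m • P.Y k • x := by
  rw [← mul_smul, ← mul_smul, (Commute.pow_right (P.Y_mul_Y k l) m).eq]

/-- If the dots act nilpotently, then there is a nonzero vector that they kill. -/
theorem exists_Y_smul_eq_zero {p : M → Prop} (hp : ∀ x k, p x → p (P.Y k • x))
    (hnil : ∀ x k, p x → ∃ m : ℕ, P.Y k ^ m • x = 0) {x : M} (hx : p x) (hx0 : x ≠ 0) :
    ∃ z, p z ∧ z ≠ 0 ∧ ∀ k, P.Y k • z = 0 := by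
  classical
  have key : ∀ m : ℕ, ∃ z, p z ∧ z ≠ 0 ∧ ∀ k < m, P.Y k • z = 0 := by
    intro m
    induction m with
    | zero => exact ⟨x, hx, hx0, by simp⟩
    | succ m ih =>
      obtain ⟨z, h1, h2, h3⟩ := ih
      have hpow : ∀ r : ℕ, p (P.Y m ^ r • z) := by
        intro r
        induction r with
        | zero => simpa using h1
        | succ r ih => rw [pow_succ', mul_smul]; exact hp _ _ ih
      have hex := hnil z m h1
      obtain ⟨r, hr⟩ : ∃ r, Nat.find hex = r + 1 := by
        refine Nat.exists_eq_succ_of_ne_zero fun h0 => h2 ?_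
        have := Nat.find_spec hex
        rwa [h0, pow_zero, one_smul] at this
      refine ⟨P.Y m ^ r • z, hpow r, Nat.find_min hex (by omega), fun k hk => ?_⟩
      rcases Nat.lt_succ_iff_lt_or_eq.1 hk with hk | rfl
      · rw [Y_pow_Y_smul, h3 k hk, smul_zero]
      · rw [← mul_smul, ← pow_succ', ← hr]
        exact Nat.find_spec hex
  obtain ⟨z, h1, h2, h3⟩ := key (size v)
  refine ⟨z, h1, h2, fun k => ?_⟩
  by_cases hk : k < size v
  · exact h3 k hk
  · rw [P.Y_of_le (by omega), zero_smul]

theorem isHighest_of_minimal {i : Words v}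
    (hmin : ∀ j : Words v, j.Smaller i → ∀ x : M, P.e j • x = 0) {x : M} (hx : P.e i • x = x)
    (hY : ∀ k, P.Y k • x = 0) : P.IsHighest i x :=
  ⟨hx, hY, fun _ hk => cr_smul_of_descent hmin hx (by omega)⟩

end module

/-- The dots act nilpotently on standard modules. -/
theorem IsStandard.exists_Y_pow_smul {M : Type*} [AddCommGroup M] [Module A M] [Module ℂ M]
    [IsScalarTower ℂ A M] {ℳ : ℤ → Submodule ℂ M} {i : Words v} {S : List (ℕ × ℕ)} {x : M}
    (h : IsStandard hG ℳ i S x) (z : M) (k : ℕ) : ∃ m : ℕ, P.Y k ^ m • z = 0 := by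
  obtain ⟨N, hN⟩ := h.finite.2
  obtain ⟨D, hD⟩ := (finite_comp h.grading.internal z).bddBelow
  have hpow : ∀ m : ℕ, P.Y k ^ m ∈ G (2 * m) := by
    intro m
    induction m with
    | zero => simpa using hG.one_mem
    | succ m ih =>
      rw [pow_succ]
      have := hG.mul_mem ih (hG.Y_mem k)
      push_cast
      rwa [mul_add, mul_one]
  refine ⟨(N - D + 1).toNat, ?_⟩
  obtain ⟨s, hs⟩ := exists_sum_comp h.grading.internal z
  rw [hs s subset_rfl, Finset.smul_sum]
  refine Finset.sum_eq_zero fun d _ => ?_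
  by_cases hd : comp h.grading.internal d z = 0
  · rw [hd, smul_zero]
  have h1 := hD hd
  have h2 := h.grading.smul_mem (hpow (N - D + 1).toNat) (comp_mem h.grading.internal d z)
  rwa [hN _ (by omega), Submodule.mem_bot] at h2

variable {I : Words v → Submodule A A} (hI : ∀ i, I i = Submodule.span A (P.standardRel i))
  (hI0 : ∀ i, (I i).mkQ 1 ≠ 0)

include hI hI0 in
/-- A simple module with a vector of minimal weight killed by the dots is a quotient of a standard
module. -/
theorem nonempty_equiv_of_minimal (hG : P.Grading G) {N : Type*} [AddCommGroup N] [Module A N]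
    [IsSimpleModule A N] {i : Words v}
    (hmin : ∀ j : Words v, j.Smaller i → ∀ x : N, P.e j • x = 0) {x : N} (hx : P.e i • x = x)
    (hx0 : x ≠ 0) (hY : ∀ k, P.Y k • x = 0) :
    Nonempty (N ≃ₗ[A] ((A ⧸ I i) ⧸ Module.jacobson A (A ⧸ I i))) := by
  obtain ⟨S, hS, hi⟩ := exists_lyn_of_minimal hmin hx hx0
  have hst := isStandard (hI i) hG hS hi
  obtain ⟨f, hf⟩ := exists_map_of_isHighest (hI i) (isHighest_of_minimal hmin hx hY)
  have hsurj : Function.Surjective f := by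
    refine (LinearMap.surjective_or_eq_zero f).resolve_right ?_
    rintro rfl
    have := hf 1
    rw [LinearMap.zero_apply, one_smul] at this
    exact hx0 this.symm
  have hker := (hst.isCoatom_iff (hI0 i) _).1 (LinearMap.isCoatom_ker_of_surjective hsurj)
  rw [← hst.jacobson_eq (hI0 i)] at hker
  exact ⟨(f.quotKerEquivOfSurjective hsurj).symm.trans (Submodule.quotEquivOfEq _ _ hker)⟩

/-- Composition factors of the radical of a standard module have larger minimal weight. -/
theorem IsStandard.exists_minimal_weight_factor {M : Type*} [AddCommGroup M] [Module A M]
    [Module ℂ M] [IsScalarTower ℂ A M] {ℳ : ℤ → Submodule ℂ M} {i : Words v} {S : List (ℕ × ℕ)}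
    {x : M} (h : IsStandard hG ℳ i S x) {N' N : Submodule A M} (hN : N ≤ IsStandard.radical P M i)
    [Nontrivial (N ⧸ N'.submoduleOf N)] :
    ∃ j : Words v, i.LexLT j ∧
      (∀ j' : Words v, j'.Smaller j → ∀ x : N ⧸ N'.submoduleOf N, P.e j' • x = 0) ∧
      ∃ x : N ⧸ N'.submoduleOf N, P.e j • x = x ∧ x ≠ 0 ∧ ∀ k, P.Y k • x = 0 := by
  obtain ⟨j, ⟨x, hx⟩, hmin⟩ := P.exists_minimal_weight (M := N ⧸ N'.submoduleOf N)
  have hsmul : ∀ (a : A) (z : N ⧸ N'.submoduleOf N),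
      ∃ w : N, z = Submodule.Quotient.mk w ∧ (a • (w : M) = 0 → a • z = 0) := by
    intro a z
    obtain ⟨w, rfl⟩ := Submodule.Quotient.mk_surjective _ z
    refine ⟨w, rfl, fun hw => ?_⟩
    rw [← Submodule.Quotient.mk_smul]
    have : a • w = 0 := Subtype.ext hw
    rw [this, Submodule.Quotient.mk_zero]
  refine ⟨j, ?_, e_smul_of_smaller_of_minimal hmin, ?_⟩
  -- Weight `i` does not occur in the radical, and smaller words do not occur in the whole module.
  · obtain ⟨w, -, hw⟩ := hsmul (P.e j) x
    rcases i.lexLT_trichotomy j with h1 | rfl | h1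
    · exact h1
    · refine absurd (hw ?_) hx
      have := hN w.2 1
      rwa [one_smul] at this
    · exact absurd (hw (h.e_smul_of_smaller (Words.lexLT_iff.1 h1) _)) hx
  · refine exists_Y_smul_eq_zero (P := P) (p := fun x => P.e j • x = x) (x := P.e j • x)
      (fun x k hx => e_Y_smul hx k) (fun x k _ => ?_) ?_ hx |>.imp fun z hz => hz
    · obtain ⟨w, rfl, -⟩ := hsmul 1 x
      obtain ⟨m, hm⟩ := h.exists_Y_pow_smul (w : M) k
      refine ⟨m, ?_⟩
      rw [← Submodule.Quotient.mk_smul]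
      have : P.Y k ^ m • w = 0 := Subtype.ext hm
      rw [this, Submodule.Quotient.mk_zero]
    · rw [← mul_smul, P.e_mul_self]

theorem IsStandard.isFiniteLength {M : Type*} [AddCommGroup M] [Module A M]
    [Module ℂ M] [IsScalarTower ℂ A M] {ℳ : ℤ → Submodule ℂ M} {i : Words v} {S : List (ℕ × ℕ)}
    {x : M} (h : IsStandard hG ℳ i S x) (N : Submodule A M) : IsFiniteLength A N := by
  have := h.finite.1
  have h1 : IsNoetherian A M := isNoetherian_of_tower ℂ inferInstance
  have h2 : IsArtinian A M := isArtinian_of_tower ℂ inferInstance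
  exact isFiniteLength_iff_isNoetherian_isArtinian.2 ⟨inferInstance, inferInstance⟩

section graded

variable {M : Type*} [AddCommGroup M] [_root_.Module A M] [_root_.Module ℂ M]
  {ℳ : ℤ → Submodule ℂ M}

/-- The submodule generated by a homogeneous vector is homogeneous. -/
theorem Grading.Module.comp_smul_mem (hM : hG.Module ℳ) {d : ℤ} {x : M} (hx : x ∈ ℳ d) (a : A)
    (d' : ℤ) : comp hM.internal (d' + d) (a • x) = comp hG.internal d' a • x := by
  obtain ⟨s, hs⟩ := exists_sum_comp hG.internal a
  conv_lhs => rw [hs (insert d' s) (Finset.subset_insert _ _), Finset.sum_smul, map_sum]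
  rw [Finset.sum_eq_single d']
  · rw [comp_of_mem _ (hM.smul_mem (comp_mem hG.internal d' a) hx), if_pos rfl]
  · intro d'' _ hd
    rw [comp_of_mem _ (hM.smul_mem (comp_mem hG.internal d'' a) hx), if_neg (by omega)]
  · intro h; exact absurd (Finset.mem_insert_self _ _) h

/-- In a graded simple module, every homogeneous vector is a multiple of any other. -/
theorem Grading.Module.exists_smul_eq (hM : hG.Module ℳ)
    (hs : ∀ N : Submodule A M, (∀ z ∈ N, ∀ d, comp hM.internal d z ∈ N) → N = ⊥ ∨ N = ⊤)
    {d : ℤ} {x : M} (hx : x ∈ ℳ d) (hx0 : x ≠ 0) {d' : ℤ} {z : M} (hz : z ∈ ℳ (d' + d)) :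
    ∃ a ∈ G d', a • x = z := by
  have htop : Submodule.span A {x} = ⊤ := by
    refine (hs _ fun z hz d' => ?_).resolve_left fun h => hx0 ?_
    · obtain ⟨a, rfl⟩ := Submodule.mem_span_singleton.1 hz
      have := hM.comp_smul_mem hx a (d' - d)
      rw [sub_add_cancel] at this
      rw [this]
      exact Submodule.smul_mem _ _ (Submodule.mem_span_singleton_self x)
    · exact Submodule.span_singleton_eq_bot.1 h
  obtain ⟨a, ha⟩ := Submodule.mem_span_singleton.1 (htop ▸ Submodule.mem_top : z ∈ _)
  refine ⟨comp hG.internal d' a, comp_mem _ _ _, ?_⟩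
  rw [← hM.comp_smul_mem hx, ha, comp_of_mem _ hz, if_pos rfl]

/-- A graded simple module contains a homogeneous vector that satisfies the relations of the
generator of a standard module. -/
theorem Grading.Module.exists_isHighest (hM : hG.Module ℳ) [Nontrivial M]
    (hs : ∀ N : Submodule A M, (∀ z ∈ N, ∀ d, comp hM.internal d z ∈ N) → N = ⊥ ∨ N = ⊤) :
    ∃ i : Words v, (∃ S, Lyn n S ∧ i.Agrees 0 (letters S)) ∧
      ∃ (d : ℤ) (x : M), x ∈ ℳ d ∧ x ≠ 0 ∧ P.IsHighest i x := by
  obtain ⟨i, ⟨x, hx⟩, hmin⟩ := P.exists_minimal_weight (M := M)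
  have hmin' := e_smul_of_smaller_of_minimal hmin
  obtain ⟨d, hd⟩ : ∃ d, comp hM.internal d (P.e i • x) ≠ 0 := by
    by_contra! h
    exact hx (eq_zero_of_comp hM.internal h)
  have hw : P.e i • comp hM.internal d (P.e i • x) = comp hM.internal d (P.e i • x) := by
    have := hM.comp_smul (hG.e_mem i) (P.e i • x) d
    rw [zero_add, ← mul_smul, P.e_mul_self] at this
    exact this.symm
  obtain ⟨D, hD⟩ := hG.bounded
  obtain ⟨z, ⟨h1, d', h2⟩, h3, h4⟩ := exists_Y_smul_eq_zero (P := P)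
    (p := fun x => P.e i • x = x ∧ ∃ d, x ∈ ℳ d)
    (fun x k hx => ⟨e_Y_smul hx.1 k, by
      obtain ⟨d, hd⟩ := hx.2
      exact ⟨_, hM.smul_mem (hG.Y_mem k) hd⟩⟩) (fun x k hx => by
      obtain ⟨d, hd⟩ := hx.2
      have hpow : ∀ m : ℕ, P.Y k ^ m • x ∈ ℳ (2 * m + d) := by
        intro m
        induction m with
        | zero => simpa using hd
        | succ m ih =>
          have := hM.smul_mem (hG.Y_mem k) ih
          rw [pow_succ', mul_smul]
          push_cast
          rwa [show 2 * ((m : ℤ) + 1) + d = 2 + (2 * m + d) by ring]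
      -- If this power of a dot did not kill `x`, graded simplicity would give an element of the
      -- opposite degree that leads back to `x`. That degree is less than `D`, so the element is
      -- zero.
      refine ⟨(-D).toNat + 1, ?_⟩
      by_contra h0
      obtain ⟨a, ha, hax⟩ := hM.exists_smul_eq hs (hpow _) h0 (d' := -(2 * ((-D).toNat + 1 : ℕ)))
        (z := x) (by rwa [neg_add_cancel_left])
      rw [hD _ (by omega), Submodule.mem_bot] at ha
      rw [ha, zero_smul] at hax
      rw [← hax, smul_zero] at h0
      exact h0 rfl)
    ⟨hw, d, comp_mem hM.internal d _⟩ hd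
  exact ⟨i, exists_lyn_of_minimal hmin' h1 h3, d', z, h2, h3, isHighest_of_minimal hmin' h1 h4⟩

end graded

include hI hI0 in
/-- A graded simple module is a shift of the simple quotient of a standard module. -/
theorem Grading.Module.exists_equiv {M : Type*} [AddCommGroup M] [_root_.Module A M]
    [_root_.Module ℂ M] {ℳ : ℤ → Submodule ℂ M} (hM : hG.Module ℳ) [Nontrivial M]
    (hs : ∀ N : Submodule A M, (∀ z ∈ N, ∀ d, comp hM.internal d z ∈ N) → N = ⊥ ∨ N = ⊤) :
    ∃ i : Words v, (∃ S, Lyn n S ∧ i.Agrees 0 (letters S)) ∧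
      ∃ (a : ℤ) (f : ((A ⧸ I i) ⧸ _root_.Module.jacobson A (A ⧸ I i)) ≃ₗ[A] M), ∀ d x,
        x ∈ quotComponent (_root_.Module.jacobson A (A ⧸ I i)) (quotComponent (I i) G) d ↔
          f x ∈ ℳ (d + a) := by
  obtain ⟨i, ⟨S, hS, hi⟩, a, x, hxa, hx0, hx⟩ := hM.exists_isHighest hs
  refine ⟨i, ⟨S, hS, hi⟩, a, ?_⟩
  have hst := isStandard (hI i) hG hS hi
  obtain ⟨f, hf⟩ := exists_map_of_isHighest (hI i) hx
  have hcomp : ∀ d z, comp hM.internal (d + a) (f z) = f (comp hst.grading.internal d z) := by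
    intro d z
    obtain ⟨b, rfl⟩ := (I i).mkQ_surjective z
    have h1 := hG.self_module.comp_mkQ (fun _ hz d => comp_mem_standard (hI i) hG hz d) b d
    rw [h1, hf, hf, hM.comp_smul_mem hxa]
  have hsurj : Function.Surjective f := by
    intro z
    obtain ⟨t, ht⟩ := exists_sum_comp hM.internal z
    have : ∀ d, ∃ b : A, b • x = comp hM.internal d z := fun d => by
      obtain ⟨b, -, hb⟩ := hM.exists_smul_eq hs hxa hx0 (d' := d - a)
        (z := comp hM.internal d z) (by rw [sub_add_cancel]; exact comp_mem _ _ _)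
      exact ⟨b, hb⟩
    choose b hb using this
    refine ⟨(I i).mkQ (∑ d ∈ t, b d), ?_⟩
    rw [hf, Finset.sum_smul, ht t subset_rfl]
    exact Finset.sum_congr rfl fun d _ => hb d
  have hle : LinearMap.ker f ≤ IsStandard.radical P (A ⧸ I i) i := by
    refine (hst.le_radical_or_eq_top _).resolve_right fun h => hx0 ?_
    have : (I i).mkQ 1 ∈ LinearMap.ker f := by rw [h]; trivial
    rw [LinearMap.mem_ker, hf, one_smul] at this
    exact this
  have hker : LinearMap.ker f = IsStandard.radical P (A ⧸ I i) i := by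
    refine le_antisymm hle fun z hz => ?_
    -- Since `M` is only graded simple, maximality of the kernel is not available. Instead, the
    -- image of the radical is homogeneous, hence `⊥` or `⊤`. If it were `⊤`, the generator would
    -- differ from an element of the radical by an element of the kernel, so it would lie in the
    -- radical.
    have hmap : ∀ z ∈ (IsStandard.radical P (A ⧸ I i) i).map f, ∀ d,
        comp hM.internal d z ∈ (IsStandard.radical P (A ⧸ I i) i).map f := by
      rintro _ ⟨w, hw, rfl⟩ d
      have := hcomp (d - a) w
      rw [sub_add_cancel] at this
      rw [this]
      exact Submodule.mem_map_of_mem (Grading.comp_mem_radical hst.grading hw _)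
    rcases hs _ hmap with h | h
    · rw [LinearMap.mem_ker, ← Submodule.mem_bot A, ← h]
      exact Submodule.mem_map_of_mem hz
    · exfalso
      obtain ⟨w, hw, hwx⟩ : x ∈ (IsStandard.radical P (A ⧸ I i) i).map f := by rw [h]; trivial
      have h1 : (I i).mkQ 1 - w ∈ IsStandard.radical P (A ⧸ I i) i := hle (by
        rw [LinearMap.mem_ker, map_sub, hf, one_smul, hwx, sub_self])
      have h2 := add_mem h1 hw 1
      rw [sub_add_cancel, one_smul, hst.highest.weight] at h2
      exact hI0 i h2
  rw [← hst.jacobson_eq (hI0 i)] at hker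
  let F := (Submodule.quotEquivOfEq _ _ hker).symm.trans (f.quotKerEquivOfSurjective hsurj)
  have hF : ∀ z, F ((_root_.Module.jacobson A (A ⧸ I i)).mkQ z) = f z := fun z => rfl
  refine ⟨F, fun d z => ⟨?_, fun hz => ?_⟩⟩
  · rintro ⟨_, ⟨b, hb, rfl⟩, rfl⟩
    change f ((I i).mkQ b) ∈ _
    rw [hf]
    exact hM.smul_mem hb hxa
  · obtain ⟨u, rfl⟩ := (_root_.Module.jacobson A (A ⧸ I i)).mkQ_surjective z
    rw [hF] at hz
    have h1 := hcomp d u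
    rw [comp_of_mem _ hz, if_pos rfl, ← hF, ← hF] at h1
    rw [F.injective h1]
    exact mkQ_mem_quotComponent _ (comp_mem _ _ _)

end Pres

end KLRW
end

/-! ### The results for the KLRW algebra itself. -/

noncomputable section

namespace KLRW

variable {n : ℕ} {v : Fin n → ℕ}

theorem standardIdeal_eq (i : Words v) :
    standardIdeal i = Submodule.span (T v) ((pres v).standardRel i) := by
  refine le_antisymm (Submodule.span_le.2 ?_) (Submodule.span_le.2 ?_)
  · rintro _ ((rfl | ⟨k, hk, rfl⟩) | ⟨k, rfl⟩)
    · exact Submodule.subset_span (Or.inl (Or.inl rfl))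
    · refine Submodule.subset_span (Or.inl (Or.inr ⟨k, ?_, (pres_cr k).symm⟩))
      rw [Words.lab_of_lt i (by omega : (k : ℕ) < size v),
        Words.lab_of_lt i (by omega : (k : ℕ) + 1 < size v)]
      exact congrArg (· + 1) hk
    · exact Submodule.subset_span (Or.inr ⟨k, (pres_Y k).symm⟩)
  · rintro _ ((rfl | ⟨k, hk, rfl⟩) | ⟨k, rfl⟩)
    · exact Submodule.subset_span (Or.inl (Or.inl rfl))
    · by_cases h : k + 1 < size v
      · refine Submodule.subset_span (Or.inl (Or.inr ⟨⟨k, by omega⟩, ?_, pres_cr ⟨k, by omega⟩⟩))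
        rw [Words.lab_of_lt i (by omega : k < size v), Words.lab_of_lt i h] at hk
        exact Nat.succ_injective hk
      · rw [(pres v).cr_of_le (by omega)]
        exact zero_mem _
    · by_cases h : k < size v
      · exact Submodule.subset_span (Or.inr ⟨⟨k, h⟩, pres_Y ⟨k, h⟩⟩)
      · rw [(pres v).Y_of_le (by omega)]
        exact zero_mem _

/-- The vector required is the indicator function of the trivial permutation, in the permutation
representation built from the word `i` itself. -/
theorem standard_mkQ_one_ne_zero (i : Words v) : (standardIdeal i).mkQ 1 ≠ 0 := by
  refine Pres.mkQ_one_ne_zero (standardIdeal_eq i) (pres_grading v) (permPres i).lift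
    permOne_ne_zero ?_ (fun k => ?_) (fun k hk => ?_)
  · have : (permPres i).lift ((pres v).e i) = permIdem i i := (permPres i).lift_mk (.idem i)
    rw [this, permIdem_permOne]
  · by_cases h : k < size v
    · have : (permPres i).lift ((pres v).Y k) = permDot i k := by
        have h1 := pres_Y (v := v) ⟨k, h⟩
        simp only at h1
        rw [h1]
        exact (permPres i).lift_mk (.dot ⟨k, h⟩)
      exact ⟨_, by rw [this, permDot_permOne]⟩
    · refine ⟨0, ?_⟩
      rw [(pres v).Y_of_le (by omega), map_zero, zero_smul]
      rfl
  · by_cases h : k + 1 < size v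
    · have : (permPres i).lift ((pres v).cr k) = permCross i k := by
        have h1 := pres_cr (v := v) ⟨k, by omega⟩
        simp only at h1
        rw [h1]
        exact (permPres i).lift_mk (.cross ⟨k, by omega⟩)
      rw [this, permCross_permOne i hk]
    · rw [(pres v).cr_of_le (by omega), map_zero]
      rfl

theorem isStandard_standard {i : Words v} {S : List (ℕ × ℕ)} (hS : Lyn n S)
    (hi : i.Agrees 0 (letters S)) :
    Pres.IsStandard (pres_grading v) (Pres.quotComponent (standardIdeal i) (component v)) i S
      ((standardIdeal i).mkQ 1) :=
  Pres.isStandard (standardIdeal_eq i) (pres_grading v) hS hi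

theorem kernel_eq {i : Words v} (hi : IsLyndonConcat i) :
    kernel i = Pres.IsStandard.radical (pres v) (Standard i) i := by
  obtain ⟨S, hS, hi⟩ := (isLyndonConcat_iff i).1 hi
  exact (isStandard_standard hS hi).jacobson_eq (standard_mkQ_one_ne_zero i)

theorem isCoatom_iff_eq_kernel {i : Words v} (hi : IsLyndonConcat i)
    (K : Submodule (T v) (Standard i)) : IsCoatom K ↔ K = kernel i := by
  rw [kernel_eq hi]
  obtain ⟨S, hS, hi⟩ := (isLyndonConcat_iff i).1 hi
  exact (isStandard_standard hS hi).isCoatom_iff (standard_mkQ_one_ne_zero i) K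

theorem isSimpleModule_L {i : Words v} (hi : IsLyndonConcat i) : IsSimpleModule (T v) (L i) :=
  isSimpleModule_iff_isCoatom.2 ((isCoatom_iff_eq_kernel hi _).2 rfl)

theorem exists_e_smul_L_ne_zero {i : Words v} (hi : IsLyndonConcat i) : ∃ x : L i, e i • x ≠ 0 := by
  refine ⟨generator i, fun h => ?_⟩
  have h1 : e i • generator i = (kernel i).mkQ (e i • (standardIdeal i).mkQ 1) :=
    ((kernel i).mkQ.map_smul _ _).symm
  have h2 := (Pres.isHighest_mkQ (P := pres v) (standardIdeal_eq i)).weight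
  have h3 : (kernel i).mkQ ((standardIdeal i).mkQ 1) = 0 := by
    rw [← h, h1]; exact congrArg _ h2.symm
  have h4 := (Submodule.Quotient.mk_eq_zero (kernel i)).1 h3
  rw [kernel_eq hi] at h4
  have h5 := h4 1
  rw [one_smul, h2] at h5
  exact standard_mkQ_one_ne_zero i h5

theorem e_smul_L_of_smaller {i : Words v} (hi : IsLyndonConcat i) {j : Words v}
    (hj : j.Smaller i) (x : L i) : e j • x = 0 := by
  obtain ⟨S, hS, hi⟩ := (isLyndonConcat_iff i).1 hi
  obtain ⟨z, rfl⟩ := (kernel i).mkQ_surjective x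
  have h := (isStandard_standard hS hi).e_smul_of_smaller hj z
  have h1 : e j • (kernel i).mkQ z = (kernel i).mkQ (e j • z) := ((kernel i).mkQ.map_smul _ _).symm
  rw [h1]
  exact (congrArg _ h).trans (map_zero _)

/-- The argument about smallest words applies to any simple module; conversely `L i` is a witness,
since its smallest word is `i`. -/
theorem isRedGood_iff (i : Words v) : IsRedGood i ↔ IsLyndonConcat i := by
  constructor
  · rintro ⟨N, _, _, _, ⟨x, hx⟩, hmin⟩
    refine (isLyndonConcat_iff i).2 (Pres.exists_lyn_of_minimal (P := pres v) (M := N)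
      (x := e i • x) (fun j hj x => ?_) ?_ hx)
    · exact Pres.e_smul_of_smaller_of_minimal (P := pres v) hmin j hj x
    · change (pres v).e i • (pres v).e i • x = (pres v).e i • x
      rw [← mul_smul, (pres v).e_mul_self]
  · intro hi
    refine ⟨L i, inferInstance, inferInstance, isSimpleModule_L hi, exists_e_smul_L_ne_zero hi,
      ?_⟩
    rintro j ⟨x, hx⟩
    rcases i.lexLT_trichotomy j with h | h | h
    · exact Or.inr h
    · exact Or.inl h
    · exact absurd (e_smul_L_of_smaller hi (Words.lexLT_iff.1 h) x) hx

theorem L_component_eq (i : Words v) :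
    L.component i = Pres.quotComponent (kernel i)
      (Pres.quotComponent (standardIdeal i) (component v)) := by
  funext d
  have h : ∀ a : T v, a • generator i = (kernel i).mkQ ((standardIdeal i).mkQ a) := by
    intro a
    have h1 : (standardIdeal i).mkQ a = a • (standardIdeal i).mkQ 1 := by
      rw [← map_smul, smul_eq_mul, mul_one]
    rw [h1]
    exact ((kernel i).mkQ.map_smul _ _).symm
  ext x
  constructor
  · rintro ⟨a, ha, rfl⟩
    exact ⟨_, ⟨a, ha, rfl⟩, (h a).symm⟩
  · rintro ⟨_, ⟨a, ha, rfl⟩, rfl⟩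
    exact ⟨a, ha, h a⟩

theorem grading_L {i : Words v} (hi : IsLyndonConcat i) :
    (pres_grading v).Module (L.component i) := by
  rw [L_component_eq]
  have hk := kernel_eq hi
  obtain ⟨S, hS, hi⟩ := (isLyndonConcat_iff i).1 hi
  refine (isStandard_standard hS hi).grading.quotient fun z hz d => ?_
  rw [hk] at hz ⊢
  exact Pres.Grading.comp_mem_radical (isStandard_standard hS hi).grading hz d

/-- The smallest word `i` of `L i` is an invariant of the ungraded module. -/
theorem eq_of_L_equiv {i j : Words v} (hi : IsLyndonConcat i) (hj : IsLyndonConcat j)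
    (f : L i ≃ₗ[T v] L j) : i = j := by
  have key : ∀ {i j : Words v}, IsLyndonConcat i → IsLyndonConcat j → (L i ≃ₗ[T v] L j) →
      ¬ i.LexLT j := by
    intro i j hi hj f h
    obtain ⟨x, hx⟩ := exists_e_smul_L_ne_zero hi
    refine hx (f.injective ?_)
    rw [map_smul, map_zero]
    exact e_smul_L_of_smaller hj (Words.lexLT_iff.1 h) _
  rcases i.lexLT_trichotomy j with h | h | h
  · exact absurd h (key hi hj f)
  · exact h
  · exact absurd h (key hj hi f.symm)

theorem decompose_eq_comp {M : Type*} [AddCommGroup M] [Module ℂ M] (ℳ : ℤ → Submodule ℂ M)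
    [DirectSum.Decomposition ℳ] (h : DirectSum.IsInternal ℳ) (x : M) (d : ℤ) :
    (DirectSum.decompose ℳ x d : M) = comp h d x := by
  induction x using DirectSum.Decomposition.inductionOn ℳ with
  | zero => simp
  | @homogeneous d' m =>
    rw [comp_of_mem h m.2]
    split_ifs with hd
    · subst hd; exact DirectSum.decompose_of_mem_same ℳ m.2
    · exact DirectSum.decompose_of_mem_ne ℳ m.2 hd
  | add x y hx hy => rw [DirectSum.decompose_add, DirectSum.add_apply, Submodule.coe_add, hx, hy,
      map_add]

theorem exists_equiv_of_isGradedSimple {M : Type*} [AddCommGroup M] [Module ℂ M] [Module (T v) M]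
    (ℳ : ℤ → Submodule ℂ M) [DirectSum.Decomposition ℳ] [SetLike.GradedSMul (component v) ℳ]
    (h : IsGradedSimple (v := v) ℳ) :
    ∃ i : Words v, IsLyndonConcat i ∧ ∃ (a : ℤ) (f : L i ≃ₗ[T v] M),
      ∀ (d : ℤ) (x : L i), x ∈ L.component i d ↔ f x ∈ ℳ (d + a) := by
  have hM : (pres_grading v).Module ℳ :=
    ⟨fun ha hx => SetLike.GradedSMul.smul_mem ha hx, DirectSum.Decomposition.isInternal ℳ⟩
  have := h.1
  obtain ⟨i, hi, a, f, hf⟩ := hM.exists_equiv (I := standardIdeal) standardIdeal_eq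
    standard_mkQ_one_ne_zero fun N hN => h.2 N fun d x hx => by
      rw [decompose_eq_comp ℳ hM.internal]
      exact hN x hx d
  refine ⟨i, (isLyndonConcat_iff i).2 hi, a, f, fun d x => ?_⟩
  rw [L_component_eq]
  exact hf d x

theorem isFiniteLength_kernel {i : Words v} (hi : IsLyndonConcat i) :
    IsFiniteLength (T v) (kernel i) := by
  obtain ⟨S, hS, hi⟩ := (isLyndonConcat_iff i).1 hi
  exact (isStandard_standard hS hi).isFiniteLength _

theorem exists_factor_equiv {i : Words v} (hi : IsLyndonConcat i)
    {N' N : Submodule (T v) (Standard i)} (hN : N ≤ kernel i)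
    (hs : IsSimpleModule (T v) (N ⧸ N'.submoduleOf N)) :
    ∃ j : Words v, IsLyndonConcat j ∧ i.LexLT j ∧
      Nonempty ((N ⧸ N'.submoduleOf N) ≃ₗ[T v] L j) := by
  rw [kernel_eq hi] at hN
  obtain ⟨S, hS, hi⟩ := (isLyndonConcat_iff i).1 hi
  have hnt : Nontrivial (N ⧸ N'.submoduleOf N) := IsSimpleModule.nontrivial (T v) _
  obtain ⟨j, hij, hmin, x, h1, h2, h3⟩ :=
    (isStandard_standard hS hi).exists_minimal_weight_factor (N' := N') hN
  refine ⟨j, (isLyndonConcat_iff j).2 (Pres.exists_lyn_of_minimal hmin h1 h2), hij, ?_⟩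
  exact Pres.nonempty_equiv_of_minimal (I := standardIdeal) standardIdeal_eq
    standard_mkQ_one_ne_zero (pres_grading v) hmin h1 h2 h3

end KLRW
end

open KLRW in
theorem mainTheorem4 (n : ℕ) (v : Fin n → ℕ) :
    -- the red-good words, described combinatorially
    (∀ i : Words v, IsRedGood i ↔ IsLyndonConcat i) ∧
    -- `L i` is the unique simple quotient of `Standard i`, and it is a graded module
    (∀ i : Words v, IsRedGood i →
      IsCoatom (kernel i) ∧
      (∀ K : Submodule (T v) (Standard i), IsCoatom K → K = kernel i) ∧
      IsSimpleModule (T v) (L i) ∧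
      DirectSum.IsInternal (L.component i) ∧
      SetLike.GradedSMul (component v) (L.component i)) ∧
    -- completeness, up to isomorphism and shift of the grading
    (∀ (M : Type*) [AddCommGroup M] [Module ℂ M] [Module (T v) M] [IsScalarTower ℂ (T v) M]
      (ℳ : ℤ → Submodule ℂ M) [DirectSum.Decomposition ℳ]
      [SetLike.GradedSMul (component v) ℳ],
      IsGradedSimple (v := v) ℳ →
      ∃ i : Words v, IsRedGood i ∧ ∃ (a : ℤ) (f : L i ≃ₗ[T v] M),
        ∀ (d : ℤ) (x : L i), x ∈ L.component i d ↔ f x ∈ ℳ (d + a)) ∧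
    -- irredundancy, even up to isomorphisms that ignore the grading
    (∀ i j : Words v, IsRedGood i → IsRedGood j → Nonempty (L i ≃ₗ[T v] L j) → i = j) ∧
    -- composition factors of the kernel of `Standard i → L i`
    (∀ i : Words v, IsRedGood i →
      IsFiniteLength (T v) (kernel i) ∧
      ∀ A B : Submodule (T v) (Standard i), A ≤ B → B ≤ kernel i →
        IsSimpleModule (T v) (B ⧸ A.submoduleOf B) →
        ∃ j : Words v, IsRedGood j ∧ i.LexLT j ∧
          Nonempty ((B ⧸ A.submoduleOf B) ≃ₗ[T v] L j)) := by
  refine ⟨isRedGood_iff, fun i hi => ?_, ?_, fun i j hi hj ⟨f⟩ => ?_, fun i hi => ?_⟩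
  · rw [isRedGood_iff] at hi
    have h := grading_L hi
    exact ⟨(isCoatom_iff_eq_kernel hi _).2 rfl, fun K => (isCoatom_iff_eq_kernel hi K).1,
      isSimpleModule_L hi, h.internal, ⟨fun _ _ _ _ ha hx => h.smul_mem ha hx⟩⟩
  · intro M _ _ _ _ ℳ _ _ h
    obtain ⟨i, hi, h⟩ := exists_equiv_of_isGradedSimple ℳ h
    exact ⟨i, (isRedGood_iff i).2 hi, h⟩
  · exact eq_of_L_equiv ((isRedGood_iff i).1 hi) ((isRedGood_iff j).1 hj) f
  · rw [isRedGood_iff] at hi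
    refine ⟨isFiniteLength_kernel hi, fun N' N _ hN hs => ?_⟩
    obtain ⟨j, hj, h⟩ := exists_factor_equiv hi hN hs
    exact ⟨j, (isRedGood_iff j).2 hj, h⟩
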